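/- Let $\Sigma$ be an oriented smooth surface (a smooth $2$-manifold without boundary). All objects are smooth. Upper signs refer to the timelike case, lower signs to the spacelike case. For a torsion-free connection $\nabla$ on $T\Sigma$ let $\mathrm{Ric}(\nabla)(X,Y)=\mathrm{tr}\,(Z\mapsto\nabla_Z\nabla_XY-\nabla_X\nabla_ZY-\nabla_{[Z,X]}Y)$, with symmetric part $\mathrm{Ric}^+(\nabla)$, and let $h_\nabla$ be the split-signature metric on $T^*\Sigma$ given in the coordinates $(x^i,\xi_i)$ induced by coordinates $x^i$ on $\Sigma$ by $$h_\nabla=-\left(d\xi_i+\xi_i\xi_j\,dx^j+\mathrm{Ric}^+_{ij}\,dx^j-\xi_k\Gamma^k_{ij}\,dx^j\right)\circ dx^i,$$ where $\circ$ is the symmetric product and $\nabla_{\partial_i}\partial_j=\Gamma^k_{ij}\partial_k$. The connection $\nabla$ is called Lagrangian if $\mathrm{Ric}(\nabla)$ is symmetric, timelike/spacelike if $\pm\mathrm{Ric}^+(\nabla)$ is positive definite, and (in the timelike/spacelike case) minimal if the zero section of $(T^*\Sigma,h_\nabla)$ has vanishing mean curvature. Consider triples $(g,\beta,C)$ of a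 Riemannian metric $g$, a $1$-form $\beta$ and a cubic differential $C\in\Gamma(K_\Sigma^3)$, where $K_\Sigma$ is the canonical bundle for the complex structure $J$ given by $g$ and the orientation, and the structure equations $$K_g=\pm1+2|C|_g^2+\delta_g\beta,\qquad \bar\partial C=(\beta-\mathrm{i}\star_g\beta)\otimes C,\qquad d\beta=0 .$$ Here $K_g$ is the Gauss curvature, $\delta_g$ the co-differential, $\star_g$ the Hodge star ($\star_g\beta=-\beta\circ J$), and $|C|_g^2=|c|^2$ if $C=c\,(\omega_1+\mathrm{i}\omega_2)^3$ for an oriented $g$-orthonormal coframe $(\omega_1,\omega_2)$. For either sign, there is a one-to-one correspondence between the torsion-free timelike/spacelike minimal Lagrangian connections $\nabla$ on $T\Sigma$ and the triples $(g,\beta,C)$ that satisfy the structure equations, given as follows. 1. The connection $\nabla$ is sent to the triple with $$g=\pm\mathrm{Ric}(\nabla),\qquad \beta=\tfrac38\,\mathrm{tr}_g\,\mathrm{Sym}\nabla g,\qquad \mathrm{Re}(C)=-\tfrac12\,\mathrm{Sym}_0\nabla g,$$ where $\mathrm{Sym}$ is the projection onto totally symmetric $3$-tensors and $\mathrm{Sym}_0\nabla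 g$ is the $g$-trace-free part of $\mathrm{Sym}\nabla g$. 2. Conversely, the triple $(g,\beta,C)$ is sent to the connection $$\nabla={}^g\nabla+g\otimes\beta^\sharp-\beta\otimes\mathrm{Id}-\mathrm{Id}\otimes\beta+\alpha,\qquad g(\alpha(X)Y,Z)=\mathrm{Re}(C)(X,Y,Z),$$ where ${}^g\nabla$ is the Levi-Civita connection of $g$. Equivalently, on the bundle of oriented $g$-orthonormal coframes, with Levi-Civita form $\varphi$ and $C=(c_1+\mathrm{i}c_2)(\omega_1+\mathrm{i}\omega_2)^3$, its connection form is $$\theta=\begin{pmatrix}-\beta&\star_g\beta-\varphi\\ \varphi-\star_g\beta&-\beta\end{pmatrix}+\begin{pmatrix}c_1\omega_1-c_2\omega_2&-c_2\omega_1-c_1\omega_2\\-c_2\omega_1-c_1\omega_2&-c_1\omega_1+c_2\omega_2\end{pmatrix}.$$ This connection is a torsion-free timelike/spacelike minimal Lagrangian connection with $\mathrm{Ric}(\nabla)=\pm g$, and the two maps are inverse to each other. -/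

import Mathlib

open Bundle
open scoped Manifold ContDiff

noncomputable section

/-! ## Tensor calculus in coordinates

Tensor fields on (open subsets of) a coordinate space `ℝ^ι` are given by their component functions.
Christoffel symbols are written `Γ k i j` for `Γ^k_{ij}`, so that `∇_{∂_i} ∂_j = Γ^k_{ij} ∂_k`. -/

/-- The coordinate plane. -/
abbrev Plane : Type := EuclideanSpace ℝ (Fin 2)

/-- Partial derivative `∂f/∂x^i`. -/
def pderiv {ι F : Type*} [Fintype ι] [DecidableEq ι] [NormedAddCommGroup F] [NormedSpace ℝ F]
    (i : ι) (f : EuclideanSpace ℝ ι → F) (x : EuclideanSpace ℝ ι) : F :=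
  fderiv ℝ f x (EuclideanSpace.single i 1)

/-- Christoffel symbols of the Levi-Civita connection of the (pseudo-)Riemannian metric `G`. -/
def leviCivita {ι : Type*} [Fintype ι] [DecidableEq ι]
    (G : EuclideanSpace ℝ ι → Matrix ι ι ℝ) (k i j : ι) (x : EuclideanSpace ℝ ι) : ℝ :=
  1 / 2 * ∑ l, (G x)⁻¹ k l *
    (pderiv i (fun y => G y j l) x + pderiv j (fun y => G y i l) x - pderiv l (fun y => G y i j) x)

/-- Curvature `R(∂_i, ∂_j) ∂_k = ∇_i ∇_j ∂_k - ∇_j ∇_i ∂_k = R^l_{ijk} ∂_l` of the connection with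
Christoffel symbols `Γ`. -/
def curvature {ι : Type*} [Fintype ι] [DecidableEq ι]
    (Γ : ι → ι → ι → EuclideanSpace ℝ ι → ℝ) (l i j k : ι) (x : EuclideanSpace ℝ ι) : ℝ :=
  pderiv i (Γ l j k) x - pderiv j (Γ l i k) x
    + ∑ m, (Γ m j k x * Γ l i m x - Γ m i k x * Γ l j m x)

/-- Ricci curvature
`Ric(X, Y) = tr (Z ↦ ∇_Z ∇_X Y - ∇_X ∇_Z Y - ∇_{[Z,X]} Y)`, with components `Ric(∂_i, ∂_j)`. -/
def ricci {ι : Type*} [Fintype ι] [DecidableEq ι]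
    (Γ : ι → ι → ι → EuclideanSpace ℝ ι → ℝ) (x : EuclideanSpace ℝ ι) : Matrix ι ι ℝ :=
  Matrix.of fun i j => ∑ k, curvature Γ k k i j x

/-- The symmetric part of the Ricci curvature. -/
def ricciSymm {ι : Type*} [Fintype ι] [DecidableEq ι]
    (Γ : ι → ι → ι → EuclideanSpace ℝ ι → ℝ) (x : EuclideanSpace ℝ ι) : Matrix ι ι ℝ :=
  (1 / 2 : ℝ) • (ricci Γ x + (ricci Γ x).transpose)

/-- The metric induced by the (pseudo-)Riemannian metric `h` along the map `F`. -/
def pullbackMetric {κ ι : Type*} [Fintype κ] [DecidableEq κ] [Fintype ι]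
    (h : EuclideanSpace ℝ ι → Matrix ι ι ℝ) (F : EuclideanSpace ℝ κ → EuclideanSpace ℝ ι)
    (x : EuclideanSpace ℝ κ) : Matrix κ κ ℝ :=
  Matrix.of fun a b => ∑ μ, ∑ ν,
    h (F x) μ ν * pderiv a (fun y => F y μ) x * pderiv b (fun y => F y ν) x

/-- The second fundamental form of the immersion `F` into `(ℝ^ι, h)`, by the Gauss formula
`II(∂_a, ∂_b) = D_{∂_a} (dF ∂_b) - dF (∇_{∂_a} ∂_b)`, where `D` and `∇` are the Levi-Civita
connections of `h` and of the induced metric. -/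
def secondFundamentalForm {κ ι : Type*} [Fintype κ] [DecidableEq κ] [Fintype ι] [DecidableEq ι]
    (h : EuclideanSpace ℝ ι → Matrix ι ι ℝ) (F : EuclideanSpace ℝ κ → EuclideanSpace ℝ ι)
    (μ : ι) (a b : κ) (x : EuclideanSpace ℝ κ) : ℝ :=
  pderiv a (pderiv b (fun y => F y μ)) x
    + ∑ ν, ∑ ρ, leviCivita h μ ν ρ (F x)
        * pderiv a (fun y => F y ν) x * pderiv b (fun y => F y ρ) x
    - ∑ c, leviCivita (pullbackMetric h F) c a b x * pderiv c (fun y => F y μ) x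

/-- The mean curvature vector of the immersion `F` into `(ℝ^ι, h)`: the trace of the second
fundamental form with respect to the induced metric, divided by the dimension. -/
def meanCurvature {κ ι : Type*} [Fintype κ] [DecidableEq κ] [Fintype ι] [DecidableEq ι]
    (h : EuclideanSpace ℝ ι → Matrix ι ι ℝ) (F : EuclideanSpace ℝ κ → EuclideanSpace ℝ ι)
    (μ : ι) (x : EuclideanSpace ℝ κ) : ℝ :=
  (Fintype.card κ : ℝ)⁻¹ *
    ∑ a, ∑ b, (pullbackMetric h F x)⁻¹ a b * secondFundamentalForm h F μ a b x

/-! ## The metric on the cotangent bundle -/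

/-- The neutral metric `h_∇` on the cotangent bundle, in the coordinates `(x^i, ξ_i)` (the `x^i` are
indexed by `Sum.inl`, the `ξ_i` by `Sum.inr`) induced by coordinates `x^i` on the surface:
`h_∇ = -(dξ_i + ξ_i ξ_j dx^j + Ric⁺_{ij} dx^j - ξ_k Γ^k_{ij} dx^j) ∘ dx^i`,
with `∘` the symmetric product `α ∘ β = (α ⊗ β + β ⊗ α) / 2`. -/
def cotangentMetric (Γ : Fin 2 → Fin 2 → Fin 2 → Plane → ℝ)
    (z : EuclideanSpace ℝ (Fin 2 ⊕ Fin 2)) : Matrix (Fin 2 ⊕ Fin 2) (Fin 2 ⊕ Fin 2) ℝ :=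
  let x : Plane := WithLp.toLp 2 fun i => z (Sum.inl i)
  let ξ : Fin 2 → ℝ := fun i => z (Sum.inr i)
  Matrix.fromBlocks
    (Matrix.of fun i j =>
      -(ξ i * ξ j + ricciSymm Γ x i j - ∑ k, ξ k * ((Γ k i j x + Γ k j i x) / 2)))
    (-(1 / 2 : ℝ) • 1) (-(1 / 2 : ℝ) • 1) 0

/-- The zero section of the cotangent bundle, in induced coordinates. -/
def zeroSection (x : Plane) : EuclideanSpace ℝ (Fin 2 ⊕ Fin 2) :=
  WithLp.toLp 2 (Sum.elim (fun i => x i) fun _ => 0)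

/-! ## Surface geometry in oriented coordinates -/

/-- Gauss curvature `g(R(∂_1, ∂_2) ∂_2, ∂_1) / (g_11 g_22 - g_12 ^ 2)`. -/
def gaussCurvature (G : Plane → Matrix (Fin 2) (Fin 2) ℝ) (x : Plane) : ℝ :=
  (∑ l, G x 0 l * curvature (leviCivita G) l 0 1 1 x) / (G x).det

/-- Rotation by `+90°`: `complexStructure G m a` is the component `J^m_a`, that is,
`J ∂_a = J^m_a ∂_m`, for the metric `G` and the orientation given by `(∂_1, ∂_2)`. -/
def complexStructure (G : Plane → Matrix (Fin 2) (Fin 2) ℝ) (m a : Fin 2) (x : Plane) : ℝ :=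
  (Real.sqrt (G x).det)⁻¹ * !![-G x 0 1, -G x 1 1; G x 0 0, G x 0 1] m a

/-- Hodge star on `1`-forms, `⋆β = -β ∘ J` (so `⋆ω¹ = ω²`, `⋆ω² = -ω¹` for an oriented orthonormal
coframe `(ω¹, ω²)`). -/
def hodgeStar (G : Plane → Matrix (Fin 2) (Fin 2) ℝ) (β : Fin 2 → Plane → ℝ)
    (a : Fin 2) (x : Plane) : ℝ :=
  -∑ m, β m x * complexStructure G m a x

/-- Co-differential of a `1`-form, `δβ = -g^{ij} ∇_i β_j`. -/
def codifferential (G : Plane → Matrix (Fin 2) (Fin 2) ℝ) (β : Fin 2 → Plane → ℝ)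
    (x : Plane) : ℝ :=
  -∑ i, ∑ j, (G x)⁻¹ i j * (pderiv i (β j) x - ∑ k, leviCivita G k i j x * β k x)

/-- The squared norm `|C|²` of a cubic differential with respect to the Hermitian metric induced by
`g`: if `C = c ω³` with `ω = ω¹ + i ω²` for an oriented orthonormal coframe, then `|C|² = |c|²`.
Equivalently `|C|² = |C(v, v, v)|² / g(v, v)³` for every `v ≠ 0`; here `v = ∂_1`. -/
def cubicNormSq (G : Plane → Matrix (Fin 2) (Fin 2) ℝ)
    (C : Fin 2 → Fin 2 → Fin 2 → Plane → ℂ) (x : Plane) : ℝ :=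
  Complex.normSq (C 0 0 0 x) / G x 0 0 ^ 3

/-- The del-bar operator on cubic differentials. For a cubic differential `C`, `∂̄C` is the
`K³`-valued `(0,1)`-form `X ↦ (L_X C + i L_{JX} C) / 2`, with `L` the Lie derivative; the components
for `X = ∂_a` are given. In a holomorphic coordinate `z`, where the components of `J` are constant,
it sends `c dz³` to `∂c/∂z̄ dz̄ ⊗ dz³`. -/
def delbar (G : Plane → Matrix (Fin 2) (Fin 2) ℝ) (C : Fin 2 → Fin 2 → Fin 2 → Plane → ℂ)
    (a i j k : Fin 2) (x : Plane) : ℂ :=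
  (1 / 2 : ℂ) * (pderiv a (C i j k) x + Complex.I * ∑ m,
    ((complexStructure G m a x : ℂ) * pderiv m (C i j k) x
      + ((pderiv i (complexStructure G m a) x : ℝ) : ℂ) * C m j k x
      + ((pderiv j (complexStructure G m a) x : ℝ) : ℂ) * C i m k x
      + ((pderiv k (complexStructure G m a) x : ℝ) : ℂ) * C i j m x))

/-- The components `(∇_{∂_k} g)(∂_i, ∂_j)`. -/
def covDerivMetric (Γ : Fin 2 → Fin 2 → Fin 2 → Plane → ℝ) (G : Plane → Matrix (Fin 2) (Fin 2) ℝ)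
    (k i j : Fin 2) (x : Plane) : ℝ :=
  pderiv k (fun y => G y i j) x - ∑ l, (Γ l k i x * G x l j + Γ l k j x * G x i l)

/-- The projection `Sym` onto totally symmetric `3`-tensors. -/
def sym3 (T : Fin 2 → Fin 2 → Fin 2 → ℝ) (i j k : Fin 2) : ℝ :=
  (T i j k + T i k j + T j i k + T j k i + T k i j + T k j i) / 6

/-- The trace `S ↦ (g^{ij} S_{ijk})_k` of a symmetric `3`-tensor. -/
def trace3 (g : Matrix (Fin 2) (Fin 2) ℝ) (S : Fin 2 → Fin 2 → Fin 2 → ℝ) (k : Fin 2) : ℝ :=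
  ∑ i, ∑ j, g⁻¹ i j * S i j k

/-- The trace-free part of a symmetric `3`-tensor (in dimension two). -/
def traceFree3 (g : Matrix (Fin 2) (Fin 2) ℝ) (S : Fin 2 → Fin 2 → Fin 2 → ℝ)
    (i j k : Fin 2) : ℝ :=
  S i j k - 1 / 4 * (g i j * trace3 g S k + g j k * trace3 g S i + g i k * trace3 g S j)

/-! ## Oriented surfaces, connections and triples -/

/-- The charts of the atlas form an oriented atlas: all coordinate changes have positive Jacobian.
The surface carries the orientation for which the charts of the atlas are positively oriented. -/
class OrientedAtlas (M : Type*) [TopologicalSpace M] [ChartedSpace Plane M] : Prop where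
  det_pos : ∀ e ∈ atlas Plane M, ∀ e' ∈ atlas Plane M, ∀ x ∈ (e.symm.trans e').source,
    0 < (fderiv ℝ (e.symm.trans e') x).det

section Surface

variable {M : Type*} [TopologicalSpace M] [ChartedSpace Plane M]

/-- The coordinate vector field `∂_i` of the chart `e` (meaningful on `e.source`). -/
def coordField (e : OpenPartialHomeomorph M Plane) (i : Fin 2) (p : M) : TangentSpace (𝓡 2) p :=
  (mfderiv (𝓡 2) (𝓡 2) e p).inverse (EuclideanSpace.single i 1 : Plane)

variable [IsManifold (𝓡 2) ∞ M]

variable (M) in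
/-- A smooth connection on the tangent bundle. Mathlib's covariant derivatives also act on sections
that are not differentiable, where their values are arbitrary; the last field fixes these
meaningless values, so that two connections are equal iff they agree on differentiable sections. -/
structure AffineConnection where
  cov : CovariantDerivative (𝓡 2) Plane (TangentSpace (𝓡 2) : M → Type _)
  smooth : CovariantDerivative.ContMDiffCovariantDerivative cov ∞
  eq_zero_of_not_mdifferentiableAt : ∀ (σ : Π p : M, TangentSpace (𝓡 2) p) (p : M),
    ¬ MDifferentiableAt (𝓡 2) ((𝓡 2).prod 𝓘(ℝ, Plane))
      (fun q => (⟨q, σ q⟩ : TotalSpace Plane (TangentSpace (𝓡 2) : M → Type _))) p →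
    cov σ p = 0

/-- Christoffel symbols `Γ^k_{ij} = dx^k (∇_{∂_i} ∂_j)` of a connection in the chart `e`, as
functions of the coordinates (meaningful on `e.target`). -/
def AffineConnection.christoffel (D : AffineConnection M) (e : OpenPartialHomeomorph M Plane)
    (k i j : Fin 2) (x : Plane) : ℝ :=
  let v : Plane := mfderiv (𝓡 2) (𝓡 2) e (e.symm x)
    (D.cov (coordField e j) (e.symm x) (coordField e i (e.symm x)))
  v k

/-- The connection is torsion-free. -/
def AffineConnection.IsTorsionFree (D : AffineConnection M) : Prop := D.cov.torsion = 0

/-- The connection is Lagrangian: the Ricci tensor is symmetric. -/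
def AffineConnection.IsLagrangian (D : AffineConnection M) : Prop :=
  ∀ e ∈ atlas Plane M, ∀ x ∈ e.target, (ricci (D.christoffel e) x).IsSymm

/-- The two causal types. -/
inductive CausalType
  | timelike
  | spacelike

/-- The sign `±1`, `+1` for timelike and `-1` for spacelike. -/
def CausalType.sign : CausalType → ℝ
  | timelike => 1
  | spacelike => -1

/-- The connection is timelike (`Ric⁺` positive definite) or spacelike (`-Ric⁺` positive
definite). -/
def AffineConnection.IsOfType (D : AffineConnection M) (τ : CausalType) : Prop :=
  ∀ e ∈ atlas Plane M, ∀ x ∈ e.target, (τ.sign • ricciSymm (D.christoffel e) x).PosDef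

/-- The connection is minimal: the zero section of `(T^*M, h_∇)` has vanishing mean curvature. -/
def AffineConnection.IsMinimal (D : AffineConnection M) : Prop :=
  ∀ e ∈ atlas Plane M, ∀ x ∈ e.target, ∀ μ,
    meanCurvature (cotangentMetric (D.christoffel e)) zeroSection μ x = 0

/-- Torsion-free minimal Lagrangian connections of causal type `τ`. -/
structure AffineConnection.IsMinimalLagrangian (D : AffineConnection M) (τ : CausalType) :
    Prop where
  torsionFree : D.IsTorsionFree
  lagrangian : D.IsLagrangian
  ofType : D.IsOfType τ
  minimal : D.IsMinimal

/-- Components of a Riemannian metric in the chart `e`. -/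
def metricComp
    (g : ContMDiffRiemannianMetric (𝓡 2) ∞ Plane (TangentSpace (𝓡 2) : M → Type _))
    (e : OpenPartialHomeomorph M Plane) (x : Plane) : Matrix (Fin 2) (Fin 2) ℝ :=
  Matrix.of fun i j =>
    g.inner (e.symm x) (coordField e i (e.symm x)) (coordField e j (e.symm x))

variable (M) in
/-- A triple `(g, β, C)` of a Riemannian metric, a `1`-form and a cubic differential: `C` is a smooth
complex-valued real-trilinear form on the tangent spaces that is complex linear in each argument
with respect to the complex structure `J` of `g` and the orientation, i.e. a smooth section of `K³`.
Smoothness of `C` means that its components in the charts are smooth. -/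
structure SurfaceTriple where
  g : ContMDiffRiemannianMetric (𝓡 2) ∞ Plane (TangentSpace (𝓡 2) : M → Type _)
  β : ContMDiffSection (𝓡 2) (Plane →L[ℝ] ℝ) ∞ fun p : M => TangentSpace (𝓡 2) p →L[ℝ] ℝ
  C : ∀ p : M,
    TangentSpace (𝓡 2) p →L[ℝ] TangentSpace (𝓡 2) p →L[ℝ] TangentSpace (𝓡 2) p →L[ℝ] ℂ
  smooth_C : ∀ e ∈ atlas Plane M, ∀ i j k : Fin 2,
    ContDiffOn ℝ ∞ (fun x => C (e.symm x) (coordField e i (e.symm x)) (coordField e j (e.symm x))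
      (coordField e k (e.symm x))) e.target
  complexTrilinear : ∀ e ∈ atlas Plane M, ∀ x ∈ e.target, ∀ u v w : Fin 2,
    let J : Fin 2 → TangentSpace (𝓡 2) (e.symm x) := fun a =>
      ∑ m, complexStructure (metricComp g e) m a x • coordField e m (e.symm x)
    let d : Fin 2 → TangentSpace (𝓡 2) (e.symm x) := fun a => coordField e a (e.symm x)
    C (e.symm x) (J u) (d v) (d w) = Complex.I * C (e.symm x) (d u) (d v) (d w) ∧
    C (e.symm x) (d u) (J v) (d w) = Complex.I * C (e.symm x) (d u) (d v) (d w) ∧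
    C (e.symm x) (d u) (d v) (J w) = Complex.I * C (e.symm x) (d u) (d v) (d w)

namespace SurfaceTriple

variable (T : SurfaceTriple M) (e : OpenPartialHomeomorph M Plane)

/-- Components of `g` in the chart `e`. -/
def gComp (x : Plane) : Matrix (Fin 2) (Fin 2) ℝ := metricComp T.g e x

/-- Components of `β` in the chart `e`. -/
def βComp (i : Fin 2) (x : Plane) : ℝ := T.β (e.symm x) (coordField e i (e.symm x))

/-- Components of `C` in the chart `e`. -/
def CComp (i j k : Fin 2) (x : Plane) : ℂ :=
  T.C (e.symm x) (coordField e i (e.symm x)) (coordField e j (e.symm x))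
    (coordField e k (e.symm x))

/-- The structure equations `K_g = ±1 + 2 |C|² + δ_g β`, `∂̄C = (β - i ⋆β) ⊗ C`, `dβ = 0`. -/
structure StructureEquations (τ : CausalType) : Prop where
  gauss : ∀ e ∈ atlas Plane M, ∀ x ∈ e.target,
    gaussCurvature (T.gComp e) x =
      τ.sign + 2 * cubicNormSq (T.gComp e) (T.CComp e) x
        + codifferential (T.gComp e) (T.βComp e) x
  delbar_eq : ∀ e ∈ atlas Plane M, ∀ x ∈ e.target, ∀ a i j k,
    delbar (T.gComp e) (T.CComp e) a i j k x =
      ((T.βComp e a x : ℂ) - Complex.I * (hodgeStar (T.gComp e) (T.βComp e) a x : ℂ))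
        * T.CComp e i j k x
  closed : ∀ e ∈ atlas Plane M, ∀ x ∈ e.target, ∀ i j,
    pderiv i (T.βComp e j) x = pderiv j (T.βComp e i) x

/-- `T = (g, β, C)` is the triple of the connection `∇`: `g = ±Ric(∇)`,
`β = 3/8 tr_g Sym ∇g` and `Re C = -1/2 Sym₀ ∇g`. -/
structure IsInducedBy (D : AffineConnection M) (τ : CausalType) : Prop where
  metric : ∀ e ∈ atlas Plane M, ∀ x ∈ e.target,
    T.gComp e x = τ.sign • ricci (D.christoffel e) x
  oneForm : ∀ e ∈ atlas Plane M, ∀ x ∈ e.target, ∀ k,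
    T.βComp e k x = 3 / 8 * trace3 (T.gComp e x)
      (sym3 fun a b c => covDerivMetric (D.christoffel e) (T.gComp e) a b c x) k
  cubic : ∀ e ∈ atlas Plane M, ∀ x ∈ e.target, ∀ i j k,
    (T.CComp e i j k x).re = -(1 / 2) * traceFree3 (T.gComp e x)
      (sym3 fun a b c => covDerivMetric (D.christoffel e) (T.gComp e) a b c x) i j k

/-- The connection `∇` is the twisted conformal connection of the triple `(g, β, C)`:
`∇ = ∇^g + g ⊗ β^♯ - β ⊗ Id - Id ⊗ β + α`, where `g(α(X) Y, Z) = Re C(X, Y, Z)`. -/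
def IsTwistedConnection (D : AffineConnection M) : Prop :=
  ∀ e ∈ atlas Plane M, ∀ x ∈ e.target, ∀ k i j : Fin 2,
    D.christoffel e k i j x =
      leviCivita (T.gComp e) k i j x
        + T.gComp e x i j * ∑ l, (T.gComp e x)⁻¹ k l * T.βComp e l x
        - T.βComp e i x * (1 : Matrix (Fin 2) (Fin 2) ℝ) k j
        - (1 : Matrix (Fin 2) (Fin 2) ℝ) k i * T.βComp e j x
        + ∑ l, (T.gComp e x)⁻¹ k l * (T.CComp e i j l x).re

end SurfaceTriple

end Surface

end

/-!
Both directions of the correspondence are local: in a chart a triple `(g, β, C)` and a connection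
are given by functions, and the work is to compare these functions and to glue.

*In a chart.* A connection that differs from the Levi-Civita connection of `g` by
`g ⊗ β^♯ - β ⊗ Id - Id ⊗ β + α` (`twistTensor`), where `α` is `Re C` with an index raised, has Ricci
tensor `(K_g - δ_g β - 2 |C|²) g + dβ + (div - 2 β^♯ ⌟) Re C` (`ricci_twisted`). The three terms are
the trace, the antisymmetric and the trace-free symmetric part. As the complex structure is
parallel, `∂̄C = (β - i ⋆β) ⊗ C` says that the `K³`-valued `1`-form `∇C - 2 β ⊗ C` is of type
`(1,0)`, and this holds iff the real part of its divergence vanishes (`typeOneZero_iff_divergence`,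
`delbar_eq_iff`). So the structure equations say exactly that `Ric(∇) = ±g` (`ricci_eq_smul_iff`).

If `Ric⁺(∇) = s g` with `s = ±1`, the zero section of `(T^*Σ, h_∇)` carries a multiple of the metric
`g`, and its mean curvature vanishes iff the difference `A` between `∇` and the Levi-Civita
connection of `g` has vanishing `g`-trace in its lower indices
(`meanCurvature_zeroSection_eq_zero_iff`). A symmetric `A` has this property iff it is a
`twistTensor`: the trace of `A` over the upper and a lower index gives `β`, and the rest, with its
index lowered, is totally symmetric and trace-free, that is, the real part of a cubic form
(`exists_twistTensor`, `isComplexCubic_complexCubic`). Hence minimal Lagrangian connections are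
twisted, and `∇g = 2 β ⊗ g - 2 Re C` (`covDerivMetric_twisted`) recovers `β` and `C` from the trace
and the trace-free part of `Sym ∇g`.

*Gluing.* Christoffel symbols, metrics, `1`-forms and cubic forms on the surface are the same as
families of functions on the charts that obey the transformation laws (`exists_affineConnection`,
`exists_metric`, `exists_oneForm`, `exists_trilinear`, and `ext_of_christoffel`, `ext_of_comp` for
uniqueness). The formulas above are natural under changes of coordinates. This gives the twisted
connection of a triple (`exists_isTwistedConnection`) and the triple of a minimal Lagrangian
connection (`exists_triple`), both unique, and each undoes the other.
-/

/-! ### Calculus with coordinate derivatives -/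

section PartialDerivatives

variable {ι F : Type*} [Fintype ι] [DecidableEq ι] [NormedAddCommGroup F] [NormedSpace ℝ F]
  {x : EuclideanSpace ℝ ι} {U : Set (EuclideanSpace ℝ ι)}

theorem pderiv_add (i : ι) {f g : EuclideanSpace ℝ ι → F} (hf : DifferentiableAt ℝ f x)
    (hg : DifferentiableAt ℝ g x) :
    pderiv i (fun y => f y + g y) x = pderiv i f x + pderiv i g x := by
  simp [pderiv, fderiv_fun_add hf hg]

theorem pderiv_sub (i : ι) {f g : EuclideanSpace ℝ ι → F} (hf : DifferentiableAt ℝ f x)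
    (hg : DifferentiableAt ℝ g x) :
    pderiv i (fun y => f y - g y) x = pderiv i f x - pderiv i g x := by
  simp [pderiv, fderiv_fun_sub hf hg]

theorem pderiv_mul {A : Type*} [NormedCommRing A] [NormedAlgebra ℝ A] (i : ι)
    {f g : EuclideanSpace ℝ ι → A} (hf : DifferentiableAt ℝ f x) (hg : DifferentiableAt ℝ g x) :
    pderiv i (fun y => f y * g y) x = pderiv i f x * g x + f x * pderiv i g x := by
  simp [pderiv, fderiv_fun_mul hf hg]
  ring

theorem pderiv_neg (i : ι) (f : EuclideanSpace ℝ ι → F) :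
    pderiv i (fun y => -f y) x = -pderiv i f x := by
  simp [pderiv]

theorem pderiv_const (i : ι) (c : F) : pderiv i (fun _ => c) x = 0 := by
  simp [pderiv]

theorem pderiv_const_mul {A : Type*} [NormedCommRing A] [NormedAlgebra ℝ A] (i : ι) (c : A)
    {f : EuclideanSpace ℝ ι → A} (hf : DifferentiableAt ℝ f x) :
    pderiv i (fun y => c * f y) x = c * pderiv i f x := by
  rw [pderiv_mul i (differentiableAt_const c) hf, pderiv_const]
  simp

theorem fin_two_cases (i : Fin 2) : i = 0 ∨ i = 1 := by omega

theorem pderiv_congr (i : ι) {f g : EuclideanSpace ℝ ι → F} (hU : IsOpen U) (hx : x ∈ U)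
    (h : ∀ y ∈ U, f y = g y) : pderiv i f x = pderiv i g x := by
  have : f =ᶠ[nhds x] g := Filter.eventuallyEq_of_mem (hU.mem_nhds hx) h
  simp [pderiv, this.fderiv_eq]

theorem contDiffOn_pderiv {f : EuclideanSpace ℝ ι → F} (hf : ContDiffOn ℝ ∞ f U) (hU : IsOpen U)
    (i : ι) : ContDiffOn ℝ ∞ (pderiv i f) U :=
  (hf.fderiv_of_isOpen hU (by simp)).clm_apply contDiffOn_const

omit [DecidableEq ι] in
theorem ContDiffOn.differentiableAt_of_mem {f : EuclideanSpace ℝ ι → F} (hf : ContDiffOn ℝ ∞ f U)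
    (hU : IsOpen U) (hx : x ∈ U) : DifferentiableAt ℝ f x :=
  (hf.contDiffAt (hU.mem_nhds hx)).differentiableAt (by simp)

theorem pderiv_pderiv_comm {f : EuclideanSpace ℝ ι → F} (hf : ContDiffOn ℝ ∞ f U)
    (hU : IsOpen U) (hx : x ∈ U) (i j : ι) :
    pderiv i (pderiv j f) x = pderiv j (pderiv i f) x := by
  have hd : DifferentiableAt ℝ (fderiv ℝ f) x :=
    (hf.fderiv_of_isOpen hU (m := ∞) (by simp)).differentiableAt_of_mem hU hx
  have hs : IsSymmSndFDerivAt ℝ f x :=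
    (hf.contDiffAt (hU.mem_nhds hx)).isSymmSndFDerivAt
      (by simpa using WithTop.coe_le_coe.2 (le_top : (2 : ℕ∞) ≤ ⊤))
  have key : ∀ a b : ι, pderiv a (pderiv b f) x =
      fderiv ℝ (fderiv ℝ f) x (EuclideanSpace.single a 1) (EuclideanSpace.single b 1) := by
    intro a b
    unfold pderiv
    rw [fderiv_clm_apply hd (differentiableAt_const _)]
    simp
  rw [key, key]
  exact hs _ _

end PartialDerivatives

/-! ### Metrics in coordinates and their Levi-Civita connection -/

/-- `G` gives the components of a smooth Riemannian metric on the coordinate domain `U`. -/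
structure IsMetricOn (G : Plane → Matrix (Fin 2) (Fin 2) ℝ) (U : Set Plane) : Prop where
  smooth : ∀ i j, ContDiffOn ℝ ∞ (fun y => G y i j) U
  posDef : ∀ y ∈ U, (G y).PosDef

theorem Matrix.PosDef.apply_comm {n : Type*} {A : Matrix n n ℝ} (h : A.PosDef) (i j : n) :
    A i j = A j i := by
  simpa using (h.isHermitian.apply j i)

theorem Matrix.inv_apply_zero_zero (A : Matrix (Fin 2) (Fin 2) ℝ) : A⁻¹ 0 0 = A 1 1 / A.det := by
  simp [Matrix.inv_def, Matrix.adjugate_fin_two, Ring.inverse_eq_inv, div_eq_inv_mul]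

theorem Matrix.inv_apply_zero_one (A : Matrix (Fin 2) (Fin 2) ℝ) : A⁻¹ 0 1 = -A 0 1 / A.det := by
  simp [Matrix.inv_def, Matrix.adjugate_fin_two, Ring.inverse_eq_inv, div_eq_inv_mul]

theorem Matrix.inv_apply_one_zero (A : Matrix (Fin 2) (Fin 2) ℝ) : A⁻¹ 1 0 = -A 1 0 / A.det := by
  simp [Matrix.inv_def, Matrix.adjugate_fin_two, Ring.inverse_eq_inv, div_eq_inv_mul]

theorem Matrix.inv_apply_one_one (A : Matrix (Fin 2) (Fin 2) ℝ) : A⁻¹ 1 1 = A 0 0 / A.det := by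
  simp [Matrix.inv_def, Matrix.adjugate_fin_two, Ring.inverse_eq_inv, div_eq_inv_mul]

namespace IsMetricOn

variable {G : Plane → Matrix (Fin 2) (Fin 2) ℝ} {U : Set Plane} {x : Plane}

theorem comm (h : IsMetricOn G U) (hx : x ∈ U) (i j : Fin 2) : G x i j = G x j i :=
  (h.posDef x hx).apply_comm i j

theorem det_pos (h : IsMetricOn G U) (hx : x ∈ U) : 0 < (G x).det := (h.posDef x hx).det_pos

theorem det_ne_zero (h : IsMetricOn G U) (hx : x ∈ U) : (G x).det ≠ 0 := (h.det_pos hx).ne'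

theorem differentiableAt (h : IsMetricOn G U) (hU : IsOpen U) (hx : x ∈ U) (i j : Fin 2) :
    DifferentiableAt ℝ (fun y => G y i j) x := (h.smooth i j).differentiableAt_of_mem hU hx

theorem pderiv_comm (h : IsMetricOn G U) (hU : IsOpen U) (hx : x ∈ U) (k i j : Fin 2) :
    pderiv k (fun y => G y i j) x = pderiv k (fun y => G y j i) x :=
  pderiv_congr k hU hx fun _ hy => h.comm hy i j

theorem smooth_det (h : IsMetricOn G U) : ContDiffOn ℝ ∞ (fun y => (G y).det) U := by
  simp only [Matrix.det_fin_two]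
  exact ((h.smooth 0 0).mul (h.smooth 1 1)).sub ((h.smooth 0 1).mul (h.smooth 1 0))

theorem smooth_inv (h : IsMetricOn G U) (i j : Fin 2) :
    ContDiffOn ℝ ∞ (fun y => (G y)⁻¹ i j) U := by
  have hd := h.smooth_det
  have h0 : ∀ y ∈ U, (G y).det ≠ 0 := fun y hy => h.det_ne_zero hy
  rcases fin_two_cases i with rfl | rfl <;> rcases fin_two_cases j with rfl | rfl
  · simp only [Matrix.inv_apply_zero_zero]
    exact (h.smooth 1 1).div hd h0
  · simp only [Matrix.inv_apply_zero_one]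
    exact (h.smooth 0 1).neg.div hd h0
  · simp only [Matrix.inv_apply_one_zero]
    exact (h.smooth 1 0).neg.div hd h0
  · simp only [Matrix.inv_apply_one_one]
    exact (h.smooth 0 0).div hd h0

theorem sum_mul_inv (h : IsMetricOn G U) (hx : x ∈ U) (i j : Fin 2) :
    ∑ k, G x i k * (G x)⁻¹ k j = (1 : Matrix (Fin 2) (Fin 2) ℝ) i j := by
  rw [← Matrix.mul_apply, Matrix.mul_nonsing_inv _ (isUnit_iff_ne_zero.mpr (h.det_ne_zero hx))]

theorem sum_inv_mul (h : IsMetricOn G U) (hx : x ∈ U) (i j : Fin 2) :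
    ∑ k, (G x)⁻¹ i k * G x k j = (1 : Matrix (Fin 2) (Fin 2) ℝ) i j := by
  rw [← Matrix.mul_apply, Matrix.nonsing_inv_mul _ (isUnit_iff_ne_zero.mpr (h.det_ne_zero hx))]

theorem smooth_leviCivita (h : IsMetricOn G U) (hU : IsOpen U) (k i j : Fin 2) :
    ContDiffOn ℝ ∞ (leviCivita G k i j) U := by
  unfold leviCivita
  refine contDiffOn_const.mul (ContDiffOn.sum fun l _ => (h.smooth_inv k l).mul ?_)
  exact ((contDiffOn_pderiv (h.smooth _ _) hU _).add (contDiffOn_pderiv (h.smooth _ _) hU _)).sub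
    (contDiffOn_pderiv (h.smooth _ _) hU _)

theorem leviCivita_comm (h : IsMetricOn G U) (hU : IsOpen U) (hx : x ∈ U) (k i j : Fin 2) :
    leviCivita G k i j x = leviCivita G k j i x := by
  unfold leviCivita
  simp only [h.pderiv_comm hU hx _ i j]
  congr 1
  exact Finset.sum_congr rfl fun l _ => by ring

theorem sum_mul_leviCivita (h : IsMetricOn G U) (hx : x ∈ U) (m i j : Fin 2) :
    ∑ k, G x m k * leviCivita G k i j x = 1 / 2 *
      (pderiv i (fun y => G y j m) x + pderiv j (fun y => G y i m) x
        - pderiv m (fun y => G y i j) x) := by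
  have h0 := h.sum_mul_inv hx m 0
  have h1 := h.sum_mul_inv hx m 1
  simp only [leviCivita, Fin.sum_univ_two] at h0 h1 ⊢
  have e : ∀ f : Fin 2 → ℝ, f m = (1 : Matrix (Fin 2) (Fin 2) ℝ) m 0 * f 0
      + (1 : Matrix (Fin 2) (Fin 2) ℝ) m 1 * f 1 := by
    intro f
    rcases fin_two_cases m with rfl | rfl <;> simp
  rw [e fun m => pderiv i (fun y => G y j m) x + pderiv j (fun y => G y i m) x
    - pderiv m (fun y => G y i j) x, ← h0, ← h1]
  ring

/-- The Levi-Civita connection is metric. -/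
theorem pderiv_eq_leviCivita (h : IsMetricOn G U) (hU : IsOpen U) (hx : x ∈ U) (k i j : Fin 2) :
    pderiv k (fun y => G y i j) x =
      ∑ l, (leviCivita G l k i x * G x l j + leviCivita G l k j x * G x i l) := by
  have h1 := h.sum_mul_leviCivita hx j k i
  have h2 := h.sum_mul_leviCivita hx i k j
  have e3 := h.pderiv_comm hU hx k i j
  simp only [Fin.sum_univ_two] at h1 h2 ⊢
  rw [h.comm hx j 0, h.comm hx j 1] at h1
  linear_combination (-1) * h1 - h2 + (1 / 2) * e3

/-- The Levi-Civita connection is the only torsion-free connection for which the metric is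
parallel. -/
theorem eq_leviCivita (h : IsMetricOn G U) (hx : x ∈ U) {L : Fin 2 → Fin 2 → Fin 2 → ℝ}
    (hL : ∀ k i j, L k i j = L k j i)
    (hG : ∀ k i j, pderiv k (fun y => G y i j) x = ∑ l, (L l k i * G x l j + L l k j * G x i l))
    (k i j : Fin 2) : L k i j = leviCivita G k i j x := by
  have h0 := h.sum_inv_mul hx k 0
  have h1 := h.sum_inv_mul hx k 1
  have e : L k i j = (1 : Matrix (Fin 2) (Fin 2) ℝ) k 0 * L 0 i j
      + (1 : Matrix (Fin 2) (Fin 2) ℝ) k 1 * L 1 i j := by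
    rcases fin_two_cases k with rfl | rfl <;> simp
  have c := h.comm hx 1 0
  rw [e, ← h0, ← h1]
  simp only [leviCivita, hG, Fin.sum_univ_two]
  rw [hL 0 j i, hL 1 j i, hL 0 0 i, hL 1 0 i, hL 0 1 i, hL 1 1 i, hL 0 0 j, hL 1 0 j, hL 0 1 j,
    hL 1 1 j]
  rw [h.comm hx j 0, h.comm hx j 1, h.comm hx i 0, h.comm hx i 1, c]
  ring

end IsMetricOn

/-! ### Curvature in dimension two -/

theorem curvature_swap (Γ : Fin 2 → Fin 2 → Fin 2 → Plane → ℝ) (l i j k : Fin 2) (x : Plane) :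
    curvature Γ l i j k x = -curvature Γ l j i k x := by
  simp only [curvature, Fin.sum_univ_two]
  ring

/-- Lowering an index, the curvature of the Levi-Civita connection is skew in the last pair. -/
theorem IsMetricOn.sum_curvature_skew {G : Plane → Matrix (Fin 2) (Fin 2) ℝ} {U : Set Plane}
    {x : Plane} (h : IsMetricOn G U) (hU : IsOpen U) (hx : x ∈ U) (i j : Fin 2) :
    ∑ l, (curvature (leviCivita G) l 0 1 i x * G x l j
      + curvature (leviCivita G) l 0 1 j x * G x i l) = 0 := by
  have hLd : ∀ k i j, DifferentiableAt ℝ (leviCivita G k i j) x := fun k i j =>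
    (h.smooth_leviCivita hU k i j).differentiableAt_of_mem hU hx
  have hGd := fun i j => h.differentiableAt hU hx i j
  have key : ∀ m k : Fin 2, pderiv m (pderiv k fun y => G y i j) x =
      ∑ l, (pderiv m (leviCivita G l k i) x * G x l j
          + leviCivita G l k i x * pderiv m (fun y => G y l j) x
        + (pderiv m (leviCivita G l k j) x * G x i l
          + leviCivita G l k j x * pderiv m (fun y => G y i l) x)) := by
    intro m k
    rw [pderiv_congr m hU hx fun y hy => h.pderiv_eq_leviCivita hU hy k i j]
    simp only [Fin.sum_univ_two]
    simp (disch := fun_prop) only [pderiv_add, pderiv_mul]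
  have hs := pderiv_pderiv_comm (h.smooth i j) hU hx 0 1
  rw [key, key] at hs
  simp only [h.pderiv_eq_leviCivita hU hx, Fin.sum_univ_two] at hs
  simp only [curvature, Fin.sum_univ_two]
  linear_combination hs

/-- In dimension two the Ricci tensor of a metric is the Gauss curvature times the metric. -/
theorem IsMetricOn.ricci_leviCivita {G : Plane → Matrix (Fin 2) (Fin 2) ℝ} {U : Set Plane}
    {x : Plane} (h : IsMetricOn G U) (hU : IsOpen U) (hx : x ∈ U) (i j : Fin 2) :
    ricci (leviCivita G) x i j = gaussCurvature G x * G x i j := by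
  have s00 := h.sum_curvature_skew hU hx 0 0
  have s01 := h.sum_curvature_skew hU hx 0 1
  have s11 := h.sum_curvature_skew hU hx 1 1
  have c := h.comm hx 1 0
  have hd := h.det_ne_zero hx
  have hdet := Matrix.det_fin_two (G x)
  simp only [Fin.sum_univ_two] at s00 s01 s11
  simp only [c] at s00 s01 s11 hdet
  have z : ∀ l k : Fin 2, ∀ a, curvature (leviCivita G) l a a k x = 0 := by
    intro l k a
    have := curvature_swap (leviCivita G) l a a k x
    linarith
  simp only [gaussCurvature, ricci, Matrix.of_apply, Fin.sum_univ_two]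
  rw [div_mul_eq_mul_div, eq_div_iff hd, hdet]
  have sw := fun k => curvature_swap (leviCivita G) 1 1 0 k x
  rcases fin_two_cases i with rfl | rfl <;> rcases fin_two_cases j with rfl | rfl <;>
    simp only [z, sw, c]
  · linear_combination -G x 0 0 * s01 + G x 0 1 / 2 * s00
  · linear_combination -G x 0 0 / 2 * s11
  · linear_combination -G x 0 1 * s01 + G x 1 1 / 2 * s00
  · linear_combination -G x 0 1 / 2 * s11

/-! ### Algebra of the twisting tensor -/

/-- A totally symmetric trilinear form, trace-free with respect to `g`: at each point, the real part
of a cubic differential. -/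
structure IsHarmonicCubic (g : Matrix (Fin 2) (Fin 2) ℝ) (r : Fin 2 → Fin 2 → Fin 2 → ℝ) :
    Prop where
  swap₁₂ : ∀ i j k, r i j k = r j i k
  swap₂₃ : ∀ i j k, r i j k = r i k j
  trace : ∀ k, ∑ i, ∑ j, g⁻¹ i j * r i j k = 0

/-- The tensor `g ⊗ b^♯ - b ⊗ Id - Id ⊗ b + α`, with `g(α(X) Y, Z) = r(X, Y, Z)`, by which a twisted
connection differs from the Levi-Civita connection. The first index is the upper one. -/
noncomputable def twistTensor (g : Matrix (Fin 2) (Fin 2) ℝ) (b : Fin 2 → ℝ)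
    (r : Fin 2 → Fin 2 → Fin 2 → ℝ) (k i j : Fin 2) : ℝ :=
  g i j * ∑ l, g⁻¹ k l * b l - b i * (1 : Matrix (Fin 2) (Fin 2) ℝ) k j
    - (1 : Matrix (Fin 2) (Fin 2) ℝ) k i * b j + ∑ l, g⁻¹ k l * r i j l

/-- The squared norm of the cubic form with real part `r`, in terms of its values on `∂_1, ∂_2`. -/
noncomputable def harmonicNormSq (g : Matrix (Fin 2) (Fin 2) ℝ)
    (r : Fin 2 → Fin 2 → Fin 2 → ℝ) : ℝ :=
  (r 0 0 0 ^ 2 + (g 0 0 * r 0 0 1 - g 0 1 * r 0 0 0) ^ 2 / g.det) / g 0 0 ^ 3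

namespace IsHarmonicCubic

variable {g : Matrix (Fin 2) (Fin 2) ℝ} {r : Fin 2 → Fin 2 → Fin 2 → ℝ}

theorem apply_zero_one_zero (h : IsHarmonicCubic g r) : r 0 1 0 = r 0 0 1 := h.swap₂₃ 0 1 0

theorem apply_one_zero_zero (h : IsHarmonicCubic g r) : r 1 0 0 = r 0 0 1 := by
  rw [h.swap₁₂, h.swap₂₃]

theorem apply_one_zero_one (h : IsHarmonicCubic g r) : r 1 0 1 = r 0 1 1 := h.swap₁₂ _ _ _

theorem apply_one_one_zero (h : IsHarmonicCubic g r) : r 1 1 0 = r 0 1 1 := by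
  rw [h.swap₂₃, h.swap₁₂]

theorem trace_mul_det (h : IsHarmonicCubic g r) (hg : g.PosDef) (k : Fin 2) :
    g 1 1 * r 0 0 k - 2 * g 0 1 * r 0 1 k + g 0 0 * r 1 1 k = 0 := by
  have t := h.trace k
  have hd : g.det ≠ 0 := hg.det_pos.ne'
  simp only [Fin.sum_univ_two, Matrix.inv_apply_zero_zero, Matrix.inv_apply_zero_one,
    Matrix.inv_apply_one_zero, Matrix.inv_apply_one_one, hg.apply_comm 1 0, h.swap₁₂ 1 0 k] at t
  field_simp at t
  linear_combination t

theorem apply_zero_one_one (h : IsHarmonicCubic g r) (hg : g.PosDef) :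
    r 0 1 1 = (2 * g 0 1 * r 0 0 1 - g 1 1 * r 0 0 0) / g 0 0 := by
  have t := h.trace_mul_det hg 0
  rw [h.apply_zero_one_zero, h.apply_one_one_zero] at t
  have := hg.diag_pos (i := 0)
  rw [eq_div_iff this.ne']
  linear_combination t

theorem apply_one_one_one (h : IsHarmonicCubic g r) (hg : g.PosDef) :
    r 1 1 1 = (2 * g 0 1 * r 0 1 1 - g 1 1 * r 0 0 1) / g 0 0 := by
  have t := h.trace_mul_det hg 1
  have := hg.diag_pos (i := 0)
  rw [eq_div_iff this.ne']
  linear_combination t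

end IsHarmonicCubic

section TwistTensor

variable {g : Matrix (Fin 2) (Fin 2) ℝ} {b : Fin 2 → ℝ} {r : Fin 2 → Fin 2 → Fin 2 → ℝ}

theorem Matrix.PosDef.sum_mul_inv_mul (hg : g.PosDef) (l : Fin 2) (f : Fin 2 → ℝ) :
    ∑ k, g l k * ∑ m, g⁻¹ k m * f m = f l := by
  have e : g * g⁻¹ = 1 := Matrix.mul_nonsing_inv _ (isUnit_iff_ne_zero.mpr hg.det_pos.ne')
  have e2 : g.mulVec (g⁻¹.mulVec f) = f := by rw [Matrix.mulVec_mulVec, e, Matrix.one_mulVec]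
  exact congrFun e2 l

theorem Matrix.PosDef.sum_inv_mul_mul (hg : g.PosDef) (l : Fin 2) (f : Fin 2 → ℝ) :
    ∑ k, g⁻¹ l k * ∑ m, g k m * f m = f l := by
  have e : g⁻¹ * g = 1 := Matrix.nonsing_inv_mul _ (isUnit_iff_ne_zero.mpr hg.det_pos.ne')
  have e2 : g⁻¹.mulVec (g.mulVec f) = f := by rw [Matrix.mulVec_mulVec, e, Matrix.one_mulVec]
  exact congrFun e2 l

theorem sum_mul_one_apply (f : Fin 2 → ℝ) (j : Fin 2) :
    ∑ k, f k * (1 : Matrix (Fin 2) (Fin 2) ℝ) k j = f j := by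
  rcases fin_two_cases j with rfl | rfl <;> simp

/-- The twisting tensor with its upper index lowered. -/
theorem sum_mul_twistTensor (hg : g.PosDef) (l i j : Fin 2) :
    ∑ k, g l k * twistTensor g b r k i j =
      g i j * b l - b i * g l j - g l i * b j + r i j l := by
  have e1 := hg.sum_mul_inv_mul l b
  have e2 := hg.sum_mul_inv_mul l fun l => r i j l
  have e3 := sum_mul_one_apply (g l) j
  have e4 := sum_mul_one_apply (g l) i
  simp only [twistTensor]
  rw [Fin.sum_univ_two] at e1 e2 e3 e4 ⊢
  linear_combination g i j * e1 - b i * e3 - b j * e4 + e2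

theorem twistTensor_comm (hg : g.PosDef) (hr : IsHarmonicCubic g r) (k i j : Fin 2) :
    twistTensor g b r k i j = twistTensor g b r k j i := by
  simp only [twistTensor, hr.swap₁₂ i j, hg.apply_comm i j]
  ring

theorem sum_twistTensor_left (hg : g.PosDef) (hr : IsHarmonicCubic g r) (j : Fin 2) :
    ∑ k, twistTensor g b r k k j = -2 * b j := by
  have hd : g.det ≠ 0 := hg.det_pos.ne'
  have t := hr.trace_mul_det hg j
  have hdet := Matrix.det_fin_two g
  simp only [twistTensor, Fin.sum_univ_two, Matrix.inv_apply_zero_zero, Matrix.inv_apply_zero_one,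
    Matrix.inv_apply_one_zero, Matrix.inv_apply_one_one, hg.apply_comm 1 0, hr.swap₂₃ _ j] at hdet ⊢
  rw [hr.swap₁₂ 1 0 j]
  rcases fin_two_cases j with rfl | rfl <;> simp [hg.apply_comm 1 0] <;> field_simp <;>
    simp only [hdet] <;> linear_combination t

theorem sum_inv_mul_twistTensor (hg : g.PosDef) (hr : IsHarmonicCubic g r) (k : Fin 2) :
    ∑ i, ∑ j, g⁻¹ i j * twistTensor g b r k i j = 0 := by
  have hd : g.det ≠ 0 := hg.det_pos.ne'
  have t0 := hr.trace_mul_det hg 0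
  have t1 := hr.trace_mul_det hg 1
  have hdet := Matrix.det_fin_two g
  simp only [twistTensor, Fin.sum_univ_two, Matrix.inv_apply_zero_zero, Matrix.inv_apply_zero_one,
    Matrix.inv_apply_one_zero, Matrix.inv_apply_one_one, hg.apply_comm 1 0] at hdet ⊢
  rw [hr.swap₁₂ 1 0 0, hr.swap₁₂ 1 0 1]
  rcases fin_two_cases k with rfl | rfl <;> simp [Matrix.inv_apply_zero_zero,
    Matrix.inv_apply_zero_one, Matrix.inv_apply_one_zero,
    Matrix.inv_apply_one_one, hg.apply_comm 1 0] <;> field_simp <;>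
    simp only [hdet]
  · linear_combination g 1 1 * t0 - g 0 1 * t1
  · linear_combination -g 0 1 * t0 + g 0 0 * t1

/-- The quadratic contribution of the twisting tensor to the Ricci tensor. -/
theorem twistTensor_quadratic (hg : g.PosDef) (hr : IsHarmonicCubic g r) (i j : Fin 2) :
    ∑ k, ∑ m, (twistTensor g b r k k m * twistTensor g b r m i j
      - twistTensor g b r k i m * twistTensor g b r m k j) =
      -2 * harmonicNormSq g r * g i j - 2 * ∑ k, ∑ l, g⁻¹ k l * (b k * r i j l) := by
  have hd : g.det ≠ 0 := hg.det_pos.ne'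
  have h0 : g 0 0 ≠ 0 := (hg.diag_pos (i := 0)).ne'
  have hdet := Matrix.det_fin_two g
  have c := hg.apply_comm 1 0
  have e11 : g 1 1 = (g.det + g 0 1 ^ 2) / g 0 0 := by
    rw [eq_div_iff h0, hdet, c]; ring
  simp only [twistTensor, Fin.sum_univ_two, Matrix.inv_apply_zero_zero, Matrix.inv_apply_zero_one,
    Matrix.inv_apply_one_zero, Matrix.inv_apply_one_one, c, harmonicNormSq]
  rcases fin_two_cases i with rfl | rfl <;> rcases fin_two_cases j with rfl | rfl <;>
  · simp only [hr.apply_zero_one_zero, hr.apply_one_zero_zero, hr.apply_one_zero_one,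
      hr.apply_one_one_zero, hr.apply_one_one_one hg, hr.apply_zero_one_one hg, c, e11,
      Matrix.one_apply_eq, Matrix.one_apply_ne, ne_eq, zero_ne_one, one_ne_zero, not_false_eq_true]
    generalize g.det = d at *
    field_simp
    ring

/-- A symmetric tensor whose `g`-trace over the lower indices vanishes is a twisting tensor. -/
theorem exists_twistTensor (hg : g.PosDef) {B : Fin 2 → Fin 2 → Fin 2 → ℝ}
    (hB : ∀ k i j, B k i j = B k j i) (ht : ∀ k, ∑ i, ∑ j, g⁻¹ i j * B k i j = 0)
    (hb : ∀ j, b j = -(1 / 2) * ∑ k, B k k j)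
    (hr : ∀ i j l, r i j l = ∑ k, g l k * B k i j - g i j * b l + b i * g l j + g l i * b j) :
    IsHarmonicCubic g r ∧ ∀ k i j, B k i j = twistTensor g b r k i j := by
  have hd : g.det ≠ 0 := hg.det_pos.ne'
  have hdet := Matrix.det_fin_two g
  have c := hg.apply_comm 1 0
  rw [c] at hdet
  have t : ∀ k, g 1 1 * B k 0 0 - 2 * g 0 1 * B k 0 1 + g 0 0 * B k 1 1 = 0 := by
    intro k
    have t := ht k
    simp only [Fin.sum_univ_two, Matrix.inv_apply_zero_zero, Matrix.inv_apply_zero_one,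
      Matrix.inv_apply_one_zero, Matrix.inv_apply_one_one, c, hB k 1 0] at t
    field_simp at t
    linear_combination t
  refine ⟨⟨?_, ?_, ?_⟩, ?_⟩
  · intro i j k
    simp only [hr, hB _ i j, hg.apply_comm i j]; ring
  · have key : ∀ i, r i 0 1 = r i 1 0 := by
      intro i
      have t0 := t 0
      have t1 := t 1
      simp only [hr, hb, Fin.sum_univ_two]
      rcases fin_two_cases i with rfl | rfl <;> simp only [c, hB _ 1 0]
      · linear_combination t1
      · linear_combination -t0
    intro i j k
    rcases fin_two_cases j with rfl | rfl <;> rcases fin_two_cases k with rfl | rfl <;>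
      simp [key]
  · intro k
    have t0 := t 0
    have t1 := t 1
    simp only [hr, hb, Fin.sum_univ_two, Matrix.inv_apply_zero_zero, Matrix.inv_apply_zero_one,
      Matrix.inv_apply_one_zero, Matrix.inv_apply_one_one, c]
    rcases fin_two_cases k with rfl | rfl <;> simp only [c, hB _ 1 0] <;> field_simp
    · linear_combination 2 * g 0 0 * t0 + 2 * g 0 1 * t1
    · linear_combination 2 * g 0 1 * t0 + 2 * g 1 1 * t1
  · intro k i j
    have e := fun k => hg.sum_inv_mul_mul k fun m => B m i j - twistTensor g b r m i j
    have z : ∀ l, ∑ m, g l m * (B m i j - twistTensor g b r m i j) = 0 := by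
      intro l
      have h1 := sum_mul_twistTensor (b := b) (r := r) hg l i j
      have h2 := hr i j l
      rw [Fin.sum_univ_two] at h1 h2 ⊢
      linear_combination -h1 - h2
    have := e k
    simp only [z, mul_zero, Finset.sum_const_zero] at this
    linarith

end TwistTensor

/-! ### Covariant differentiation of forms and tensors -/

/-- Components `(∇_{∂_i} β)_j` of the covariant derivative of a `1`-form. -/
noncomputable def covDerivOneForm (L : Fin 2 → Fin 2 → Fin 2 → Plane → ℝ) (β : Fin 2 → Plane → ℝ)
    (i j : Fin 2) (x : Plane) : ℝ :=
  pderiv i (β j) x - ∑ k, L k i j x * β k x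

/-- Components `(∇_{∂_m} R)_{ijk}` of the covariant derivative of a trilinear form. -/
noncomputable def covDerivCubic (L : Fin 2 → Fin 2 → Fin 2 → Plane → ℝ)
    (R : Fin 2 → Fin 2 → Fin 2 → Plane → ℝ) (m i j k : Fin 2) (x : Plane) : ℝ :=
  pderiv m (R i j k) x
    - ∑ n, (L n m i x * R n j k x + L n m j x * R i n k x + L n m k x * R i j n x)

/-- Components `(∇_{∂_m} A)^k_{ij}` of the covariant derivative of a tensor with one upper index. -/
noncomputable def covDerivDiff (L A : Fin 2 → Fin 2 → Fin 2 → Plane → ℝ)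
    (m k i j : Fin 2) (x : Plane) : ℝ :=
  pderiv m (A k i j) x
    + ∑ n, (L k m n x * A n i j x - L n m i x * A k n j x - L n m j x * A k i n x)

/-! ### The Ricci tensor of a twisted connection -/

/-- The Ricci tensor of the sum of a torsion-free connection and a tensor. -/
theorem ricci_add {U : Set Plane} (hU : IsOpen U) {x : Plane} (hx : x ∈ U)
    {Γ L A : Fin 2 → Fin 2 → Fin 2 → Plane → ℝ}
    (hL : ∀ k i j, DifferentiableAt ℝ (L k i j) x) (hA : ∀ k i j, DifferentiableAt ℝ (A k i j) x)
    (hs : ∀ k i j, L k i j x = L k j i x)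
    (hΓ : ∀ y ∈ U, ∀ k i j, Γ k i j y = L k i j y + A k i j y) (i j : Fin 2) :
    ricci Γ x i j = ricci L x i j
      + ∑ k, (covDerivDiff L A k k i j x - covDerivDiff L A i k k j x)
      + ∑ k, ∑ m, (A k k m x * A m i j x - A k i m x * A m k j x) := by
  have hd : ∀ m k i j, pderiv m (Γ k i j) x = pderiv m (L k i j) x + pderiv m (A k i j) x := by
    intro m k i j
    rw [← pderiv_add m (hL k i j) (hA k i j)]
    exact pderiv_congr m hU hx fun y hy => hΓ y hy k i j
  simp only [ricci, Matrix.of_apply, curvature, covDerivDiff, hd, hΓ x hx, Fin.sum_univ_two]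
  rcases fin_two_cases i with rfl | rfl <;> rcases fin_two_cases j with rfl | rfl <;>
    simp only [hs 0 1 0, hs 1 1 0] <;> ring

section Twisted

variable {G : Plane → Matrix (Fin 2) (Fin 2) ℝ} {U : Set Plane} {x : Plane}
  {β : Fin 2 → Plane → ℝ} {R : Fin 2 → Fin 2 → Fin 2 → Plane → ℝ}

theorem smooth_twistTensor (h : IsMetricOn G U) (hβ : ∀ j, ContDiffOn ℝ ∞ (β j) U)
    (hR : ∀ i j k, ContDiffOn ℝ ∞ (R i j k) U) (k i j : Fin 2) :
    ContDiffOn ℝ ∞ (fun y => twistTensor (G y) (fun l => β l y) (fun a b c => R a b c y) k i j)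
      U := by
  unfold twistTensor
  exact ((((h.smooth i j).mul (ContDiffOn.sum fun l _ => (h.smooth_inv k l).mul (hβ l))).sub
    ((hβ i).mul contDiffOn_const)).sub (contDiffOn_const.mul (hβ j))).add
    (ContDiffOn.sum fun l _ => (h.smooth_inv k l).mul (hR i j l))

/-- Covariant differentiation with respect to the Levi-Civita connection commutes with lowering the
index of the twisting tensor. -/
theorem sum_mul_covDerivDiff (h : IsMetricOn G U) (hU : IsOpen U) (hx : x ∈ U)
    {A : Fin 2 → Fin 2 → Fin 2 → Plane → ℝ} (hA : ∀ k i j, DifferentiableAt ℝ (A k i j) x)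
    (hβ : ∀ j, DifferentiableAt ℝ (β j) x) (hR : ∀ i j k, DifferentiableAt ℝ (R i j k) x)
    (hlow : ∀ y ∈ U, ∀ l i j, ∑ k, G y l k * A k i j y =
      G y i j * β l y - β i y * G y l j - G y l i * β j y + R i j l y) (m l i j : Fin 2) :
    ∑ k, G x l k * covDerivDiff (leviCivita G) A m k i j x =
      G x i j * covDerivOneForm (leviCivita G) β m l x
        - G x l j * covDerivOneForm (leviCivita G) β m i x
        - G x l i * covDerivOneForm (leviCivita G) β m j x
        + covDerivCubic (leviCivita G) R m i j l x := by
  have hG := fun i j => h.differentiableAt hU hx i j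
  have hd := pderiv_congr m hU hx fun y hy => hlow y hy l i j
  simp only [Fin.sum_univ_two] at hd hlow
  simp (disch := fun_prop) only [pderiv_add, pderiv_sub, pderiv_mul] at hd
  simp only [h.pderiv_eq_leviCivita hU hx, Fin.sum_univ_two] at hd
  have H := hlow x hx
  simp only [covDerivDiff, covDerivOneForm, covDerivCubic, Fin.sum_univ_two]
  have c := h.comm hx 1 0
  linear_combination hd - leviCivita G 0 m l x * H 0 i j - leviCivita G 1 m l x * H 1 i j
    - leviCivita G 0 m i x * H l 0 j - leviCivita G 1 m i x * H l 1 j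
    - leviCivita G 0 m j x * H l i 0 - leviCivita G 1 m j x * H l i 1

/-- The Ricci tensor of the twisted connection of a metric `G`, a `1`-form `β` and the real part `R`
of a cubic differential. -/
theorem ricci_twisted (h : IsMetricOn G U) (hU : IsOpen U) (hx : x ∈ U)
    (hβ : ∀ j, ContDiffOn ℝ ∞ (β j) U) (hR : ∀ i j k, ContDiffOn ℝ ∞ (R i j k) U)
    (hH : ∀ y ∈ U, IsHarmonicCubic (G y) fun a b c => R a b c y)
    {Γ : Fin 2 → Fin 2 → Fin 2 → Plane → ℝ}
    (hΓ : ∀ y ∈ U, ∀ k i j, Γ k i j y = leviCivita G k i j y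
      + twistTensor (G y) (fun l => β l y) (fun a b c => R a b c y) k i j) (i j : Fin 2) :
    ricci Γ x i j = G x i j * (gaussCurvature G x - codifferential G β x
        - 2 * harmonicNormSq (G x) fun a b c => R a b c x)
      + (pderiv i (β j) x - pderiv j (β i) x)
      + ∑ k, ∑ l, (G x)⁻¹ k l *
        (covDerivCubic (leviCivita G) R k i j l x - 2 * (β k x * R i j l x)) := by
  set A : Fin 2 → Fin 2 → Fin 2 → Plane → ℝ := fun k i j y =>
    twistTensor (G y) (fun l => β l y) (fun a b c => R a b c y) k i j with hAdef
  have hAd : ∀ k i j, DifferentiableAt ℝ (A k i j) x := fun k i j =>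
    (smooth_twistTensor h hβ hR k i j).differentiableAt_of_mem hU hx
  have hLd : ∀ k i j, DifferentiableAt ℝ (leviCivita G k i j) x := fun k i j =>
    (h.smooth_leviCivita hU k i j).differentiableAt_of_mem hU hx
  have hβd : ∀ j, DifferentiableAt ℝ (β j) x := fun j => (hβ j).differentiableAt_of_mem hU hx
  have hRd : ∀ i j k, DifferentiableAt ℝ (R i j k) x := fun i j k =>
    (hR i j k).differentiableAt_of_mem hU hx
  have hLs := h.leviCivita_comm hU hx
  rw [ricci_add hU hx hLd hAd hLs hΓ, h.ricci_leviCivita hU hx]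
  have quad := twistTensor_quadratic (b := fun l => β l x) (h.posDef x hx) (hH x hx) i j
  have low : ∀ m l, _ := fun m l => sum_mul_covDerivDiff h hU hx hAd hβd hRd
    (fun y hy l i j => sum_mul_twistTensor (h.posDef y hy) l i j) m l i j
  have tr : ∑ k, covDerivDiff (leviCivita G) A i k k j x
      = -2 * covDerivOneForm (leviCivita G) β i j x := by
    have tr0 : ∀ y ∈ U, ∀ j, ∑ k, A k k j y = -2 * β j y := fun y hy j =>
      sum_twistTensor_left (h.posDef y hy) (hH y hy) j
    have hd := pderiv_congr i hU hx fun y hy => tr0 y hy j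
    have t0 := tr0 x hx 0
    have t1 := tr0 x hx 1
    simp only [Fin.sum_univ_two] at hd t0 t1
    simp (disch := fun_prop) only [pderiv_add, pderiv_const_mul] at hd
    simp only [covDerivDiff, covDerivOneForm, Fin.sum_univ_two]
    rcases fin_two_cases i with rfl | rfl <;>
      linear_combination hd - leviCivita G 0 _ j x * t0 - leviCivita G 1 _ j x * t1
  have dv : ∑ k, covDerivDiff (leviCivita G) A k k i j x =
      ∑ k, ∑ l, (G x)⁻¹ k l * (G x i j * covDerivOneForm (leviCivita G) β k l x
        - G x l j * covDerivOneForm (leviCivita G) β k i x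
        - G x l i * covDerivOneForm (leviCivita G) β k j x
        + covDerivCubic (leviCivita G) R k i j l x) := by
    refine Finset.sum_congr rfl fun k _ => ?_
    rw [← (h.posDef x hx).sum_inv_mul_mul k fun n => covDerivDiff (leviCivita G) A k n i j x]
    exact Finset.sum_congr rfl fun l _ => by rw [low k l]
  -- To be used for `a = j` and `a = i`, when `i + j - a` is the other one of the two indices.
  have inv : ∀ a, ∑ k, ∑ l, (G x)⁻¹ k l *
      (G x l a * covDerivOneForm (leviCivita G) β k (i + j - a) x)
      = covDerivOneForm (leviCivita G) β a (i + j - a) x := by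
    intro a
    have e0 := h.sum_inv_mul hx 0 a
    have e1 := h.sum_inv_mul hx 1 a
    simp only [Fin.sum_univ_two] at e0 e1 ⊢
    have e2 : ∀ f : Fin 2 → ℝ, f a = (1 : Matrix (Fin 2) (Fin 2) ℝ) 0 a * f 0
      + (1 : Matrix (Fin 2) (Fin 2) ℝ) 1 a * f 1 := by
      intro f
      rcases fin_two_cases a with rfl | rfl <;> simp
    rw [e2 fun b => covDerivOneForm (leviCivita G) β b (i + j - a) x, ← e0, ← e1]
    ring
  have i1 := inv j
  have i2 := inv i
  rw [show i + j - j = i by abel] at i1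
  rw [show i + j - i = j by abel] at i2
  have skew : covDerivOneForm (leviCivita G) β i j x - covDerivOneForm (leviCivita G) β j i x
      = pderiv i (β j) x - pderiv j (β i) x := by
    simp only [covDerivOneForm, hLs _ i j]; ring
  rw [← skew, Finset.sum_sub_distrib, tr, dv, quad]
  have cod : codifferential G β x =
      -∑ k, ∑ l, (G x)⁻¹ k l * covDerivOneForm (leviCivita G) β k l x := rfl
  rw [cod]
  simp only [Fin.sum_univ_two] at i1 i2 ⊢
  linear_combination -i1 - i2

/-! ### Recovering the triple from the derivative of the metric -/

/-- The metric derivative with respect to a twisted connection. -/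
theorem covDerivMetric_twisted (h : IsMetricOn G U) (hU : IsOpen U) (hx : x ∈ U)
    {Γ : Fin 2 → Fin 2 → Fin 2 → Plane → ℝ}
    (hH : IsHarmonicCubic (G x) fun a b c => R a b c x)
    (hΓ : ∀ k i j, Γ k i j x = leviCivita G k i j x
      + twistTensor (G x) (fun l => β l x) (fun a b c => R a b c x) k i j) (k i j : Fin 2) :
    covDerivMetric Γ G k i j x = 2 * β k x * G x i j - 2 * R k i j x := by
  have e1 := sum_mul_twistTensor (b := fun l => β l x) (r := fun a b c => R a b c x)
    (h.posDef x hx) j k i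
  have e2 := sum_mul_twistTensor (b := fun l => β l x) (r := fun a b c => R a b c x)
    (h.posDef x hx) i k j
  have s := hH.swap₂₃ k i j
  simp only [covDerivMetric, h.pderiv_eq_leviCivita hU hx, hΓ]
  rw [Fin.sum_univ_two] at e1 e2 ⊢
  rw [h.comm hx 0 j, h.comm hx 1 j, Fin.sum_univ_two, h.comm hx 0 j, h.comm hx 1 j]
  have c := h.comm hx i j
  have c1 := h.comm hx k j
  have c2 := h.comm hx k i
  rw [h.comm hx j k, h.comm hx j i] at e1
  rw [h.comm hx i k] at e2
  linear_combination -e1 - e2 + s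

theorem trace3_sym3 {g : Matrix (Fin 2) (Fin 2) ℝ} (hg : g.PosDef) {b : Fin 2 → ℝ}
    {r : Fin 2 → Fin 2 → Fin 2 → ℝ} (hr : IsHarmonicCubic g r) (k : Fin 2) :
    trace3 g (sym3 fun a i j => 2 * b a * g i j - 2 * r a i j) k = 8 / 3 * b k := by
  have hd : g.det ≠ 0 := hg.det_pos.ne'
  have hdet := Matrix.det_fin_two g
  have c := hg.apply_comm 1 0
  rw [c] at hdet
  have t0 := hr.trace_mul_det hg 0
  have t1 := hr.trace_mul_det hg 1
  simp only [trace3, sym3, Fin.sum_univ_two, Matrix.inv_apply_zero_zero, Matrix.inv_apply_zero_one,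
    Matrix.inv_apply_one_zero, Matrix.inv_apply_one_one, c]
  rcases fin_two_cases k with rfl | rfl <;>
    simp only [hr.apply_zero_one_zero, hr.apply_one_zero_zero, hr.apply_one_zero_one,
      hr.apply_one_one_zero, c] at t0 t1 ⊢ <;> field_simp <;> simp only [hdet]
  · linear_combination (-36 : ℝ) * t0
  · linear_combination (-36 : ℝ) * t1

theorem traceFree3_sym3 {g : Matrix (Fin 2) (Fin 2) ℝ} (hg : g.PosDef) {b : Fin 2 → ℝ}
    {r : Fin 2 → Fin 2 → Fin 2 → ℝ} (hr : IsHarmonicCubic g r) (i j k : Fin 2) :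
    traceFree3 g (sym3 fun a i j => 2 * b a * g i j - 2 * r a i j) i j k = -2 * r i j k := by
  simp only [traceFree3, trace3_sym3 hg hr, sym3]
  rw [hr.swap₂₃ i k j, hr.swap₁₂ j i k, hr.swap₂₃ j k i, hr.swap₁₂ j i k, hr.swap₁₂ k i j,
    hr.swap₂₃ i k j, hr.swap₂₃ k j i, hr.swap₁₂ k i j, hr.swap₂₃ i k j]
  rw [hg.apply_comm k j, hg.apply_comm k i, hg.apply_comm j i]
  ring

end Twisted

/-! ### The complex structure of a metric -/

/-- The complex number `g_01 + i √det g`, the ratio `g_00 f_1 / f_0` for a complex linear form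
`f`. -/
noncomputable def conformalRatio (g : Matrix (Fin 2) (Fin 2) ℝ) : ℂ :=
  (g 0 1 : ℂ) + Complex.I * (Real.sqrt g.det : ℂ)

section Pointwise

variable {G : Plane → Matrix (Fin 2) (Fin 2) ℝ} {x : Plane}

theorem conformalRatio_mul_conj (hg : (G x).PosDef) :
    conformalRatio (G x) * ((G x 0 1 : ℂ) - Complex.I * (Real.sqrt (G x).det : ℂ))
      = (G x 0 0 : ℂ) * (G x 1 1 : ℂ) := by
  have hq : (Real.sqrt (G x).det : ℂ) ^ 2 = (G x 0 0 : ℂ) * (G x 1 1 : ℂ) - (G x 0 1 : ℂ) ^ 2 := by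
    rw [← Complex.ofReal_pow, Real.sq_sqrt hg.det_pos.le, Matrix.det_fin_two, hg.apply_comm 1 0]
    push_cast; ring
  unfold conformalRatio
  linear_combination hq - (Real.sqrt (G x).det : ℂ) ^ 2 * Complex.I_sq

/-- A form is complex linear iff its values on `∂_1, ∂_2` have the ratio `conformalRatio`. -/
theorem complexLinear_iff (hg : (G x).PosDef) (f : Fin 2 → ℂ) :
    (∀ u, ∑ m, (complexStructure G m u x : ℂ) * f m = Complex.I * f u) ↔
      (G x 0 0 : ℂ) * f 1 = conformalRatio (G x) * f 0 := by
  have hq0 : (Real.sqrt (G x).det : ℂ) ≠ 0 := by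
    exact_mod_cast (Real.sqrt_pos.mpr hg.det_pos).ne'
  have h0 : (G x 0 0 : ℂ) ≠ 0 := by exact_mod_cast (hg.diag_pos (i := 0)).ne'
  have hw := conformalRatio_mul_conj hg
  have e : ∀ a b c : ℂ,
      ((Real.sqrt (G x).det : ℂ)⁻¹ * a) * b + ((Real.sqrt (G x).det : ℂ)⁻¹ * c) * f 1 =
        (Real.sqrt (G x).det : ℂ)⁻¹ * (a * b + c * f 1) := fun a b c => by ring
  rw [Fin.forall_fin_two]
  simp only [Fin.sum_univ_two, complexStructure, Matrix.of_apply, Matrix.cons_val',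
    Matrix.cons_val_zero, Matrix.cons_val_one, Matrix.cons_val_fin_one, Complex.ofReal_mul,
    Complex.ofReal_inv, Complex.ofReal_neg, e]
  rw [inv_mul_eq_iff_eq_mul₀ hq0, inv_mul_eq_iff_eq_mul₀ hq0]
  constructor
  · rintro ⟨h, -⟩
    unfold conformalRatio
    linear_combination h
  · intro h
    have h' : (G x 1 1 : ℂ) * f 0 =
        ((G x 0 1 : ℂ) - Complex.I * (Real.sqrt (G x).det : ℂ)) * f 1 := by
      apply mul_left_cancel₀ h0
      linear_combination (-(((G x 0 1 : ℂ) - Complex.I * (Real.sqrt (G x).det : ℂ)))) * h - f 0 * hw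
    refine ⟨?_, ?_⟩
    · unfold conformalRatio at h
      linear_combination h
    · linear_combination -h'

/-- The components of a complex trilinear form at a point, for the complex structure of `g`. By
`complexLinear_iff`, complex linearity in a slot is a single equation between the values on `∂_1`
and `∂_2`. -/
structure IsComplexCubic (g : Matrix (Fin 2) (Fin 2) ℝ) (c : Fin 2 → Fin 2 → Fin 2 → ℂ) :
    Prop where
  slot₁ : ∀ j k, (g 0 0 : ℂ) * c 1 j k = conformalRatio g * c 0 j k
  slot₂ : ∀ i k, (g 0 0 : ℂ) * c i 1 k = conformalRatio g * c i 0 k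
  slot₃ : ∀ i j, (g 0 0 : ℂ) * c i j 1 = conformalRatio g * c i j 0

/-- The real part of a cubic differential is totally symmetric and trace-free. -/
theorem IsComplexCubic.isHarmonicCubic_re {g : Matrix (Fin 2) (Fin 2) ℝ}
    {c : Fin 2 → Fin 2 → Fin 2 → ℂ} (hc : IsComplexCubic g c) (hg : g.PosDef) :
    IsHarmonicCubic g fun i j k => (c i j k).re := by
  have h0 : (g 0 0 : ℂ) ≠ 0 := by exact_mod_cast (hg.diag_pos (i := 0)).ne'
  have s12 : ∀ k, c 0 1 k = c 1 0 k := fun k => by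
    apply mul_left_cancel₀ h0
    rw [hc.slot₁, hc.slot₂]
  have s23 : ∀ i, c i 0 1 = c i 1 0 := fun i => by
    apply mul_left_cancel₀ h0
    rw [hc.slot₂, hc.slot₃]
  have hw := conformalRatio_mul_conj (G := fun _ => g) (x := 0) hg
  refine ⟨?_, ?_, ?_⟩
  · intro i j k
    rcases fin_two_cases i with rfl | rfl <;> rcases fin_two_cases j with rfl | rfl <;> simp [s12]
  · intro i j k
    rcases fin_two_cases j with rfl | rfl <;> rcases fin_two_cases k with rfl | rfl <;> simp [s23]
  · intro k
    have t : (g 1 1 : ℂ) * c 0 0 k - 2 * (g 0 1 : ℂ) * c 1 0 k + (g 0 0 : ℂ) * c 1 1 k = 0 := by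
      apply mul_left_cancel₀ h0
      have a1 := hc.slot₁ 0 k
      have a2 := hc.slot₂ 1 k
      simp only [conformalRatio] at a1 a2 hw
      linear_combination
        (-2 * (g 0 1 : ℂ) + ((g 0 1 : ℂ) + Complex.I * (Real.sqrt g.det : ℂ))) * a1
          + (g 0 0 : ℂ) * a2 - c 0 0 k * hw
    have t' := congrArg Complex.re t
    simp only [Complex.add_re, Complex.sub_re, Complex.mul_re, Complex.ofReal_re, Complex.ofReal_im,
      Complex.re_ofNat, Complex.im_ofNat, Complex.mul_im, Complex.zero_re] at t'
    simp only [Fin.sum_univ_two, Matrix.inv_apply_zero_zero, Matrix.inv_apply_zero_one,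
      Matrix.inv_apply_one_zero, Matrix.inv_apply_one_one, hg.apply_comm 1 0, s12]
    have hd : g.det ≠ 0 := hg.det_pos.ne'
    field_simp
    linear_combination t'

theorem IsComplexCubic.harmonicNormSq_re {g : Matrix (Fin 2) (Fin 2) ℝ}
    {c : Fin 2 → Fin 2 → Fin 2 → ℂ} (hc : IsComplexCubic g c) (hg : g.PosDef) :
    (harmonicNormSq g fun i j k => (c i j k).re) = Complex.normSq (c 0 0 0) / g 0 0 ^ 3 := by
  have h := congrArg Complex.re (hc.slot₃ 0 0)
  simp only [conformalRatio, Complex.mul_re, Complex.add_re, Complex.ofReal_re, Complex.ofReal_im,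
    Complex.I_re, Complex.I_im, Complex.add_im, Complex.mul_im] at h
  have e : g 0 0 * (c 0 0 1).re - g 0 1 * (c 0 0 0).re = -(Real.sqrt g.det * (c 0 0 0).im) := by
    linear_combination h
  have hd := hg.det_pos
  simp only [harmonicNormSq, e, neg_sq, mul_pow, Real.sq_sqrt hd.le, Complex.normSq_apply]
  rw [mul_div_cancel_left₀ _ hd.ne']
  ring

/-- The complex trilinear form with real part `r`, as `r - i r(J ·, ·, ·)`. -/
noncomputable def complexCubic (J : Fin 2 → Fin 2 → ℝ) (r : Fin 2 → Fin 2 → Fin 2 → ℝ)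
    (i j k : Fin 2) : ℂ :=
  (r i j k : ℂ) - Complex.I * ∑ m, (J m i : ℂ) * (r m j k : ℂ)

theorem complexCubic_re (J : Fin 2 → Fin 2 → ℝ) (r : Fin 2 → Fin 2 → Fin 2 → ℝ)
    (i j k : Fin 2) : (complexCubic J r i j k).re = r i j k := by
  simp [complexCubic, Fin.sum_univ_two]

theorem isComplexCubic_complexCubic (hg : (G x).PosDef) {r : Fin 2 → Fin 2 → Fin 2 → ℝ}
    (hr : IsHarmonicCubic (G x) r) :
    IsComplexCubic (G x) (complexCubic (fun m a => complexStructure G m a x) r) := by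
  set q := Real.sqrt (G x).det with hq
  have hqp : 0 < q := Real.sqrt_pos.mpr hg.det_pos
  have h0 : G x 0 0 ≠ 0 := (hg.diag_pos (i := 0)).ne'
  have e11 : G x 1 1 = (q ^ 2 + G x 0 1 ^ 2) / G x 0 0 := by
    rw [eq_div_iff h0, hq, Real.sq_sqrt hg.det_pos.le, Matrix.det_fin_two, hg.apply_comm 1 0]; ring
  have a3 := hr.apply_zero_one_one hg
  have a4 := hr.apply_one_one_one hg
  rw [a3] at a4
  constructor <;> intro i j <;>
    rcases fin_two_cases i with rfl | rfl <;> rcases fin_two_cases j with rfl | rfl <;>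
    simp only [complexCubic, conformalRatio, complexStructure, ← hq, Fin.sum_univ_two,
      hr.apply_zero_one_zero, hr.apply_one_zero_zero, hr.apply_one_zero_one,
      hr.apply_one_one_zero, a3, a4, e11] <;>
    apply Complex.ext <;> simp [-Complex.ofReal_pow] <;> field_simp <;> ring

/-- A family of complex cubic forms `T_a` is of type `(1,0)` in `a` iff the real part of its
divergence vanishes. -/
theorem typeOneZero_iff_divergence {g : Matrix (Fin 2) (Fin 2) ℝ} (hg : g.PosDef)
    {T : Fin 2 → Fin 2 → Fin 2 → Fin 2 → ℂ} (hT : ∀ a, IsComplexCubic g (T a)) :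
    (∀ i j k, (g 0 0 : ℂ) * T 1 i j k = conformalRatio g * T 0 i j k) ↔
      ∀ i j, ∑ k, ∑ l, g⁻¹ k l * (T k i j l).re = 0 := by
  have hd : (g.det : ℂ) ≠ 0 := by exact_mod_cast hg.det_pos.ne'
  have hq0 : (Real.sqrt g.det : ℂ) ≠ 0 := by
    exact_mod_cast (Real.sqrt_pos.mpr hg.det_pos).ne'
  have h0 : (g 0 0 : ℂ) ≠ 0 := by exact_mod_cast (hg.diag_pos (i := 0)).ne'
  have hw := conformalRatio_mul_conj (G := fun _ => g) (x := 0) hg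
  -- The complex divergence, multiplied by `det g`.
  set D : Fin 2 → Fin 2 → ℂ := fun i j =>
    (g 1 1 : ℂ) * T 0 i j 0 - (g 0 1 : ℂ) * (T 0 i j 1 + T 1 i j 0)
      + (g 0 0 : ℂ) * T 1 i j 1 with hD
  have hDre : ∀ i j, ∑ k, ∑ l, g⁻¹ k l * (T k i j l).re = (D i j).re / g.det := by
    intro i j
    simp only [hD, Fin.sum_univ_two, Matrix.inv_apply_zero_zero, Matrix.inv_apply_zero_one,
      Matrix.inv_apply_one_zero, Matrix.inv_apply_one_one, hg.apply_comm 1 0, Complex.add_re,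
      Complex.sub_re, Complex.mul_re, Complex.ofReal_re, Complex.ofReal_im]
    ring
  have hDE : ∀ i j, (g 0 0 : ℂ) * D i j = Complex.I * (Real.sqrt g.det : ℂ) *
      ((g 0 0 : ℂ) * T 1 i j 0 - conformalRatio g * T 0 i j 0) := by
    intro i j
    have a0 := (hT 0).slot₃ i j
    have a1 := (hT 1).slot₃ i j
    simp only [hD]
    simp only [conformalRatio] at a0 a1 hw ⊢
    linear_combination (-(g 0 1 : ℂ)) * a0 + (g 0 0 : ℂ) * a1 - T 0 i j 0 * hw
  have hDs : ∀ j, (g 0 0 : ℂ) * D 1 j = conformalRatio g * D 0 j := by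
    intro j
    simp only [hD]
    linear_combination (g 1 1 : ℂ) * (hT 0).slot₁ j 0
      - (g 0 1 : ℂ) * ((hT 0).slot₁ j 1 + (hT 1).slot₁ j 0) + (g 0 0 : ℂ) * (hT 1).slot₁ j 1
  have hdr : g.det ≠ 0 := hg.det_pos.ne'
  simp only [hDre, div_eq_zero_iff, hdr, or_false]
  constructor
  · intro h i j
    have : D i j = 0 := by
      apply mul_left_cancel₀ h0
      rw [hDE, h]; ring
    simp [this]
  · intro h
    have hz0 : ∀ j, D 0 j = 0 := by
      intro j
      have e := congrArg Complex.re (hDs j)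
      have r0 := h 0 j
      have r1 := h 1 j
      simp only [conformalRatio, Complex.mul_re, Complex.add_re, Complex.ofReal_re,
        Complex.ofReal_im, Complex.I_re, Complex.I_im, Complex.add_im, Complex.mul_im, r0, r1] at e
      have hs := (Real.sqrt_pos.mpr hg.det_pos).ne'
      apply Complex.ext r0
      have : Real.sqrt g.det * (D 0 j).im = 0 := by linarith
      simpa [hs] using this
    have hz : ∀ i j, D i j = 0 := by
      intro i j
      rcases fin_two_cases i with rfl | rfl
      · exact hz0 j
      · apply mul_left_cancel₀ h0
        rw [hDs, hz0]; ring
    have E0 : ∀ i j, (g 0 0 : ℂ) * T 1 i j 0 = conformalRatio g * T 0 i j 0 := by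
      intro i j
      have e := hDE i j
      rw [hz, mul_zero, zero_eq_mul] at e
      rcases e with e | e
      · exact absurd e (mul_ne_zero Complex.I_ne_zero hq0)
      · exact sub_eq_zero.mp e
    intro i j k
    rcases fin_two_cases k with rfl | rfl
    · exact E0 i j
    · apply mul_left_cancel₀ h0
      linear_combination (g 0 0 : ℂ) * (hT 1).slot₃ i j - conformalRatio g * (hT 0).slot₃ i j
        + conformalRatio g * E0 i j

end Pointwise

/-! ### The del-bar operator in terms of the Levi-Civita connection -/

section Delbar

variable {G : Plane → Matrix (Fin 2) (Fin 2) ℝ} {U : Set Plane} {x : Plane}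
  {C : Fin 2 → Fin 2 → Fin 2 → Plane → ℂ}

theorem IsMetricOn.smooth_sqrt_det (h : IsMetricOn G U) :
    ContDiffOn ℝ ∞ (fun y => Real.sqrt (G y).det) U :=
  h.smooth_det.sqrt fun _ hy => h.det_ne_zero hy

theorem IsMetricOn.smooth_complexStructure (h : IsMetricOn G U) (m a : Fin 2) :
    ContDiffOn ℝ ∞ (complexStructure G m a) U := by
  unfold complexStructure
  refine (h.smooth_sqrt_det.inv fun y hy => (Real.sqrt_pos.mpr (h.det_pos hy)).ne').mul ?_
  rcases fin_two_cases m with rfl | rfl <;> rcases fin_two_cases a with rfl | rfl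
  · exact (h.smooth 0 1).neg
  · exact (h.smooth 1 1).neg
  · exact h.smooth 0 0
  · exact h.smooth 0 1

/-- The complex structure is parallel for the Levi-Civita connection. -/
theorem IsMetricOn.pderiv_complexStructure (h : IsMetricOn G U) (hU : IsOpen U) (hx : x ∈ U)
    (i m a : Fin 2) :
    pderiv i (complexStructure G m a) x =
      ∑ l, (leviCivita G l i a x * complexStructure G m l x
        - leviCivita G m i l x * complexStructure G l a x) := by
  have hG := fun i j => h.differentiableAt hU hx i j
  have hJ : ∀ m a, DifferentiableAt ℝ (complexStructure G m a) x := fun m a =>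
    (h.smooth_complexStructure m a).differentiableAt_of_mem hU hx
  have hq := h.smooth_sqrt_det.differentiableAt_of_mem hU hx
  set q : Plane → ℝ := fun y => Real.sqrt (G y).det with hqdef
  have hq0 : ∀ y ∈ U, q y ≠ 0 := fun y hy => (Real.sqrt_pos.mpr (h.det_pos hy)).ne'
  have hdet : ∀ y ∈ U, q y * q y = G y 0 0 * G y 1 1 - G y 0 1 * G y 0 1 := fun y hy => by
    rw [Real.mul_self_sqrt (h.det_pos hy).le, Matrix.det_fin_two, h.comm hy 1 0]
  have hqJ : ∀ y ∈ U, ∀ m a, q y * complexStructure G m a y =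
      !![-G y 0 1, -G y 1 1; G y 0 0, G y 0 1] m a := fun y hy m a => by
    rw [complexStructure, mul_inv_cancel_left₀ (hq0 y hy)]
  have d1 := pderiv_congr i hU hx hdet
  simp (disch := fun_prop) only [pderiv_sub, pderiv_mul] at d1
  simp only [h.pderiv_eq_leviCivita hU hx, Fin.sum_univ_two, h.comm hx 1 0] at d1
  have hq' : pderiv i q x = q x * (leviCivita G 0 i 0 x + leviCivita G 1 i 1 x) := by
    apply mul_left_cancel₀ (hq0 x hx)
    linear_combination (1 / 2) * d1
      - (leviCivita G 0 i 0 x + leviCivita G 1 i 1 x) * hdet x hx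
  have d2 := pderiv_congr i hU hx fun y hy => hqJ y hy m a
  have e00 := hqJ x hx 0 0
  have e01 := hqJ x hx 0 1
  have e10 := hqJ x hx 1 0
  have e11 := hqJ x hx 1 1
  apply mul_left_cancel₀ (hq0 x hx)
  rcases fin_two_cases m with rfl | rfl <;> rcases fin_two_cases a with rfl | rfl <;>
  · simp only [Matrix.of_apply, Matrix.cons_val', Matrix.cons_val_zero, Matrix.cons_val_one,
      Matrix.cons_val_fin_one] at d2 e00 e01 e10 e11
    simp (disch := fun_prop) only [pderiv_neg, pderiv_mul] at d2
    simp only [h.pderiv_eq_leviCivita hU hx, hq', Fin.sum_univ_two, h.comm hx 1 0] at d2 ⊢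
    first
    | linear_combination d2 - (leviCivita G 0 i 0 x + leviCivita G 1 i 1 x) * e00
        - leviCivita G 0 i 0 x * e00 - leviCivita G 1 i 0 x * e01
        + leviCivita G 0 i 0 x * e00 + leviCivita G 0 i 1 x * e10
    | linear_combination d2 - (leviCivita G 0 i 0 x + leviCivita G 1 i 1 x) * e01
        - leviCivita G 0 i 1 x * e00 - leviCivita G 1 i 1 x * e01
        + leviCivita G 0 i 0 x * e01 + leviCivita G 0 i 1 x * e11
    | linear_combination d2 - (leviCivita G 0 i 0 x + leviCivita G 1 i 1 x) * e10
        - leviCivita G 0 i 0 x * e10 - leviCivita G 1 i 0 x * e11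
        + leviCivita G 1 i 0 x * e00 + leviCivita G 1 i 1 x * e10
    | linear_combination d2 - (leviCivita G 0 i 0 x + leviCivita G 1 i 1 x) * e11
        - leviCivita G 0 i 1 x * e10 - leviCivita G 1 i 1 x * e11
        + leviCivita G 1 i 0 x * e01 + leviCivita G 1 i 1 x * e11

theorem pderiv_ofReal {f : Plane → ℝ} (hf : DifferentiableAt ℝ f x) (i : Fin 2) :
    pderiv i (fun y => (f y : ℂ)) x = ((pderiv i f x : ℝ) : ℂ) := by
  have := (Complex.ofRealCLM.hasFDerivAt.comp x hf.hasFDerivAt).fderiv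
  simp only [pderiv]
  change (fderiv ℝ (⇑Complex.ofRealCLM ∘ f) x) _ = _
  rw [this]; rfl

theorem pderiv_re {f : Plane → ℂ} (hf : DifferentiableAt ℝ f x) (i : Fin 2) :
    pderiv i (fun y => (f y).re) x = (pderiv i f x).re := by
  have := (Complex.reCLM.hasFDerivAt.comp x hf.hasFDerivAt).fderiv
  simp only [pderiv]
  change (fderiv ℝ (⇑Complex.reCLM ∘ f) x) _ = _
  rw [this]; rfl

/-- Components `(∇_{∂_m} C)_{ijk}` of the covariant derivative of a complex trilinear form. -/
noncomputable def covDerivComplexCubic (L : Fin 2 → Fin 2 → Fin 2 → Plane → ℝ)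
    (C : Fin 2 → Fin 2 → Fin 2 → Plane → ℂ) (m i j k : Fin 2) (x : Plane) : ℂ :=
  pderiv m (C i j k) x
    - ∑ n, ((L n m i x : ℂ) * C n j k x + (L n m j x : ℂ) * C i n k x + (L n m k x : ℂ) * C i j n x)

theorem covDerivComplexCubic_re (L : Fin 2 → Fin 2 → Fin 2 → Plane → ℝ)
    (hC : ∀ i j k, DifferentiableAt ℝ (C i j k) x) (m i j k : Fin 2) :
    (covDerivComplexCubic L C m i j k x).re =
      covDerivCubic L (fun a b c y => (C a b c y).re) m i j k x := by
  simp only [covDerivComplexCubic, covDerivCubic, pderiv_re (hC i j k), Fin.sum_univ_two]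
  simp

theorem IsComplexCubic.complexStructure_slot₁ (hg : (G x).PosDef)
    {c : Fin 2 → Fin 2 → Fin 2 → ℂ} (hc : IsComplexCubic (G x) c) (u j k : Fin 2) :
    ∑ m, (complexStructure G m u x : ℂ) * c m j k = Complex.I * c u j k :=
  (complexLinear_iff hg fun m => c m j k).mpr (hc.slot₁ j k) u

theorem IsComplexCubic.complexStructure_slot₂ (hg : (G x).PosDef)
    {c : Fin 2 → Fin 2 → Fin 2 → ℂ} (hc : IsComplexCubic (G x) c) (i u k : Fin 2) :
    ∑ m, (complexStructure G m u x : ℂ) * c i m k = Complex.I * c i u k :=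
  (complexLinear_iff hg fun m => c i m k).mpr (hc.slot₂ i k) u

theorem IsComplexCubic.complexStructure_slot₃ (hg : (G x).PosDef)
    {c : Fin 2 → Fin 2 → Fin 2 → ℂ} (hc : IsComplexCubic (G x) c) (i j u : Fin 2) :
    ∑ m, (complexStructure G m u x : ℂ) * c i j m = Complex.I * c i j u :=
  (complexLinear_iff hg fun m => c i j m).mpr (hc.slot₃ i j) u

variable (h : IsMetricOn G U) (hU : IsOpen U) (hx : x ∈ U)
  (hC : ∀ i j k, ContDiffOn ℝ ∞ (C i j k) U)
  (hH : ∀ y ∈ U, IsComplexCubic (G y) fun i j k => C i j k y)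
include h hU hx hC hH

/-- As the complex structure is parallel, the covariant derivative of a cubic differential is again
complex trilinear. -/
theorem isComplexCubic_covDeriv (a : Fin 2) :
    IsComplexCubic (G x) fun i j k => covDerivComplexCubic (leviCivita G) C a i j k x := by
  have hCd : ∀ i j k, DifferentiableAt ℝ (C i j k) x := fun i j k =>
    (hC i j k).differentiableAt_of_mem hU hx
  have hJ : ∀ m a, DifferentiableAt ℝ (complexStructure G m a) x := fun m a =>
    (h.smooth_complexStructure m a).differentiableAt_of_mem hU hx
  have hJc : ∀ m a, DifferentiableAt ℝ (fun y => (complexStructure G m a y : ℂ)) x := fun m a =>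
    Complex.ofRealCLM.differentiableAt.comp x (hJ m a)
  have hg := h.posDef x hx
  have hdJ := h.pderiv_complexStructure hU hx
  have s1 := fun u j k => (hH x hx).complexStructure_slot₁ hg u j k
  have s2 := fun u j k => (hH x hx).complexStructure_slot₂ hg u j k
  have s3 := fun u j k => (hH x hx).complexStructure_slot₃ hg u j k
  simp only [Fin.sum_univ_two] at s1 s2 s3 hdJ
  refine ⟨fun j k => (complexLinear_iff hg fun m =>
      covDerivComplexCubic (leviCivita G) C a m j k x).mp fun u => ?_,
    fun i k => (complexLinear_iff hg fun m =>
      covDerivComplexCubic (leviCivita G) C a i m k x).mp fun u => ?_,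
    fun i j => (complexLinear_iff hg fun m =>
      covDerivComplexCubic (leviCivita G) C a i j m x).mp fun u => ?_⟩
  · have d := pderiv_congr a hU hx fun y hy =>
      (hH y hy).complexStructure_slot₁ (h.posDef y hy) u j k
    simp only [Fin.sum_univ_two] at d
    simp (disch := fun_prop) only [pderiv_add, pderiv_mul, pderiv_const, pderiv_ofReal, hdJ] at d
    push_cast at d
    simp only [covDerivComplexCubic, Fin.sum_univ_two]
    linear_combination d - (leviCivita G 0 a u x : ℂ) * s1 0 j k
      - (leviCivita G 1 a u x : ℂ) * s1 1 j k
      - (leviCivita G 0 a j x : ℂ) * s1 u 0 k - (leviCivita G 1 a j x : ℂ) * s1 u 1 k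
      - (leviCivita G 0 a k x : ℂ) * s1 u j 0 - (leviCivita G 1 a k x : ℂ) * s1 u j 1
  · have d := pderiv_congr a hU hx fun y hy =>
      (hH y hy).complexStructure_slot₂ (h.posDef y hy) i u k
    simp only [Fin.sum_univ_two] at d
    simp (disch := fun_prop) only [pderiv_add, pderiv_mul, pderiv_const, pderiv_ofReal, hdJ] at d
    push_cast at d
    simp only [covDerivComplexCubic, Fin.sum_univ_two]
    linear_combination d - (leviCivita G 0 a u x : ℂ) * s2 i 0 k
      - (leviCivita G 1 a u x : ℂ) * s2 i 1 k
      - (leviCivita G 0 a i x : ℂ) * s2 0 u k - (leviCivita G 1 a i x : ℂ) * s2 1 u k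
      - (leviCivita G 0 a k x : ℂ) * s2 i u 0 - (leviCivita G 1 a k x : ℂ) * s2 i u 1
  · have d := pderiv_congr a hU hx fun y hy =>
      (hH y hy).complexStructure_slot₃ (h.posDef y hy) i j u
    simp only [Fin.sum_univ_two] at d
    simp (disch := fun_prop) only [pderiv_add, pderiv_mul, pderiv_const, pderiv_ofReal, hdJ] at d
    push_cast at d
    simp only [covDerivComplexCubic, Fin.sum_univ_two]
    linear_combination d - (leviCivita G 0 a u x : ℂ) * s3 i j 0
      - (leviCivita G 1 a u x : ℂ) * s3 i j 1
      - (leviCivita G 0 a i x : ℂ) * s3 0 j u - (leviCivita G 1 a i x : ℂ) * s3 1 j u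
      - (leviCivita G 0 a j x : ℂ) * s3 i 0 u - (leviCivita G 1 a j x : ℂ) * s3 i 1 u

omit hC in
/-- The del-bar operator is the `(0,1)`-part of the Levi-Civita covariant derivative. -/
theorem delbar_eq (a i j k : Fin 2) :
    delbar G C a i j k x = (1 / 2 : ℂ) * (covDerivComplexCubic (leviCivita G) C a i j k x
      + Complex.I * ∑ m, (complexStructure G m a x : ℂ)
        * covDerivComplexCubic (leviCivita G) C m i j k x) := by
  have hg := h.posDef x hx
  have s1 := fun u j k => (hH x hx).complexStructure_slot₁ hg u j k
  have s2 := fun u j k => (hH x hx).complexStructure_slot₂ hg u j k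
  have s3 := fun u j k => (hH x hx).complexStructure_slot₃ hg u j k
  have hL := h.leviCivita_comm hU hx
  simp only [delbar, covDerivComplexCubic, h.pderiv_complexStructure hU hx,
    Fin.sum_univ_two] at s1 s2 s3 ⊢
  push_cast
  simp only [hL _ i, hL _ j, hL _ k]
  have I2 := Complex.I_sq
  linear_combination (1 / 2 : ℂ) * Complex.I * (
    (leviCivita G 0 a i x : ℂ) * s1 0 j k + (leviCivita G 1 a i x : ℂ) * s1 1 j k
    + (leviCivita G 0 a j x : ℂ) * s2 i 0 k + (leviCivita G 1 a j x : ℂ) * s2 i 1 k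
    + (leviCivita G 0 a k x : ℂ) * s3 i j 0 + (leviCivita G 1 a k x : ℂ) * s3 i j 1)
    + (1 / 2 : ℂ) * I2 * ((leviCivita G 0 a i x : ℂ) * C 0 j k x
      + (leviCivita G 1 a i x : ℂ) * C 1 j k x
      + (leviCivita G 0 a j x : ℂ) * C i 0 k x + (leviCivita G 1 a j x : ℂ) * C i 1 k x
      + (leviCivita G 0 a k x : ℂ) * C i j 0 x + (leviCivita G 1 a k x : ℂ) * C i j 1 x)

/-- The equation `∂̄C = (β - i ⋆β) ⊗ C` is equivalent to a divergence equation for `Re C`. -/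
theorem delbar_eq_iff (β : Fin 2 → Plane → ℝ) :
    (∀ a i j k, delbar G C a i j k x =
      ((β a x : ℂ) - Complex.I * (hodgeStar G β a x : ℂ)) * C i j k x) ↔
    ∀ i j, ∑ k, ∑ l, (G x)⁻¹ k l *
      (covDerivCubic (leviCivita G) (fun a b c y => (C a b c y).re) k i j l x
        - 2 * (β k x * (C i j l x).re)) = 0 := by
  have hg := h.posDef x hx
  set T : Fin 2 → Fin 2 → Fin 2 → Fin 2 → ℂ := fun a i j k =>
    covDerivComplexCubic (leviCivita G) C a i j k x - 2 * ((β a x : ℂ) * C i j k x) with hT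
  have hTc : ∀ a, IsComplexCubic (G x) (T a) := by
    intro a
    have c1 := isComplexCubic_covDeriv h hU hx hC hH a
    have c2 := hH x hx
    refine ⟨fun j k => ?_, fun i k => ?_, fun i j => ?_⟩
    · linear_combination c1.slot₁ j k - 2 * (β a x : ℂ) * c2.slot₁ j k
    · linear_combination c1.slot₂ i k - 2 * (β a x : ℂ) * c2.slot₂ i k
    · linear_combination c1.slot₃ i j - 2 * (β a x : ℂ) * c2.slot₃ i j
  have hre : ∀ a i j k, (T a i j k).re =
      covDerivCubic (leviCivita G) (fun a b c y => (C a b c y).re) a i j k x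
        - 2 * (β a x * (C i j k x).re) := by
    intro a i j k
    rw [← covDerivComplexCubic_re _ fun i j k => (hC i j k).differentiableAt_of_mem hU hx]
    simp [hT]
  simp only [← hre]
  rw [← typeOneZero_iff_divergence hg hTc]
  have key : ∀ i j k, (∀ a, delbar G C a i j k x =
      ((β a x : ℂ) - Complex.I * (hodgeStar G β a x : ℂ)) * C i j k x) ↔
      (G x 0 0 : ℂ) * T 1 i j k = conformalRatio (G x) * T 0 i j k := by
    intro i j k
    rw [← complexLinear_iff hg fun a => T a i j k]
    refine forall_congr' fun a => ?_
    rw [delbar_eq h hU hx hH]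
    simp only [hodgeStar, hT, Fin.sum_univ_two]
    push_cast
    constructor
    · intro e
      linear_combination -2 * Complex.I * e + (
        (complexStructure G 0 a x : ℂ) * covDerivComplexCubic (leviCivita G) C 0 i j k x
        + (complexStructure G 1 a x : ℂ) * covDerivComplexCubic (leviCivita G) C 1 i j k x
        - 2 * ((complexStructure G 0 a x : ℂ) * β 0 x + (complexStructure G 1 a x : ℂ) * β 1 x)
          * C i j k x) * Complex.I_sq
    · intro e
      linear_combination (1 / 2) * Complex.I * e + (1 / 2) * (
        covDerivComplexCubic (leviCivita G) C a i j k x - 2 * β a x * C i j k x) * Complex.I_sq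
  constructor
  · intro H i j k
    exact (key i j k).mp fun a => H a i j k
  · intro H a i j k
    exact (key i j k).mpr (H i j k) a

end Delbar

/-! ### The mean curvature of the zero section -/

/-- The base point of a covector, in induced coordinates. -/
noncomputable def cotangentBase : EuclideanSpace ℝ (Fin 2 ⊕ Fin 2) →L[ℝ] Plane :=
  (EuclideanSpace.equiv (Fin 2) ℝ).symm.toContinuousLinearMap ∘L
    ContinuousLinearMap.pi fun i => EuclideanSpace.proj (Sum.inl i : Fin 2 ⊕ Fin 2)

theorem cotangentBase_apply (z : EuclideanSpace ℝ (Fin 2 ⊕ Fin 2)) :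
    cotangentBase z = WithLp.toLp 2 fun i => z (Sum.inl i) := rfl

theorem cotangentBase_zeroSection (x : Plane) : cotangentBase (_root_.zeroSection x) = x := by
  rw [cotangentBase_apply]; ext i; simp [_root_.zeroSection]

theorem pderiv_coord {ι : Type*} [Fintype ι] [DecidableEq ι] (i j : ι) (x : EuclideanSpace ℝ ι) :
    pderiv i (fun y : EuclideanSpace ℝ ι => y j) x = if j = i then 1 else 0 := by
  have : fderiv ℝ (fun y : EuclideanSpace ℝ ι => y j) x = EuclideanSpace.proj j :=
    (EuclideanSpace.proj  j : EuclideanSpace ℝ ι →L[ℝ] ℝ).fderiv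
  simp [pderiv, this]

theorem pderiv_inl_comp_cotangentBase {f : Plane → ℝ} {z : EuclideanSpace ℝ (Fin 2 ⊕ Fin 2)}
    (hf : DifferentiableAt ℝ f (cotangentBase z)) (i : Fin 2) :
    pderiv (Sum.inl i) (fun y => f (cotangentBase y)) z = pderiv i f (cotangentBase z) := by
  have := (hf.hasFDerivAt.comp z cotangentBase.hasFDerivAt).fderiv
  simp only [pderiv]
  change (fderiv ℝ (f ∘ ⇑cotangentBase) z) _ = _
  rw [this, ContinuousLinearMap.comp_apply]
  congr 1
  ext j
  simp [cotangentBase_apply]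

theorem pderiv_inr_comp_cotangentBase {f : Plane → ℝ} {z : EuclideanSpace ℝ (Fin 2 ⊕ Fin 2)}
    (hf : DifferentiableAt ℝ f (cotangentBase z)) (i : Fin 2) :
    pderiv (Sum.inr i) (fun y => f (cotangentBase y)) z = 0 := by
  have := (hf.hasFDerivAt.comp z cotangentBase.hasFDerivAt).fderiv
  simp only [pderiv]
  change (fderiv ℝ (f ∘ ⇑cotangentBase) z) _ = _
  rw [this, ContinuousLinearMap.comp_apply]
  have : cotangentBase (EuclideanSpace.single (Sum.inr i) (1 : ℝ)) = 0 := by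
    ext j
    simp [cotangentBase_apply]
  rw [this, map_zero]

theorem leviCivita_congr_smul {G H : Plane → Matrix (Fin 2) (Fin 2) ℝ} {U : Set Plane}
    (hU : IsOpen U) {x : Plane} (hx : x ∈ U) {c : ℝ} (hc : c ≠ 0)
    (hG : ∀ i j, DifferentiableAt ℝ (fun y => G y i j) x)
    (h : ∀ y ∈ U, H y = c • G y) (k i j : Fin 2) :
    leviCivita H k i j x = leviCivita G k i j x := by
  have hd : ∀ m i j, pderiv m (fun y => H y i j) x = c * pderiv m (fun y => G y i j) x := by
    intro m i j
    rw [← pderiv_const_mul m c (hG i j)]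
    exact pderiv_congr m hU hx fun y hy => by simp [h y hy]
  have hi : (H x)⁻¹ = c⁻¹ • (G x)⁻¹ := by
    rw [h x hx]
    ext i j
    rcases fin_two_cases i with rfl | rfl <;> rcases fin_two_cases j with rfl | rfl <;>
      simp only [Matrix.inv_apply_zero_zero, Matrix.inv_apply_zero_one, Matrix.inv_apply_one_zero,
        Matrix.inv_apply_one_one, Matrix.smul_apply, smul_eq_mul, Matrix.det_smul,
        Fintype.card_fin] <;> field_simp
  simp only [leviCivita, hd, hi, Fin.sum_univ_two, Matrix.smul_apply, smul_eq_mul]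
  field_simp

section ZeroSection

variable {Γ : Fin 2 → Fin 2 → Fin 2 → Plane → ℝ} {x : Plane}

theorem cotangentMetric_inl_inl (z : EuclideanSpace ℝ (Fin 2 ⊕ Fin 2)) (i j : Fin 2) :
    cotangentMetric Γ z (Sum.inl i) (Sum.inl j) =
      -(z (Sum.inr i) * z (Sum.inr j) + ricciSymm Γ (cotangentBase z) i j
        - ∑ k, z (Sum.inr k) * ((Γ k i j (cotangentBase z) + Γ k j i (cotangentBase z)) / 2)) := rfl

theorem cotangentMetric_inl_inr (z : EuclideanSpace ℝ (Fin 2 ⊕ Fin 2)) (i j : Fin 2) :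
    cotangentMetric Γ z (Sum.inl i) (Sum.inr j) =
      (-(1 / 2 : ℝ) • (1 : Matrix (Fin 2) (Fin 2) ℝ)) i j := rfl

theorem cotangentMetric_zeroSection (x : Plane) :
    cotangentMetric Γ (_root_.zeroSection x) = Matrix.fromBlocks (-ricciSymm Γ x)
      (-(1 / 2 : ℝ) • 1) (-(1 / 2 : ℝ) • 1) 0 := by
  ext μ ν
  rcases μ with i | i <;> rcases ν with j | j
  · rw [cotangentMetric_inl_inl, cotangentBase_zeroSection]
    simp [_root_.zeroSection]
  · rfl
  · rfl
  · rfl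

theorem inv_cotangentMetric_zeroSection (x : Plane) :
    (cotangentMetric Γ (_root_.zeroSection x))⁻¹ = Matrix.fromBlocks 0 (-(2 : ℝ) • 1) (-(2 : ℝ) • 1)
      ((4 : ℝ) • ricciSymm Γ x) := by
  rw [cotangentMetric_zeroSection]
  apply Matrix.inv_eq_right_inv
  rw [Matrix.fromBlocks_multiply, ← Matrix.fromBlocks_one]
  congr 1
  · simp
  · simp [smul_smul]; norm_num
  · simp
  · simp

variable (hΓ : ∀ k i j, DifferentiableAt ℝ (Γ k i j) x)
  (hr : ∀ i j, DifferentiableAt ℝ (fun y => ricciSymm Γ y i j) x)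
include hΓ hr

/-- As `ξ = 0` along the zero section, a derivative of the terms of `h_∇` that contain `ξ` falls on
a factor `ξ`; the quadratic term does not contribute. -/
theorem pderiv_cotangentMetric (m : Fin 2 ⊕ Fin 2) (i j : Fin 2) :
    pderiv m (fun z => cotangentMetric Γ z (Sum.inl i) (Sum.inl j)) (_root_.zeroSection x)
      = -(pderiv m (fun z => ricciSymm Γ (cotangentBase z) i j) (_root_.zeroSection x)
        - ∑ k, (if Sum.inr k = m then 1 else 0) * ((Γ k i j x + Γ k j i x) / 2)) := by
  have e := cotangentBase_zeroSection x
  have hΓ' : ∀ k i j, DifferentiableAt ℝ (fun z => Γ k i j (cotangentBase z))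
      (_root_.zeroSection x) :=
    fun k i j => DifferentiableAt.comp (g := Γ k i j) _ (by rw [e]; exact hΓ k i j)
      cotangentBase.differentiableAt
  have hr' : DifferentiableAt ℝ (fun z => ricciSymm Γ (cotangentBase z) i j)
      (_root_.zeroSection x) :=
    DifferentiableAt.comp (g := fun y => ricciSymm Γ y i j) _ (by rw [e]; exact hr i j)
      cotangentBase.differentiableAt
  have hz : ∀ μ, DifferentiableAt ℝ (fun z : EuclideanSpace ℝ (Fin 2 ⊕ Fin 2) => z μ)
      (_root_.zeroSection x) := fun μ =>
    (EuclideanSpace.proj μ : EuclideanSpace ℝ (Fin 2 ⊕ Fin 2) →L[ℝ] ℝ).differentiableAt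
  have hm : ∀ k, DifferentiableAt ℝ
      (fun z => (Γ k i j (cotangentBase z) + Γ k j i (cotangentBase z)) / 2)
      (_root_.zeroSection x) :=
    fun k => by
      simp only [div_eq_mul_inv]
      exact ((hΓ' k i j).fun_add (hΓ' k j i)).mul_const (2 : ℝ)⁻¹
  have z0 : ∀ k, (_root_.zeroSection x) (Sum.inr k) = 0 := fun k => rfl
  simp only [cotangentMetric_inl_inl, Fin.sum_univ_two]
  rw [pderiv_neg, pderiv_sub m (((hz _).fun_mul (hz _)).fun_add hr')
      (((hz _).fun_mul (hm 0)).fun_add ((hz _).fun_mul (hm 1))),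
    pderiv_add m ((hz _).fun_mul (hz _)) hr', pderiv_mul m (hz _) (hz _),
    pderiv_add m ((hz _).fun_mul (hm 0)) ((hz _).fun_mul (hm 1)), pderiv_mul m (hz _) (hm 0),
    pderiv_mul m (hz _) (hm 1)]
  simp only [z0, pderiv_coord, e]
  ring

theorem pderiv_inl_cotangentMetric (m i j : Fin 2) :
    pderiv (Sum.inl m) (fun z => cotangentMetric Γ z (Sum.inl i) (Sum.inl j)) (_root_.zeroSection x)
      = -pderiv m (fun y => ricciSymm Γ y i j) x := by
  have e := cotangentBase_zeroSection x
  have h1 := pderiv_inl_comp_cotangentBase (f := fun y => ricciSymm Γ y i j)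
    (z := _root_.zeroSection x) (by rw [e]; exact hr i j) m
  rw [e] at h1
  rw [pderiv_cotangentMetric hΓ hr, h1]
  simp

theorem pderiv_inr_cotangentMetric (hs : ∀ k i j, Γ k i j x = Γ k j i x) (m i j : Fin 2) :
    pderiv (Sum.inr m) (fun z => cotangentMetric Γ z (Sum.inl i) (Sum.inl j)) (_root_.zeroSection x)
      = Γ m i j x := by
  have e := cotangentBase_zeroSection x
  have h1 := pderiv_inr_comp_cotangentBase (f := fun y => ricciSymm Γ y i j)
    (z := _root_.zeroSection x) (by rw [e]; exact hr i j) m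
  rw [pderiv_cotangentMetric hΓ hr, h1]
  simp [hs _ j i]

omit hΓ hr in
theorem pderiv_zeroSection_inl (a i : Fin 2) (y : Plane) :
    pderiv a (fun y => _root_.zeroSection y (Sum.inl i)) y = if i = a then 1 else 0 :=
  pderiv_coord a i y

omit hΓ hr in
theorem pderiv_zeroSection_inr (a i : Fin 2) (y : Plane) :
    pderiv a (fun y => _root_.zeroSection y (Sum.inr i)) y = 0 :=
  pderiv_const a (0 : ℝ)

theorem leviCivita_cotangentMetric_inl (hs : ∀ k i j, Γ k i j x = Γ k j i x) (k i j : Fin 2) :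
    leviCivita (cotangentMetric Γ) (Sum.inl k) (Sum.inl i) (Sum.inl j) (_root_.zeroSection x)
      = Γ k i j x := by
  simp only [leviCivita, Fintype.sum_sum_type, inv_cotangentMetric_zeroSection,
    Matrix.fromBlocks_apply₁₁, Matrix.fromBlocks_apply₁₂, Matrix.zero_apply, Matrix.smul_apply,
    cotangentMetric_inl_inr, pderiv_const, pderiv_inr_cotangentMetric hΓ hr hs, Fin.sum_univ_two]
  rcases fin_two_cases k with rfl | rfl <;> simp

theorem leviCivita_cotangentMetric_inr (hs : ∀ k i j, Γ k i j x = Γ k j i x) (k i j : Fin 2) :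
    leviCivita (cotangentMetric Γ) (Sum.inr k) (Sum.inl i) (Sum.inl j) (_root_.zeroSection x)
      = (pderiv i (fun y => ricciSymm Γ y j k) x + pderiv j (fun y => ricciSymm Γ y i k) x
          - pderiv k (fun y => ricciSymm Γ y i j) x)
        - 2 * ∑ l, ricciSymm Γ x k l * Γ l i j x := by
  simp only [leviCivita, Fintype.sum_sum_type, inv_cotangentMetric_zeroSection,
    Matrix.fromBlocks_apply₂₁, Matrix.fromBlocks_apply₂₂, Matrix.smul_apply,
    cotangentMetric_inl_inr, pderiv_const, pderiv_inr_cotangentMetric hΓ hr hs,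
    pderiv_inl_cotangentMetric hΓ hr, Fin.sum_univ_two]
  rcases fin_two_cases k with rfl | rfl <;> simp <;> ring

end ZeroSection

/-- The zero section of `(T^*Σ, h_∇)` has vanishing mean curvature iff the difference of `∇` and the
Levi-Civita connection of the metric `±Ric⁺(∇)` is trace-free in its lower indices. -/
theorem meanCurvature_zeroSection_eq_zero_iff {Γ : Fin 2 → Fin 2 → Fin 2 → Plane → ℝ}
    {G : Plane → Matrix (Fin 2) (Fin 2) ℝ} {U : Set Plane} {x : Plane} (h : IsMetricOn G U)
    (hU : IsOpen U) (hx : x ∈ U) (hΓ : ∀ k i j, ContDiffOn ℝ ∞ (Γ k i j) U)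
    (hs : ∀ k i j, Γ k i j x = Γ k j i x) {s : ℝ} (hs0 : s ≠ 0)
    (hG : ∀ y ∈ U, ricciSymm Γ y = s • G y) :
    (∀ μ, meanCurvature (cotangentMetric Γ) _root_.zeroSection μ x = 0) ↔
      ∀ k, ∑ i, ∑ j, (G x)⁻¹ i j * (Γ k i j x - leviCivita G k i j x) = 0 := by
  have hΓd : ∀ k i j, DifferentiableAt ℝ (Γ k i j) x := fun k i j =>
    (hΓ k i j).differentiableAt_of_mem hU hx
  have hGd := fun i j => h.differentiableAt hU hx i j
  have hrG : ∀ y ∈ U, ∀ i j, ricciSymm Γ y i j = s * G y i j := fun y hy i j => by simp [hG y hy]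
  have hrd : ∀ i j, DifferentiableAt ℝ (fun y => ricciSymm Γ y i j) x := fun i j =>
    ((hGd i j).const_mul s).congr_of_eventuallyEq
      (Filter.eventuallyEq_of_mem (hU.mem_nhds hx) fun y hy => hrG y hy i j)
  have hpr : ∀ m i j, pderiv m (fun y => ricciSymm Γ y i j) x
      = s * pderiv m (fun y => G y i j) x := fun m i j => by
    rw [← pderiv_const_mul m s (hGd i j)]
    exact pderiv_congr m hU hx fun y hy => hrG y hy i j
  have hpull : ∀ y ∈ U, pullbackMetric (cotangentMetric Γ) _root_.zeroSection y = (-s) • G y := by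
    intro y hy
    ext a b
    simp only [pullbackMetric, Matrix.of_apply, Fintype.sum_sum_type, pderiv_zeroSection_inl,
      pderiv_zeroSection_inr, cotangentMetric_zeroSection, Matrix.fromBlocks_apply₁₁, hG y hy]
    simp
  have hLC : ∀ k i j, leviCivita (pullbackMetric (cotangentMetric Γ) _root_.zeroSection) k i j x
      = leviCivita G k i j x := fun k i j =>
    leviCivita_congr_smul hU hx (neg_ne_zero.mpr hs0) hGd hpull k i j
  have hinl : ∀ k a b,
      secondFundamentalForm (cotangentMetric Γ) _root_.zeroSection (Sum.inl k) a b x =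
        Γ k a b x - leviCivita G k a b x := by
    intro k a b
    have hc : pderiv b (fun y => _root_.zeroSection y (Sum.inl k)) =
        fun _ => if k = b then 1 else 0 :=
      funext fun y => pderiv_zeroSection_inl b k y
    simp only [secondFundamentalForm, hc, pderiv_const, Fintype.sum_sum_type,
      pderiv_zeroSection_inl, pderiv_zeroSection_inr, hLC,
      leviCivita_cotangentMetric_inl hΓd hrd hs]
    simp
  have hinr : ∀ k a b,
      secondFundamentalForm (cotangentMetric Γ) _root_.zeroSection (Sum.inr k) a b x =
        -2 * s * ∑ l, G x k l * (Γ l a b x - leviCivita G l a b x) := by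
    intro k a b
    have hc : pderiv b (fun y => _root_.zeroSection y (Sum.inr k)) = fun _ => 0 :=
      funext fun y => pderiv_zeroSection_inr b k y
    have e := h.sum_mul_leviCivita hx k a b
    simp only [secondFundamentalForm, hc, pderiv_const, Fintype.sum_sum_type,
      pderiv_zeroSection_inl, pderiv_zeroSection_inr, hLC,
      leviCivita_cotangentMetric_inr hΓd hrd hs, hpr, hrG x hx, mul_sub, Finset.sum_sub_distrib, e]
    simp
    ring
  have hinv : (pullbackMetric (cotangentMetric Γ) _root_.zeroSection x)⁻¹ = (-s)⁻¹ • (G x)⁻¹ := by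
    rw [hpull x hx]
    exact Matrix.inv_smul' (A := G x) (Units.mk0 (-s) (neg_ne_zero.mpr hs0))
      (h.det_ne_zero hx).isUnit
  have hH : ∀ μ, meanCurvature (cotangentMetric Γ) _root_.zeroSection μ x =
      (2 : ℝ)⁻¹ * (-s)⁻¹ * ∑ a, ∑ b, (G x)⁻¹ a b *
        secondFundamentalForm (cotangentMetric Γ) _root_.zeroSection μ a b x := by
    intro μ
    simp only [meanCurvature, hinv, Fintype.card_fin, Fin.sum_univ_two, Matrix.smul_apply,
      smul_eq_mul]
    push_cast
    ring
  have hc0 : (2 : ℝ)⁻¹ * (-s)⁻¹ ≠ 0 := by simp [hs0]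
  constructor
  · intro H k
    have := H (Sum.inl k)
    rw [hH] at this
    simpa only [hinl, mul_eq_zero, hc0, false_or] using this
  · rintro H (k | k)
    · rw [hH]; simp only [hinl, H k, mul_zero]
    · rw [hH]
      simp only [hinr]
      have H0 := H 0
      have H1 := H 1
      simp only [Fin.sum_univ_two] at H0 H1 ⊢
      linear_combination (2 : ℝ)⁻¹ * (-s)⁻¹ * (-2 * s) * (G x k 0 * H0 + G x k 1 * H1)

/-! ### Changes of coordinates -/

/-- The Jacobian matrix `∂φ^c/∂x^j`. -/
noncomputable def jacobian (φ : Plane → Plane) (c j : Fin 2) (x : Plane) : ℝ :=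
  pderiv j (fun y => φ y c) x

/-- A smooth map `φ` from the open set `V` to the open set `W` with positive Jacobian
determinant. -/
structure IsCoordChange (φ : Plane → Plane) (V W : Set Plane) : Prop where
  isOpen_source : IsOpen V
  isOpen_target : IsOpen W
  mapsTo : ∀ y ∈ V, φ y ∈ W
  smooth : ∀ c, ContDiffOn ℝ ∞ (fun y => φ y c) V
  det_pos : ∀ y ∈ V, 0 < jacobian φ 0 0 y * jacobian φ 1 1 y - jacobian φ 0 1 y * jacobian φ 1 0 y

/-- The transformation law of Christoffel symbols under the change of coordinates `φ`. -/
def ChristoffelLaw (Γ Γ' : Fin 2 → Fin 2 → Fin 2 → Plane → ℝ) (φ : Plane → Plane)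
    (V : Set Plane) : Prop :=
  ∀ y ∈ V, ∀ c i j, ∑ k, jacobian φ c k y * Γ k i j y =
    pderiv i (jacobian φ c j) y
      + ∑ a, ∑ b, Γ' c a b (φ y) * jacobian φ a i y * jacobian φ b j y

/-- The transformation law of a bilinear form at a point, with Jacobian matrix `F`. -/
def BilinLaw (F : Fin 2 → Fin 2 → ℝ) (g g' : Fin 2 → Fin 2 → ℝ) : Prop :=
  ∀ i j, g i j = ∑ a, ∑ b, g' a b * F a i * F b j

/-- The transformation law of a trilinear form at a point, with Jacobian matrix `F`. -/
def TrilinLaw (F : Fin 2 → Fin 2 → ℝ) (r r' : Fin 2 → Fin 2 → Fin 2 → ℝ) : Prop :=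
  ∀ i j k, r i j k = ∑ a, ∑ b, ∑ c, r' a b c * F a i * F b j * F c k

/-- The transformation law of a `1`-form at a point, with Jacobian matrix `F`. -/
def LinLaw (F : Fin 2 → Fin 2 → ℝ) (b b' : Fin 2 → ℝ) : Prop :=
  ∀ i, b i = ∑ a, b' a * F a i

/-- The transformation law at a point of a tensor with one upper and two lower indices. -/
def DiffLaw (F : Fin 2 → Fin 2 → ℝ) (A A' : Fin 2 → Fin 2 → Fin 2 → ℝ) : Prop :=
  ∀ c i j, ∑ k, F c k * A k i j = ∑ a, ∑ b, A' c a b * F a i * F b j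

section PointwiseLaws

variable {F : Fin 2 → Fin 2 → ℝ} (hF : F 0 0 * F 1 1 - F 0 1 * F 1 0 ≠ 0)
include hF

theorem eq_of_jacobian_mul {u v : Fin 2 → ℝ}
    (h : ∀ c, ∑ k, F c k * u k = ∑ k, F c k * v k) (k : Fin 2) : u k = v k := by
  have h0 := h 0
  have h1 := h 1
  simp only [Fin.sum_univ_two] at h0 h1
  apply mul_left_cancel₀ hF
  rcases fin_two_cases k with rfl | rfl
  · linear_combination F 1 1 * h0 - F 0 1 * h1
  · linear_combination F 0 0 * h1 - F 1 0 * h0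

theorem eq_of_mul_jacobian {u v : Fin 2 → ℝ}
    (h : ∀ i, ∑ a, u a * F a i = ∑ a, v a * F a i) (a : Fin 2) : u a = v a := by
  have h0 := h 0
  have h1 := h 1
  simp only [Fin.sum_univ_two] at h0 h1
  apply mul_left_cancel₀ hF
  rcases fin_two_cases a with rfl | rfl
  · linear_combination F 1 1 * h0 - F 1 0 * h1
  · linear_combination F 0 0 * h1 - F 0 1 * h0

theorem DiffLaw.trace {A A' : Fin 2 → Fin 2 → Fin 2 → ℝ} (h : DiffLaw F A A') :
    LinLaw F (fun j => ∑ k, A k k j) fun j => ∑ k, A' k k j := by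
  intro j
  apply mul_left_cancel₀ hF
  have h00 := h 0 0 j
  have h01 := h 0 1 j
  have h10 := h 1 0 j
  have h11 := h 1 1 j
  simp only [Fin.sum_univ_two] at h00 h01 h10 h11 ⊢
  linear_combination F 1 1 * h00 - F 0 1 * h10 + F 0 0 * h11 - F 1 0 * h01

/-- The twisting tensor is natural. -/
theorem diffLaw_twistTensor {g g' : Matrix (Fin 2) (Fin 2) ℝ} {b b' : Fin 2 → ℝ}
    {r r' : Fin 2 → Fin 2 → Fin 2 → ℝ} (hg : g.PosDef) (hg' : g'.PosDef) (h : BilinLaw F g g')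
    (hb : LinLaw F b b') (hr : TrilinLaw F r r') :
    DiffLaw F (twistTensor g b r) (twistTensor g' b' r') := by
  intro c i j
  set A := twistTensor g b r with hA
  set A' := twistTensor g' b' r' with hA'
  have l1 := fun l => sum_mul_twistTensor (b := b) (r := r) hg l i j
  have l2 := fun l a b => sum_mul_twistTensor (b := b') (r := r') hg' l a b
  rw [← hA] at l1
  rw [← hA'] at l2
  have key : ∀ a, ∑ c, g' a c * ((∑ k, F c k * A k i j)
      - ∑ a, ∑ b, A' c a b * F a i * F b j) = 0 := by
    refine eq_of_mul_jacobian hF (u := fun a => ∑ c, g' a c * ((∑ k, F c k * A k i j)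
      - ∑ a, ∑ b, A' c a b * F a i * F b j)) (v := fun _ => 0) fun l => ?_
    have m1 := l1 l
    rw [Fin.sum_univ_two] at m1
    rw [h l 0, h l 1, h i j, h l j, h l i, hb l, hb i, hb j, hr i j l] at m1
    simp only [Fin.sum_univ_two] at m1 l2 ⊢
    simp only [zero_mul, add_zero]
    linear_combination m1
      - F 0 l * (F 0 i * F 0 j * l2 0 0 0 + F 0 i * F 1 j * l2 0 0 1 + F 1 i * F 0 j * l2 0 1 0
        + F 1 i * F 1 j * l2 0 1 1)
      - F 1 l * (F 0 i * F 0 j * l2 1 0 0 + F 0 i * F 1 j * l2 1 0 1 + F 1 i * F 0 j * l2 1 1 0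
        + F 1 i * F 1 j * l2 1 1 1)
  have e := hg'.sum_inv_mul_mul c fun c => (∑ k, F c k * A k i j)
      - ∑ a, ∑ b, A' c a b * F a i * F b j
  simp only [key, mul_zero, Finset.sum_const_zero] at e
  linarith

end PointwiseLaws

theorem DiffLaw.lower {F : Fin 2 → Fin 2 → ℝ} {A A' : Fin 2 → Fin 2 → Fin 2 → ℝ}
    (h : DiffLaw F A A') {g g' : Fin 2 → Fin 2 → ℝ} (hg : BilinLaw F g g') :
    TrilinLaw F (fun i j l => ∑ k, g l k * A k i j) fun i j l => ∑ k, g' l k * A' k i j := by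
  intro i j l
  have h0 := h 0 i j
  have h1 := h 1 i j
  simp only
  rw [Fin.sum_univ_two, hg l 0, hg l 1]
  simp only [Fin.sum_univ_two] at h0 h1 ⊢
  linear_combination (g' 0 0 * F 0 l + g' 1 0 * F 1 l) * h0 + (g' 0 1 * F 0 l + g' 1 1 * F 1 l) * h1

/-- The complex structure is natural under changes of coordinates that preserve the
orientation. -/
theorem complexStructure_natural {F : Fin 2 → Fin 2 → ℝ} (hF : 0 < F 0 0 * F 1 1 - F 0 1 * F 1 0)
    {G G' : Plane → Matrix (Fin 2) (Fin 2) ℝ} {x x' : Plane}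
    (hg' : (G' x').PosDef) (h : BilinLaw F (G x) (G' x')) (c i : Fin 2) :
    ∑ k, F c k * complexStructure G k i x = ∑ a, complexStructure G' c a x' * F a i := by
  have hdet : (G x).det = (F 0 0 * F 1 1 - F 0 1 * F 1 0) ^ 2 * (G' x').det := by
    rw [Matrix.det_fin_two, Matrix.det_fin_two, h 0 0, h 0 1, h 1 0, h 1 1]
    simp only [Fin.sum_univ_two]
    ring
  have hsq : Real.sqrt (G x).det = (F 0 0 * F 1 1 - F 0 1 * F 1 0) * Real.sqrt (G' x').det := by
    rw [hdet, Real.sqrt_mul (sq_nonneg _), Real.sqrt_sq hF.le]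
  have hq' : Real.sqrt (G' x').det ≠ 0 := (Real.sqrt_pos.mpr hg'.det_pos).ne'
  have hF' := hF.ne'
  have c' := hg'.apply_comm 1 0
  simp only [complexStructure, hsq, Fin.sum_univ_two]
  have e00 := h 0 0
  have e01 := h 0 1
  have e11 := h 1 1
  simp only [Fin.sum_univ_two, c'] at e00 e01 e11
  generalize hD : F 0 0 * F 1 1 - F 0 1 * F 1 0 = D at *
  rcases fin_two_cases c with rfl | rfl <;> rcases fin_two_cases i with rfl | rfl <;>
    simp only [Matrix.of_apply, Matrix.cons_val', Matrix.cons_val_zero, Matrix.cons_val_one,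
      Matrix.cons_val_fin_one, e00, e01, e11] <;> field_simp <;> rw [← hD] <;> ring

section Laws

variable {φ : Plane → Plane} {V W : Set Plane} {x : Plane}

namespace IsCoordChange

variable (hφ : IsCoordChange φ V W) (hx : x ∈ V)
include hφ

theorem smooth_jacobian (c j : Fin 2) : ContDiffOn ℝ ∞ (jacobian φ c j) V :=
  contDiffOn_pderiv (hφ.smooth c) hφ.isOpen_source j

include hx

theorem differentiableAt : DifferentiableAt ℝ φ x :=
  differentiableAt_euclidean.mpr fun c => (hφ.smooth c).differentiableAt_of_mem hφ.isOpen_source hx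

theorem pderiv_jacobian_comm (c i j : Fin 2) :
    pderiv i (jacobian φ c j) x = pderiv j (jacobian φ c i) x :=
  pderiv_pderiv_comm (hφ.smooth c) hφ.isOpen_source hx i j

theorem pderiv_comp {f : Plane → ℝ} (hf : DifferentiableAt ℝ f (φ x)) (i : Fin 2) :
    pderiv i (fun y => f (φ y)) x = ∑ a, pderiv a f (φ x) * jacobian φ a i x := by
  have hd := hφ.differentiableAt hx
  have h1 : fderiv ℝ (fun y => f (φ y)) x = (fderiv ℝ f (φ x)).comp (fderiv ℝ φ x) :=
    (hf.hasFDerivAt.comp x hd.hasFDerivAt).fderiv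
  have h2 : ∀ c, jacobian φ c i x = (fderiv ℝ φ x (EuclideanSpace.single i 1)) c := by
    intro c
    have : fderiv ℝ (fun y => φ y c) x = (EuclideanSpace.proj c).comp (fderiv ℝ φ x) :=
      ((EuclideanSpace.proj c : Plane →L[ℝ] ℝ).hasFDerivAt.comp x hd.hasFDerivAt).fderiv
    simp [jacobian, pderiv, this]
  have h3 : ∀ v : Plane, v = ∑ a, v a • EuclideanSpace.single a (1 : ℝ) := by
    intro v
    ext j
    rcases fin_two_cases j with rfl | rfl <;> simp
  simp only [pderiv, h1, ContinuousLinearMap.comp_apply, h2]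
  conv_lhs => rw [h3 (fderiv ℝ φ x (EuclideanSpace.single i 1))]
  simp only [map_sum, map_smul, smul_eq_mul]
  exact Finset.sum_congr rfl fun a _ => mul_comm _ _

end IsCoordChange

/-- The curvature tensor is natural. -/
theorem ChristoffelLaw.curvature (hφ : IsCoordChange φ V W) (hx : x ∈ V)
    {Γ Γ' : Fin 2 → Fin 2 → Fin 2 → Plane → ℝ} (h : ChristoffelLaw Γ Γ' φ V)
    (hΓ : ∀ k i j, DifferentiableAt ℝ (Γ k i j) x)
    (hΓ' : ∀ k i j, DifferentiableAt ℝ (Γ' k i j) (φ x)) (d i j k : Fin 2) :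
    ∑ l, jacobian φ d l x * curvature Γ l i j k x =
      ∑ a, ∑ b, ∑ c, _root_.curvature Γ' d a b c (φ x) * jacobian φ a i x * jacobian φ b j x
        * jacobian φ c k x := by
  have hJ : ∀ c j, DifferentiableAt ℝ (jacobian φ c j) x := fun c j =>
    (hφ.smooth_jacobian c j).differentiableAt_of_mem hφ.isOpen_source hx
  have hpJ : ∀ i c j, DifferentiableAt ℝ (pderiv i (jacobian φ c j)) x := fun i c j =>
    (contDiffOn_pderiv (hφ.smooth_jacobian c j) hφ.isOpen_source i).differentiableAt_of_mem
      hφ.isOpen_source hx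
  have hc : ∀ k i j, DifferentiableAt ℝ (fun y => Γ' k i j (φ y)) x := fun k i j =>
    (hΓ' k i j).comp x (hφ.differentiableAt hx)
  have hpc : ∀ m k i j, pderiv m (fun y => Γ' k i j (φ y)) x
      = ∑ a, pderiv a (Γ' k i j) (φ x) * jacobian φ a m x := fun m k i j =>
    hφ.pderiv_comp hx (hΓ' k i j) m
  have D : ∀ i j : Fin 2, pderiv i (fun y => ∑ l, jacobian φ d l y * Γ l j k y) x
      = pderiv i (fun y => pderiv j (jacobian φ d k) y
        + ∑ a, ∑ b, Γ' d a b (φ y) * jacobian φ a j y * jacobian φ b k y) x := fun i j =>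
    pderiv_congr i hφ.isOpen_source hx fun y hy => h y hy d j k
  obtain ⟨H, hH⟩ : ∃ H : Fin 2 → Fin 2 → Fin 2 → Plane → ℝ,
    ∀ k i j y, Γ' k i j (φ y) = H k i j y := ⟨_, fun _ _ _ _ => rfl⟩
  simp only [Fin.sum_univ_two, hH] at D hpc hc
  simp (disch := fun_prop) only [pderiv_add, pderiv_mul, hpc] at D
  simp only [← hH] at D
  have Dij := D i j
  have Dji := D j i
  have s1 := pderiv_pderiv_comm (hφ.smooth_jacobian d k) hφ.isOpen_source hx i j
  have s2 := fun c => hφ.pderiv_jacobian_comm hx c i j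
  have L := h x hx
  simp only [Fin.sum_univ_two] at L
  simp only [_root_.curvature, Fin.sum_univ_two]
  simp only [s2] at Dij
  linear_combination Dij - Dji + s1
    + Γ 0 j k x * L d i 0 + Γ 1 j k x * L d i 1 - Γ 0 i k x * L d j 0 - Γ 1 i k x * L d j 1
    + (Γ' d 0 0 (φ x) * jacobian φ 0 i x + Γ' d 1 0 (φ x) * jacobian φ 1 i x) * L 0 j k
    + (Γ' d 0 1 (φ x) * jacobian φ 0 i x + Γ' d 1 1 (φ x) * jacobian φ 1 i x) * L 1 j k
    - (Γ' d 0 0 (φ x) * jacobian φ 0 j x + Γ' d 1 0 (φ x) * jacobian φ 1 j x) * L 0 i k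
    - (Γ' d 0 1 (φ x) * jacobian φ 0 j x + Γ' d 1 1 (φ x) * jacobian φ 1 j x) * L 1 i k

/-- The Ricci tensor is natural. -/
theorem ChristoffelLaw.ricci (hφ : IsCoordChange φ V W) (hx : x ∈ V)
    {Γ Γ' : Fin 2 → Fin 2 → Fin 2 → Plane → ℝ} (h : ChristoffelLaw Γ Γ' φ V)
    (hΓ : ∀ k i j, DifferentiableAt ℝ (Γ k i j) x)
    (hΓ' : ∀ k i j, DifferentiableAt ℝ (Γ' k i j) (φ x)) :
    BilinLaw (fun c j => jacobian φ c j x) (ricci Γ x) (_root_.ricci Γ' (φ x)) := by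
  intro i j
  have hF := (hφ.det_pos x hx).ne'
  have C := fun d l => h.curvature hφ hx hΓ hΓ' d l i j
  have C00 := C 0 0
  have C01 := C 0 1
  have C10 := C 1 0
  have C11 := C 1 1
  apply mul_left_cancel₀ hF
  simp only [Fin.sum_univ_two] at C00 C01 C10 C11
  simp only [_root_.ricci, Matrix.of_apply, Fin.sum_univ_two]
  linear_combination jacobian φ 1 1 x * C00 - jacobian φ 0 1 x * C10 + jacobian φ 0 0 x * C11
    - jacobian φ 1 0 x * C01

/-- The Levi-Civita connection is natural. -/
theorem christoffelLaw_leviCivita (hφ : IsCoordChange φ V W)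
    {G G' : Plane → Matrix (Fin 2) (Fin 2) ℝ} (hG : IsMetricOn G V) (hG' : IsMetricOn G' W)
    (h : ∀ y ∈ V, BilinLaw (fun c j => jacobian φ c j y) (G y) (G' (φ y))) :
    ChristoffelLaw (leviCivita G) (leviCivita G') φ V := by
  intro x hx
  have hF := (hφ.det_pos x hx).ne'
  have hW := hφ.mapsTo x hx
  set F : Fin 2 → Fin 2 → ℝ := fun c j => jacobian φ c j x with hFdef
  set D : ℝ := jacobian φ 0 0 x * jacobian φ 1 1 x - jacobian φ 0 1 x * jacobian φ 1 0 x with hD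
  set rhs : Fin 2 → Fin 2 → Fin 2 → ℝ := fun c i j => pderiv i (jacobian φ c j) x
      + ∑ a, ∑ b, leviCivita G' c a b (φ x) * jacobian φ a i x * jacobian φ b j x with hrhs
  -- The connection `L` obtained by transforming that of `G'` is symmetric and metric for `G`.
  set L : Fin 2 → Fin 2 → Fin 2 → ℝ := fun k i j =>
    ![(F 1 1 * rhs 0 i j - F 0 1 * rhs 1 i j) / D, (F 0 0 * rhs 1 i j - F 1 0 * rhs 0 i j) / D] k
    with hLdef
  have hL : ∀ c i j, F c 0 * L 0 i j + F c 1 * L 1 i j = rhs c i j := by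
    intro c i j
    simp only [hLdef, Matrix.cons_val_zero, Matrix.cons_val_one]
    rcases fin_two_cases c with rfl | rfl <;> field_simp <;> simp only [hD, hFdef] <;> ring
  have hrs : ∀ c i j, rhs c i j = rhs c j i := by
    intro c i j
    simp only [hrhs, hφ.pderiv_jacobian_comm hx c i j, Fin.sum_univ_two]
    rw [hG'.leviCivita_comm hφ.isOpen_target hW c 1 0]
    ring
  have hLs : ∀ k i j, L k i j = L k j i := fun k i j => by
    simp only [hLdef, hrs _ i j]
  have hLG : ∀ k i j, pderiv k (fun y => G y i j) x
      = ∑ l, (L l k i * G x l j + L l k j * G x i l) := by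
    intro k i j
    have hJ : ∀ c j, DifferentiableAt ℝ (jacobian φ c j) x := fun c j =>
      (hφ.smooth_jacobian c j).differentiableAt_of_mem hφ.isOpen_source hx
    have hGd := fun i j => hG'.differentiableAt hφ.isOpen_target hW i j
    have hc : ∀ i j, DifferentiableAt ℝ (fun y => G' (φ y) i j) x := fun i j =>
      (hGd i j).comp x (hφ.differentiableAt hx)
    have hpc : ∀ m i j, pderiv m (fun y => G' (φ y) i j) x
        = ∑ a, pderiv a (fun z => G' z i j) (φ x) * jacobian φ a m x := fun m i j =>
      hφ.pderiv_comp hx (hGd i j) m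
    have d : pderiv k (fun y => G y i j) x
        = pderiv k (fun y => ∑ a, ∑ b, G' (φ y) a b * jacobian φ a i y * jacobian φ b j y) x :=
      pderiv_congr k hφ.isOpen_source hx fun y hy => h y hy i j
    simp only [Fin.sum_univ_two, hG'.pderiv_eq_leviCivita hφ.isOpen_target hW] at hpc d
    obtain ⟨H, hH⟩ : ∃ H : Fin 2 → Fin 2 → Plane → ℝ, ∀ i j y, G' (φ y) i j = H i j y :=
      ⟨_, fun _ _ _ => rfl⟩
    simp only [hH] at d hpc hc
    simp (disch := fun_prop) only [pderiv_add, pderiv_mul, hpc] at d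
    simp only [← hH] at d
    rw [d]
    have hGx := h x hx
    rw [Fin.sum_univ_two, hGx 0 j, hGx 1 j, hGx i 0, hGx i 1]
    have L1 := hL 0 k i
    have L2 := hL 1 k i
    have L3 := hL 0 k j
    have L4 := hL 1 k j
    simp only [hrhs, hFdef, Fin.sum_univ_two] at L1 L2 L3 L4 ⊢
    linear_combination
      -(G' (φ x) 0 0 * jacobian φ 0 j x + G' (φ x) 0 1 * jacobian φ 1 j x) * L1
      - (G' (φ x) 1 0 * jacobian φ 0 j x + G' (φ x) 1 1 * jacobian φ 1 j x) * L2
      - (G' (φ x) 0 0 * jacobian φ 0 i x + G' (φ x) 1 0 * jacobian φ 1 i x) * L3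
      - (G' (φ x) 0 1 * jacobian φ 0 i x + G' (φ x) 1 1 * jacobian φ 1 i x) * L4
  intro c i j
  rw [Fin.sum_univ_two, ← hG.eq_leviCivita hx hLs hLG, ← hG.eq_leviCivita hx hLs hLG]
  exact hL c i j

end Laws

/-! ### Coordinate frames on a surface -/

section Frames

variable {M : Type*} [TopologicalSpace M] [ChartedSpace Plane M] [IsManifold (𝓡 2) ∞ M]
  {e e' : OpenPartialHomeomorph M Plane} {p : M}

/-- The coordinate `1`-form `dx^k` of the chart `e`. -/
noncomputable def coordForm (e : OpenPartialHomeomorph M Plane) (k : Fin 2) (p : M) :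
    TangentSpace (𝓡 2) p →L[ℝ] ℝ :=
  (EuclideanSpace.proj k : Plane →L[ℝ] ℝ).comp (mfderiv (𝓡 2) (𝓡 2) e p)

theorem isInvertible_mfderiv_of_mem_atlas (he : e ∈ atlas Plane M) (hp : p ∈ e.source) :
    (mfderiv (𝓡 2) (𝓡 2) e p).IsInvertible :=
  ⟨(mdifferentiable_of_mem_atlas (I := 𝓡 2) he).mfderiv hp, rfl⟩

theorem coordForm_coordField (he : e ∈ atlas Plane M) (hp : p ∈ e.source) (k i : Fin 2) :
    coordForm e k p (coordField e i p) = (1 : Matrix (Fin 2) (Fin 2) ℝ) k i := by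
  have h := (isInvertible_mfderiv_of_mem_atlas he hp).self_apply_inverse
    (EuclideanSpace.single i 1 : Plane)
  have : coordForm e k p (coordField e i p) = (EuclideanSpace.single i (1 : ℝ) : Plane) k :=
    congrArg (fun v : Plane => v k) h
  rw [this]
  simp [Matrix.one_apply]

theorem eq_of_coordForm_eq (he : e ∈ atlas Plane M) (hp : p ∈ e.source)
    {v w : TangentSpace (𝓡 2) p} (h : ∀ k, coordForm e k p v = coordForm e k p w) : v = w := by
  refine (isInvertible_mfderiv_of_mem_atlas he hp).injective ?_
  exact PiLp.ext h

theorem sum_coordForm_smul_coordField (he : e ∈ atlas Plane M) (hp : p ∈ e.source)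
    (v : TangentSpace (𝓡 2) p) : ∑ k, coordForm e k p v • coordField e k p = v := by
  refine eq_of_coordForm_eq he hp fun k => ?_
  rw [Fin.sum_univ_two, map_add, map_smul, map_smul, coordForm_coordField he hp,
    coordForm_coordField he hp]
  rcases fin_two_cases k with rfl | rfl <;> simp

theorem map_eq_sum_coordForm {F : Type*} [AddCommGroup F] [Module ℝ F] [TopologicalSpace F]
    (he : e ∈ atlas Plane M) (hp : p ∈ e.source) (T : TangentSpace (𝓡 2) p →L[ℝ] F)
    (v : TangentSpace (𝓡 2) p) : T v = ∑ k, coordForm e k p v • T (coordField e k p) := by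
  conv_lhs => rw [← sum_coordForm_smul_coordField he hp v]
  simp

theorem mfderiv_eq_fderiv_transition (he : e ∈ atlas Plane M) (he' : e' ∈ atlas Plane M)
    (hp : p ∈ e.source) (hp' : p ∈ e'.source) (v : TangentSpace (𝓡 2) p) :
    mfderiv (𝓡 2) (𝓡 2) e' p v =
      fderiv ℝ (e.symm.trans e') (e p) (mfderiv (𝓡 2) (𝓡 2) e p v) := by
  have hφ : MDifferentiableAt (𝓡 2) (𝓡 2) (e.symm.trans e') (e p) :=
    ((mdifferentiable_of_mem_atlas (I := 𝓡 2) he).symm.trans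
      (mdifferentiable_of_mem_atlas (I := 𝓡 2) he')).mdifferentiableAt
        (by simp [hp, hp'])
  have hd : MDifferentiableAt (𝓡 2) (𝓡 2) e p := mdifferentiableAt_atlas he hp
  have hc : (e' : M → Plane) =ᶠ[nhds p] (e.symm.trans e') ∘ e := by
    filter_upwards [e.open_source.mem_nhds hp] with q hq
    simp [hq]
  rw [hc.mfderiv_eq, mfderiv_comp p hφ hd, mfderiv_eq_fderiv]
  rfl

theorem contDiffOn_transition (he : e ∈ atlas Plane M) (he' : e' ∈ atlas Plane M) :
    ContDiffOn ℝ ∞ (e.symm.trans e') (e.symm.trans e').source := by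
  have h := (contDiffGroupoid ∞ (𝓡 2)).compatible he he'
  rw [contDiffGroupoid, mem_groupoid_of_pregroupoid] at h
  simpa [contDiffPregroupoid] using h.1

theorem fderiv_transition_apply (he : e ∈ atlas Plane M) (he' : e' ∈ atlas Plane M) {y : Plane}
    (hy : y ∈ (e.symm.trans e').source) (c j : Fin 2) :
    (fderiv ℝ (e.symm.trans e') y (EuclideanSpace.single j 1)) c =
      jacobian (e.symm.trans e') c j y := by
  have hd : DifferentiableAt ℝ (e.symm.trans e') y :=
    ((contDiffOn_transition he he').contDiffAt
      ((e.symm.trans e').open_source.mem_nhds hy)).differentiableAt (by simp)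
  have : fderiv ℝ (fun y => e.symm.trans e' y c) y =
      (EuclideanSpace.proj c : Plane →L[ℝ] ℝ).comp (fderiv ℝ (e.symm.trans e') y) :=
    ((EuclideanSpace.proj c : Plane →L[ℝ] ℝ).hasFDerivAt.comp y hd.hasFDerivAt).fderiv
  simp only [jacobian, pderiv, this]
  rfl

theorem coordField_eq_sum_jacobian (he : e ∈ atlas Plane M) (he' : e' ∈ atlas Plane M)
    (hp : p ∈ e.source) (hp' : p ∈ e'.source) (i : Fin 2) :
    coordField e i p = ∑ c, jacobian (e.symm.trans e') c i (e p) • coordField e' c p := by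
  have h := (isInvertible_mfderiv_of_mem_atlas he hp).self_apply_inverse
    (EuclideanSpace.single i 1 : Plane)
  rw [← sum_coordForm_smul_coordField he' hp' (coordField e i p)]
  refine Finset.sum_congr rfl fun c _ => ?_
  rw [← fderiv_transition_apply he he' (by simp [hp, hp'])]
  congr 1
  refine (congrArg (fun v : Plane => v c)
    (mfderiv_eq_fderiv_transition he he' hp hp' (coordField e i p))).trans ?_
  rw [coordField, h]

theorem coordForm_eq_sum_jacobian (he : e ∈ atlas Plane M) (he' : e' ∈ atlas Plane M)
    (hp : p ∈ e.source) (hp' : p ∈ e'.source) (c : Fin 2) (v : TangentSpace (𝓡 2) p) :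
    coordForm e' c p v = ∑ k, jacobian (e.symm.trans e') c k (e p) * coordForm e k p v := by
  conv_lhs => rw [← sum_coordForm_smul_coordField he hp v]
  have h : ∀ k, coordForm e' c p (coordField e k p) =
      jacobian (e.symm.trans e') c k (e p) := by
    intro k
    rw [coordField_eq_sum_jacobian he he' hp hp', Fin.sum_univ_two, map_add, map_smul, map_smul,
      coordForm_coordField he' hp', coordForm_coordField he' hp']
    rcases fin_two_cases c with rfl | rfl <;> simp
  rw [Fin.sum_univ_two, Fin.sum_univ_two, map_add, map_smul, map_smul, h, h, smul_eq_mul,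
    smul_eq_mul]
  ring

theorem isCoordChange_transition [OrientedAtlas M] (he : e ∈ atlas Plane M)
    (he' : e' ∈ atlas Plane M) :
    IsCoordChange (e.symm.trans e') (e.symm.trans e').source e'.target where
  isOpen_source := (e.symm.trans e').open_source
  isOpen_target := e'.open_target
  mapsTo y hy := ((e.symm.trans e').map_source hy).1
  smooth := contDiffOn_euclidean.mp (contDiffOn_transition he he')
  det_pos y hy := by
    have h := OrientedAtlas.det_pos e he e' he' y hy
    have b := LinearMap.det_toMatrix (EuclideanSpace.basisFun (Fin 2) ℝ).toBasis
      (fderiv ℝ (e.symm.trans e') y : Plane →ₗ[ℝ] Plane)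
    rw [Matrix.det_fin_two] at b
    simp only [LinearMap.toMatrix_apply, OrthonormalBasis.coe_toBasis,
      OrthonormalBasis.coe_toBasis_repr_apply, EuclideanSpace.basisFun_apply,
      EuclideanSpace.basisFun_repr, ContinuousLinearMap.coe_coe,
      fderiv_transition_apply he he' hy] at b
    rw [b]
    exact h

/-- A vector field as a map into the tangent bundle. -/
abbrev fieldMap (σ : Π q : M, TangentSpace (𝓡 2) q) (q : M) :
    TotalSpace Plane (TangentSpace (𝓡 2) : M → Type _) := ⟨q, σ q⟩

theorem contMDiffOn_coordField (he : e ∈ atlas Plane M) (i : Fin 2) :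
    ContMDiffOn (𝓡 2) ((𝓡 2).prod 𝓘(ℝ, Plane)) ∞ (fieldMap (coordField e i)) e.source := by
  intro p hp
  have he' : e ∈ IsManifold.maximalAtlas (𝓡 2) ∞ M := IsManifold.subset_maximalAtlas he
  have h1 : ContMDiffAt (𝓡 2) (𝓡 2) ∞ e p := contMDiffAt_of_mem_maximalAtlas he' hp
  have h2 : ContMDiffAt (𝓡 2) (𝓡 2).tangent ∞
      (fun y : Plane => (⟨y, (EuclideanSpace.single i 1 : Plane)⟩ : TangentBundle (𝓡 2) Plane))
      (e p) :=
    contMDiffAt_vectorSpace_iff_contDiffAt.mpr contDiffAt_const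
  exact (ContMDiffAt.mpullback_vectorField_preimage h2 h1
    (isInvertible_mfderiv_of_mem_atlas he hp) (by simp)).contMDiffWithinAt

theorem contMDiffOn_tangentMap_chart (he : e ∈ atlas Plane M) (k : Fin 2) :
    ContMDiffOn (𝓡 2).tangent 𝓘(ℝ, ℝ) ∞
      (fun v : TangentBundle (𝓡 2) M => coordForm e k v.1 v.2)
      (TotalSpace.proj ⁻¹' e.source) := by
  have he' : e ∈ IsManifold.maximalAtlas (𝓡 2) ∞ M := IsManifold.subset_maximalAtlas he
  have h := (contMDiffOn_of_mem_maximalAtlas he').contMDiffOn_tangentMapWithin (m := ∞) (by simp)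
    e.open_source.uniqueMDiffOn
  have h3 : ContMDiffOn (𝓡 2).tangent 𝓘(ℝ, ℝ) ∞
      (fun v : TangentBundle (𝓡 2) M =>
        (EuclideanSpace.proj k : Plane →L[ℝ] ℝ) (tangentMapWithin (𝓡 2) (𝓡 2) e e.source v).2)
      (TotalSpace.proj ⁻¹' e.source) :=
    (EuclideanSpace.proj k : Plane →L[ℝ] ℝ).contMDiff.comp_contMDiffOn
      ((contMDiff_snd_tangentBundle_modelSpace Plane (𝓡 2)).comp_contMDiffOn h)
  refine h3.congr fun v hv => ?_
  simp only [tangentMapWithin, mfderivWithin_of_isOpen e.open_source hv]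
  rfl

theorem contMDiffOn_coordForm (he : e ∈ atlas Plane M) (k : Fin 2)
    {σ : Π p : M, TangentSpace (𝓡 2) p} {s : Set M} (hs : s ⊆ e.source)
    (hσ : ContMDiffOn (𝓡 2) ((𝓡 2).prod 𝓘(ℝ, Plane)) ∞ (fieldMap σ) s) :
    ContMDiffOn (𝓡 2) 𝓘(ℝ, ℝ) ∞ (fun p => coordForm e k p (σ p)) s :=
  (contMDiffOn_tangentMap_chart he k).comp hσ fun _ hq => hs hq

theorem mdifferentiableAt_coordForm (he : e ∈ atlas Plane M) (hp : p ∈ e.source) (k : Fin 2)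
    {σ : Π p : M, TangentSpace (𝓡 2) p}
    (hσ : MDifferentiableAt (𝓡 2) ((𝓡 2).prod 𝓘(ℝ, Plane)) (fieldMap σ) p) :
    MDifferentiableAt (𝓡 2) 𝓘(ℝ, ℝ) (fun p => coordForm e k p (σ p)) p := by
  have h : ContMDiffAt (𝓡 2).tangent 𝓘(ℝ, ℝ) ∞
      (fun v : TangentBundle (𝓡 2) M => coordForm e k v.1 v.2) (fieldMap σ p) :=
    (contMDiffOn_tangentMap_chart he k).contMDiffAt
      ((e.open_source.preimage (FiberBundle.continuous_proj Plane _)).mem_nhds hp)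
  exact (h.mdifferentiableAt (by simp)).comp p hσ

end Frames

section HomSections

variable {M : Type*} [TopologicalSpace M] [ChartedSpace Plane M] [IsManifold (𝓡 2) ∞ M]
  {e e' : OpenPartialHomeomorph M Plane} {p : M}

theorem ContinuousLinearMap.eq_sum_smulRight_proj {F : Type*} [NormedAddCommGroup F]
    [NormedSpace ℝ F] (A : Plane →L[ℝ] F) :
    A = ∑ j, (EuclideanSpace.proj j : Plane →L[ℝ] ℝ).smulRight (A (EuclideanSpace.single j 1)) := by
  ext v
  have h3 : v = ∑ a, v a • EuclideanSpace.single a (1 : ℝ) := by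
    ext j
    rcases fin_two_cases j with rfl | rfl <;> simp
  conv_lhs => rw [h3]
  simp

theorem contMDiffAt_coordForm (he : e ∈ atlas Plane M) (hp : p ∈ e.source) (k : Fin 2)
    {σ : Π p : M, TangentSpace (𝓡 2) p}
    (hσ : ContMDiffAt (𝓡 2) ((𝓡 2).prod 𝓘(ℝ, Plane)) ∞ (fieldMap σ) p) :
    ContMDiffAt (𝓡 2) 𝓘(ℝ, ℝ) ∞ (fun p => coordForm e k p (σ p)) p := by
  have h : ContMDiffAt (𝓡 2).tangent 𝓘(ℝ, ℝ) ∞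
      (fun v : TangentBundle (𝓡 2) M => coordForm e k v.1 v.2) (fieldMap σ p) :=
    (contMDiffOn_tangentMap_chart he k).contMDiffAt
      ((e.open_source.preimage (FiberBundle.continuous_proj Plane _)).mem_nhds hp)
  exact h.comp p hσ

/-- A family of linear maps on the tangent spaces with values in a vector bundle is smooth if its
values on the coordinate fields are. -/
theorem contMDiffOn_hom_of_coordField {F : Type*} [NormedAddCommGroup F] [NormedSpace ℝ F]
    {V : M → Type*} [∀ q, AddCommGroup (V q)] [∀ q, Module ℝ (V q)]
    [TopologicalSpace (TotalSpace F V)] [∀ q, TopologicalSpace (V q)]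
    [∀ q, IsTopologicalAddGroup (V q)] [∀ q, ContinuousSMul ℝ (V q)]
    [FiberBundle F V] [VectorBundle ℝ F V] [ContMDiffVectorBundle ∞ F V (𝓡 2)]
    (he : e ∈ atlas Plane M)
    {T : Π q : M, TangentSpace (𝓡 2) q →L[ℝ] V q}
    (h : ∀ i, ContMDiffOn (𝓡 2) ((𝓡 2).prod 𝓘(ℝ, F)) ∞
      (fun q => (⟨q, T q (coordField e i q)⟩ : TotalSpace F V)) e.source) :
    ContMDiffOn (𝓡 2) ((𝓡 2).prod 𝓘(ℝ, Plane →L[ℝ] F)) ∞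
      (fun q => (⟨q, T q⟩ : TotalSpace (Plane →L[ℝ] F) fun q => TangentSpace (𝓡 2) q →L[ℝ] V q))
      e.source := by
  intro p hp
  have hop := e.open_source.mem_nhds hp
  refine ContMDiffAt.contMDiffWithinAt ?_
  rw [contMDiffAt_hom_bundle]
  refine ⟨contMDiffAt_id, ?_⟩
  set t := trivializationAt Plane (TangentSpace (𝓡 2) : M → Type _) p with ht
  set t' := trivializationAt F V p with ht'
  have hpt : p ∈ t.baseSet := FiberBundle.mem_baseSet_trivializationAt' p
  have hpt' : p ∈ t'.baseSet := FiberBundle.mem_baseSet_trivializationAt' p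
  -- Constant sections in the trivialization are smooth, hence so are their images under `T`.
  have hs : ∀ v : Plane, ContMDiffAt (𝓡 2) ((𝓡 2).prod 𝓘(ℝ, Plane)) ∞
      (fieldMap fun q => t.symm q v) p := by
    intro v
    rw [contMDiffAt_section]
    refine (contMDiffAt_const (c := v)).congr_of_eventuallyEq ?_
    filter_upwards [t.open_baseSet.mem_nhds hpt] with q hq
    rw [← ht, t.apply_mk_symm hq]
  have hT : ∀ v : Plane, ContMDiffAt (𝓡 2) ((𝓡 2).prod 𝓘(ℝ, F)) ∞
      (fun q => (⟨q, T q (t.symm q v)⟩ : TotalSpace F V)) p := by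
    intro v
    refine (ContMDiffAt.sum_section (s := Finset.univ)
      (t := fun k q => coordForm e k q (t.symm q v) • T q (coordField e k q)) fun k _ =>
        ContMDiffAt.smul_section (contMDiffAt_coordForm he hp k (hs v))
          ((h k).contMDiffAt hop)).congr_of_eventuallyEq ?_
    filter_upwards [hop] with q hq
    rw [map_eq_sum_coordForm he hq (T q)]
  have key : ∀ v : Plane, ContMDiffAt (𝓡 2) 𝓘(ℝ, F) ∞
      (fun q => ContinuousLinearMap.inCoordinates Plane (TangentSpace (𝓡 2)) F V p q p q (T q) v)
      p := by
    intro v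
    refine (contMDiffAt_totalSpace.mp (hT v)).2.congr_of_eventuallyEq ?_
    filter_upwards [t.open_baseSet.mem_nhds hpt, t'.open_baseSet.mem_nhds hpt'] with q hq hq'
    rw [ContinuousLinearMap.inCoordinates_eq hq hq']
    simp [← ht, ← ht']
  refine ContMDiffAt.congr_of_eventuallyEq ?_
    (Filter.Eventually.of_forall fun q => ContinuousLinearMap.eq_sum_smulRight_proj _)
  refine ContMDiffAt.sum fun j _ => ?_
  exact (((ContinuousLinearMap.smulRightL ℝ Plane F)
    (EuclideanSpace.proj j : Plane →L[ℝ] ℝ)).contMDiff).contMDiffAt.comp p (key _)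

end HomSections

/-! ### Tensor fields and their components -/

section Components

variable {M : Type*} [TopologicalSpace M] [ChartedSpace Plane M] [IsManifold (𝓡 2) ∞ M]
  {e e' : OpenPartialHomeomorph M Plane} {p : M}

theorem contDiffOn_comp_symm (he : e ∈ atlas Plane M) {f : M → ℝ}
    (hf : ContMDiffOn (𝓡 2) 𝓘(ℝ, ℝ) ∞ f e.source) :
    ContDiffOn ℝ ∞ (fun x => f (e.symm x)) e.target := by
  have he' : e ∈ IsManifold.maximalAtlas (𝓡 2) ∞ M := IsManifold.subset_maximalAtlas he
  exact contMDiffOn_iff_contDiffOn.mp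
    (hf.comp (contMDiffOn_symm_of_mem_maximalAtlas he') fun x hx => e.map_target hx)

theorem contMDiffOn_comp_chart (he : e ∈ atlas Plane M) {f : Plane → ℝ}
    (hf : ContDiffOn ℝ ∞ f e.target) :
    ContMDiffOn (𝓡 2) 𝓘(ℝ, ℝ) ∞ (fun q => f (e q)) e.source := by
  have he' : e ∈ IsManifold.maximalAtlas (𝓡 2) ∞ M := IsManifold.subset_maximalAtlas he
  exact (contMDiffOn_iff_contDiffOn.mpr hf).comp (contMDiffOn_of_mem_maximalAtlas he')
    fun x hx => e.map_source hx

omit [IsManifold (𝓡 2) ∞ M] in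
theorem contMDiffOn_trivial_iff {f : M → ℝ} {s : Set M} :
    ContMDiffOn (𝓡 2) ((𝓡 2).prod 𝓘(ℝ, ℝ)) ∞
      (fun q => (⟨q, f q⟩ : TotalSpace ℝ (Bundle.Trivial M ℝ))) s ↔
    ContMDiffOn (𝓡 2) 𝓘(ℝ, ℝ) ∞ f s :=
  ⟨fun h q hq => (contMDiffWithinAt_totalSpace.mp (h q hq)).2,
    fun h q hq => contMDiffWithinAt_totalSpace.mpr ⟨contMDiffWithinAt_id, h q hq⟩⟩

theorem isMetricOn_metricComp
    (g : ContMDiffRiemannianMetric (𝓡 2) ∞ Plane (TangentSpace (𝓡 2) : M → Type _))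
    (he : e ∈ atlas Plane M) : IsMetricOn (metricComp g e) e.target where
  smooth i j := by
    have h : ContMDiffOn (𝓡 2) ((𝓡 2).prod 𝓘(ℝ, ℝ)) ∞
        (fun q => (⟨q, g.inner q (coordField e i q) (coordField e j q)⟩ :
          TotalSpace ℝ (Bundle.Trivial M ℝ))) e.source :=
      ContMDiffOn.clm_bundle_apply₂ (F₁ := Plane) (F₂ := Plane) g.contMDiff.contMDiffOn
        (contMDiffOn_coordField he i) (contMDiffOn_coordField he j)
    exact contDiffOn_comp_symm he (contMDiffOn_trivial_iff.mp h)
  posDef x hx := by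
    have hp := e.map_target hx
    refine Matrix.PosDef.of_dotProduct_mulVec_pos ?_ ?_
    · ext i j
      simp [metricComp, g.symm _ (coordField e i _)]
    · intro v hv
      have h0 : ∑ k, v k • coordField e k (e.symm x) ≠ 0 := by
        intro h0
        apply hv
        ext k
        have h1 := congrArg (coordForm e k (e.symm x)) h0
        rw [Fin.sum_univ_two, map_add, map_smul, map_smul, coordForm_coordField he hp,
          coordForm_coordField he hp, map_zero] at h1
        rcases fin_two_cases k with rfl | rfl <;> simpa using h1
      have h2 := g.pos _ _ h0
      simp only [Fin.sum_univ_two, map_add, map_smul, _root_.add_apply,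
        _root_.smul_apply, smul_eq_mul] at h2
      simp only [metricComp, dotProduct, Matrix.mulVec, Matrix.of_apply, Fin.sum_univ_two,
        star_trivial]
      linarith

theorem contDiffOn_oneForm
    (β : ContMDiffSection (𝓡 2) (Plane →L[ℝ] ℝ) ∞ fun p : M => TangentSpace (𝓡 2) p →L[ℝ] ℝ)
    (he : e ∈ atlas Plane M) (i : Fin 2) :
    ContDiffOn ℝ ∞ (fun x => β (e.symm x) (coordField e i (e.symm x))) e.target := by
  have h : ContMDiffOn (𝓡 2) ((𝓡 2).prod 𝓘(ℝ, ℝ)) ∞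
      (fun q => (⟨q, β q (coordField e i q)⟩ : TotalSpace ℝ (Bundle.Trivial M ℝ))) e.source :=
    ContMDiffOn.clm_bundle_apply (F₁ := Plane) β.contMDiff.contMDiffOn
      (contMDiffOn_coordField he i)
  exact contDiffOn_comp_symm he (contMDiffOn_trivial_iff.mp h)

/-- The linear map on the tangent space with prescribed values on the coordinate frame. -/
noncomputable def frameLift {F : Type*} [AddCommGroup F] [Module ℝ F] [TopologicalSpace F]
    [IsTopologicalAddGroup F] [ContinuousSMul ℝ F] (e : OpenPartialHomeomorph M Plane) (p : M)
    (f : Fin 2 → F) : TangentSpace (𝓡 2) p →L[ℝ] F :=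
  ∑ k, (coordForm e k p).smulRight (f k)

omit [IsManifold (𝓡 2) ∞ M] in
theorem frameLift_apply {F : Type*} [AddCommGroup F] [Module ℝ F] [TopologicalSpace F]
    [IsTopologicalAddGroup F] [ContinuousSMul ℝ F] (f : Fin 2 → F) (v : TangentSpace (𝓡 2) p) :
    frameLift e p f v = ∑ k, coordForm e k p v • f k := by
  simp [frameLift]

theorem coordForm_coordField_eq_jacobian (he : e ∈ atlas Plane M) (he' : e' ∈ atlas Plane M)
    (hp : p ∈ e.source) (hp' : p ∈ e'.source) (c i : Fin 2) :
    coordForm e' c p (coordField e i p) = jacobian (e.symm.trans e') c i (e p) := by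
  rw [coordForm_eq_sum_jacobian he he' hp hp', Fin.sum_univ_two, coordForm_coordField he hp,
    coordForm_coordField he hp]
  rcases fin_two_cases i with rfl | rfl <;> simp

end Components

section Gluing

variable {M : Type*} [TopologicalSpace M] [ChartedSpace Plane M] [IsManifold (𝓡 2) ∞ M]
  {e e' : OpenPartialHomeomorph M Plane} {p : M}

theorem frameLift_frameLift_coordField {G G' : Fin 2 → Fin 2 → ℝ} (he : e ∈ atlas Plane M)
    (he' : e' ∈ atlas Plane M) (hp : p ∈ e.source) (hp' : p ∈ e'.source)
    (h : BilinLaw (fun c j => jacobian (e.symm.trans e') c j (e p)) G G') (i j : Fin 2) :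
    frameLift e' p (fun a => frameLift e' p fun b => G' a b) (coordField e i p) (coordField e j p)
      = G i j := by
  rw [h i j]
  simp only [frameLift_apply, Fin.sum_univ_two, _root_.add_apply, _root_.smul_apply,
    coordForm_coordField_eq_jacobian he he' hp hp', smul_eq_mul]
  ring

omit [IsManifold (𝓡 2) ∞ M] in
theorem frameLift_frameLift_apply (G : Fin 2 → Fin 2 → ℝ) (v w : TangentSpace (𝓡 2) p) :
    frameLift e p (fun a => frameLift e p fun b => G a b) v w =
      ∑ a, ∑ b, G a b * coordForm e a p v * coordForm e b p w := by
  simp only [frameLift_apply, Fin.sum_univ_two, _root_.add_apply, _root_.smul_apply, smul_eq_mul]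
  ring

theorem isVonNBounded_of_posDef (he : e ∈ atlas Plane M) (hp : p ∈ e.source)
    {g : Matrix (Fin 2) (Fin 2) ℝ} (hg : g.PosDef) :
    Bornology.IsVonNBounded ℝ {v : TangentSpace (𝓡 2) p |
      ∑ a, ∑ b, g a b * coordForm e a p v * coordForm e b p v < 1} := by
  set A : TangentSpace (𝓡 2) p ≃L[ℝ] Plane :=
    (mdifferentiable_of_mem_atlas (I := 𝓡 2) he).mfderiv hp
  have hdet := hg.det_pos
  have hg0 : 0 < g 0 0 := hg.diag_pos
  have hg1 : 0 < g 1 1 := hg.diag_pos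
  have hc := hg.apply_comm 1 0
  rw [Matrix.det_fin_two, hc] at hdet
  have hb := ((NormedSpace.isVonNBounded_closedBall ℝ Plane
    (Real.sqrt ((g 0 0 + g 1 1) / (g 0 0 * g 1 1 - g 0 1 * g 0 1)))).image
      (A.symm : Plane →L[ℝ] TangentSpace (𝓡 2) p))
  refine Bornology.IsVonNBounded.subset
    (fun v hv => (Set.mem_image _ _ _).mpr ⟨A v, ?_, A.symm_apply_apply v⟩) hb
  simp only [Fin.sum_univ_two, Set.mem_ofPred_eq, hc] at hv
  rw [mem_closedBall_zero_iff, EuclideanSpace.norm_eq]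
  apply Real.sqrt_le_sqrt
  change ∑ i, ‖coordForm e i p v‖ ^ 2 ≤ _
  simp only [Fin.sum_univ_two, Real.norm_eq_abs, sq_abs]
  generalize coordForm e 0 p v = x at *
  generalize coordForm e 1 p v = y at *
  rw [le_div_iff₀ hdet]
  -- Complete the square in either variable.
  have k0 : x ^ 2 * (g 0 0 * g 1 1 - g 0 1 * g 0 1) ≤ g 1 1 := by
    nlinarith [sq_nonneg (g 0 1 * x + g 1 1 * y)]
  have k1 : y ^ 2 * (g 0 0 * g 1 1 - g 0 1 * g 0 1) ≤ g 0 0 := by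
    nlinarith [sq_nonneg (g 0 0 * x + g 0 1 * y)]
  linarith

/-- Compatible families of coordinate expressions define a Riemannian metric. -/
theorem exists_metric {G : OpenPartialHomeomorph M Plane → Plane → Matrix (Fin 2) (Fin 2) ℝ}
    (hG : ∀ e ∈ atlas Plane M, IsMetricOn (G e) e.target)
    (law : ∀ e ∈ atlas Plane M, ∀ e' ∈ atlas Plane M, ∀ y ∈ (e.symm.trans e').source,
      BilinLaw (fun c j => jacobian (e.symm.trans e') c j y) (G e y)
        (G e' (e.symm.trans e' y))) :
    ∃ g : ContMDiffRiemannianMetric (𝓡 2) ∞ Plane (TangentSpace (𝓡 2) : M → Type _),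
      ∀ e ∈ atlas Plane M, ∀ x ∈ e.target, metricComp g e x = G e x := by
  have hc : ∀ p : M, chartAt Plane p ∈ atlas Plane M := chart_mem_atlas Plane
  have hs : ∀ p : M, p ∈ (chartAt Plane p).source := mem_chart_source Plane
  set b : Π p : M, TangentSpace (𝓡 2) p →L[ℝ] TangentSpace (𝓡 2) p →L[ℝ] ℝ := fun p =>
    frameLift (chartAt Plane p) p fun i => frameLift (chartAt Plane p) p fun j =>
      G (chartAt Plane p) (chartAt Plane p p) i j with hb
  have key : ∀ e ∈ atlas Plane M, ∀ p ∈ e.source, ∀ i j,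
      b p (coordField e i p) (coordField e j p) = G e (e p) i j := by
    intro e he p hp i j
    have h := law e he _ (hc p) (e p) (by simp [hp])
    simp only [OpenPartialHomeomorph.coe_trans, Function.comp_apply, e.left_inv hp] at h
    exact frameLift_frameLift_coordField he (hc p) hp (hs p) h i j
  have hpd := fun p => (hG _ (hc p)).posDef _ ((chartAt Plane p).map_source (hs p))
  have happ : ∀ p (v w : TangentSpace (𝓡 2) p), b p v w = ∑ i, ∑ j,
      G (chartAt Plane p) (chartAt Plane p p) i j * coordForm (chartAt Plane p) i p v
        * coordForm (chartAt Plane p) j p w := fun p v w => frameLift_frameLift_apply _ v w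
  refine ⟨⟨b, fun p v w => ?_, fun p v hv => ?_, fun p => ?_, fun p => ?_⟩, fun e he x hx => ?_⟩
  · rw [happ, happ]
    simp only [Fin.sum_univ_two, (hpd p).apply_comm 1 0]
    ring
  · have hv' : (fun k => coordForm (chartAt Plane p) k p v) ≠ 0 := by
      intro h0
      refine hv (eq_of_coordForm_eq (hc p) (hs p) fun k => ?_)
      rw [map_zero]
      exact congrFun h0 k
    have h := (hpd p).dotProduct_mulVec_pos hv'
    rw [happ]
    simp only [dotProduct, Matrix.mulVec, Fin.sum_univ_two, star_trivial] at h ⊢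
    linarith
  · simp only [happ]
    exact isVonNBounded_of_posDef (hc p) (hs p) (hpd p)
  · have h : ContMDiffOn (𝓡 2) ((𝓡 2).prod 𝓘(ℝ, Plane →L[ℝ] Plane →L[ℝ] ℝ)) ∞
        (fun q => (⟨q, b q⟩ : TotalSpace (Plane →L[ℝ] Plane →L[ℝ] ℝ) fun q : M =>
          TangentSpace (𝓡 2) q →L[ℝ] TangentSpace (𝓡 2) q →L[ℝ] Bundle.Trivial M ℝ q))
        (chartAt Plane p).source := by
      refine contMDiffOn_hom_of_coordField (hc p) fun i => ?_
      refine contMDiffOn_hom_of_coordField (hc p) fun j => ?_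
      refine contMDiffOn_trivial_iff.mpr ?_
      exact (contMDiffOn_comp_chart (hc p) ((hG _ (hc p)).smooth i j)).congr
        fun q hq => key _ (hc p) q hq i j
    exact h.contMDiffAt ((chartAt Plane p).open_source.mem_nhds (hs p))
  · ext i j
    rw [metricComp, Matrix.of_apply, key e he _ (e.map_target hx), e.right_inv hx]

/-- Compatible families of coordinate expressions define a `1`-form. -/
theorem exists_oneForm {B : OpenPartialHomeomorph M Plane → Fin 2 → Plane → ℝ}
    (hB : ∀ e ∈ atlas Plane M, ∀ i, ContDiffOn ℝ ∞ (B e i) e.target)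
    (law : ∀ e ∈ atlas Plane M, ∀ e' ∈ atlas Plane M, ∀ y ∈ (e.symm.trans e').source,
      LinLaw (fun c j => jacobian (e.symm.trans e') c j y) (fun i => B e i y)
        (fun i => B e' i (e.symm.trans e' y))) :
    ∃ β : ContMDiffSection (𝓡 2) (Plane →L[ℝ] ℝ) ∞ fun p : M => TangentSpace (𝓡 2) p →L[ℝ] ℝ,
      ∀ e ∈ atlas Plane M, ∀ x ∈ e.target, ∀ i,
        β (e.symm x) (coordField e i (e.symm x)) = B e i x := by
  have hc : ∀ p : M, chartAt Plane p ∈ atlas Plane M := chart_mem_atlas Plane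
  have hs : ∀ p : M, p ∈ (chartAt Plane p).source := mem_chart_source Plane
  set b : Π p : M, TangentSpace (𝓡 2) p →L[ℝ] ℝ := fun p =>
    frameLift (chartAt Plane p) p fun i => B (chartAt Plane p) i (chartAt Plane p p) with hb
  have key : ∀ e ∈ atlas Plane M, ∀ p ∈ e.source, ∀ i,
      b p (coordField e i p) = B e i (e p) := by
    intro e he p hp i
    have h := law e he _ (hc p) (e p) (by simp [hp]) i
    simp only [OpenPartialHomeomorph.coe_trans, Function.comp_apply, e.left_inv hp] at h
    rw [h]
    simp only [hb, frameLift_apply, Fin.sum_univ_two, smul_eq_mul,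
      coordForm_coordField_eq_jacobian he (hc p) hp (hs p), OpenPartialHomeomorph.coe_trans]
    ring
  refine ⟨⟨b, fun p => ?_⟩, fun e he x hx i => ?_⟩
  · have h : ContMDiffOn (𝓡 2) ((𝓡 2).prod 𝓘(ℝ, Plane →L[ℝ] ℝ)) ∞
        (fun q => (⟨q, b q⟩ : TotalSpace (Plane →L[ℝ] ℝ) fun q : M =>
          TangentSpace (𝓡 2) q →L[ℝ] Bundle.Trivial M ℝ q)) (chartAt Plane p).source := by
      refine contMDiffOn_hom_of_coordField (hc p) fun i => ?_
      refine contMDiffOn_trivial_iff.mpr ?_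
      exact (contMDiffOn_comp_chart (hc p) (hB _ (hc p) i)).congr
        fun q hq => key _ (hc p) q hq i
    exact h.contMDiffAt ((chartAt Plane p).open_source.mem_nhds (hs p))
  · exact (key e he _ (e.map_target hx) i).trans (by rw [e.right_inv hx])

set_option synthInstance.maxHeartbeats 200000 in
/-- Compatible families of coordinate expressions define a complex-valued trilinear form. -/
theorem exists_trilinear {C : OpenPartialHomeomorph M Plane → Fin 2 → Fin 2 → Fin 2 → Plane → ℂ}
    (law : ∀ e ∈ atlas Plane M, ∀ e' ∈ atlas Plane M, ∀ y ∈ (e.symm.trans e').source,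
      ∀ i j k, C e i j k y = ∑ a, ∑ b, ∑ c, C e' a b c (e.symm.trans e' y)
        * ((jacobian (e.symm.trans e') a i y * jacobian (e.symm.trans e') b j y
          * jacobian (e.symm.trans e') c k y : ℝ) : ℂ)) :
    ∃ T : ∀ p : M, TangentSpace (𝓡 2) p →L[ℝ] TangentSpace (𝓡 2) p →L[ℝ]
        TangentSpace (𝓡 2) p →L[ℝ] ℂ,
      ∀ e ∈ atlas Plane M, ∀ x ∈ e.target, ∀ i j k,
        T (e.symm x) (coordField e i (e.symm x)) (coordField e j (e.symm x))
          (coordField e k (e.symm x)) = C e i j k x := by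
  have hc : ∀ p : M, chartAt Plane p ∈ atlas Plane M := chart_mem_atlas Plane
  have hs : ∀ p : M, p ∈ (chartAt Plane p).source := mem_chart_source Plane
  refine ⟨fun p => frameLift (chartAt Plane p) p fun i => frameLift (chartAt Plane p) p fun j =>
    frameLift (chartAt Plane p) p fun k => C (chartAt Plane p) i j k (chartAt Plane p p),
    fun e he x hx i j k => ?_⟩
  have hp := e.map_target hx
  have h := law e he _ (hc (e.symm x)) x (by simp [hx]) i j k
  simp only [OpenPartialHomeomorph.coe_trans, Function.comp_apply] at h
  rw [h]
  simp only [frameLift_apply, Fin.sum_univ_two, _root_.add_apply, _root_.smul_apply,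
    coordForm_coordField_eq_jacobian he (hc _) hp (hs _), Complex.real_smul,
    OpenPartialHomeomorph.coe_trans, e.right_inv hx, Complex.ofReal_mul]
  ring

end Gluing

/-! ### Connections and their Christoffel symbols -/

/-- The components `∇_i s^k = ∂_i s^k + Γ^k_{ij} s^j` of the covariant derivative of the vector
field with components `s^k`. -/
noncomputable def covDerivField (Γ : Fin 2 → Fin 2 → Fin 2 → Plane → ℝ) (s : Fin 2 → Plane → ℝ)
    (k i : Fin 2) (x : Plane) : ℝ :=
  pderiv i (s k) x + ∑ j, Γ k i j x * s j x

/-- The covariant derivative of a vector field is natural. -/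
theorem ChristoffelLaw.covDerivField {φ : Plane → Plane} {V W : Set Plane} {x : Plane}
    (hφ : IsCoordChange φ V W) (hx : x ∈ V) {Γ Γ' : Fin 2 → Fin 2 → Fin 2 → Plane → ℝ}
    (h : ChristoffelLaw Γ Γ' φ V) {s s' : Fin 2 → Plane → ℝ}
    (hs : ∀ k, DifferentiableAt ℝ (s k) x) (hs' : ∀ k, DifferentiableAt ℝ (s' k) (φ x))
    (hss' : ∀ y ∈ V, ∀ c, s' c (φ y) = ∑ k, jacobian φ c k y * s k y) (c i : Fin 2) :
    ∑ k, jacobian φ c k x * covDerivField Γ s k i x =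
      ∑ a, _root_.covDerivField Γ' s' c a (φ x) * jacobian φ a i x := by
  have hJ : ∀ c j, DifferentiableAt ℝ (jacobian φ c j) x := fun c j =>
    (hφ.smooth_jacobian c j).differentiableAt_of_mem hφ.isOpen_source hx
  have d1 := hφ.pderiv_comp hx (hs' c) i
  have d2 : pderiv i (fun y => s' c (φ y)) x
      = pderiv i (fun y => ∑ k, jacobian φ c k y * s k y) x :=
    pderiv_congr i hφ.isOpen_source hx fun y hy => hss' y hy c
  simp only [Fin.sum_univ_two] at d1 d2
  simp (disch := fun_prop) only [pderiv_add, pderiv_mul] at d2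
  have L0 := h x hx c i 0
  have L1 := h x hx c i 1
  have v0 := hss' x hx 0
  have v1 := hss' x hx 1
  simp only [_root_.covDerivField, Fin.sum_univ_two, hφ.pderiv_jacobian_comm hx c i]
    at L0 L1 v0 v1 d2 ⊢
  rw [v0, v1]
  linear_combination s 0 x * L0 + s 1 x * L1 + d1 - d2

section Connections

variable {M : Type*} [TopologicalSpace M] [ChartedSpace Plane M] [IsManifold (𝓡 2) ∞ M]
  {e e' : OpenPartialHomeomorph M Plane} {p : M}

/-- The components of a vector field in the chart `e`. -/
noncomputable def fieldComp (e : OpenPartialHomeomorph M Plane)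
    (σ : Π q : M, TangentSpace (𝓡 2) q) (k : Fin 2) (x : Plane) : ℝ :=
  coordForm e k (e.symm x) (σ (e.symm x))

omit [IsManifold (𝓡 2) ∞ M] in
theorem fieldComp_apply_chart (hp : p ∈ e.source) (σ : Π q : M, TangentSpace (𝓡 2) q)
    (k : Fin 2) : fieldComp e σ k (e p) = coordForm e k p (σ p) := by
  rw [fieldComp, e.left_inv hp]

theorem differentiableAt_comp_symm (he : e ∈ atlas Plane M) (hp : p ∈ e.source) {f : M → ℝ}
    (hf : MDifferentiableAt (𝓡 2) 𝓘(ℝ, ℝ) f p) :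
    DifferentiableAt ℝ (fun x => f (e.symm x)) (e p) := by
  have h : MDifferentiableAt (𝓡 2) (𝓡 2) e.symm (e p) :=
    mdifferentiableAt_atlas_symm he (e.map_source hp)
  rw [← e.left_inv hp] at hf
  exact mdifferentiableAt_iff_differentiableAt.mp (hf.comp (e p) h)

theorem differentiableAt_fieldComp (he : e ∈ atlas Plane M) (hp : p ∈ e.source)
    {σ : Π q : M, TangentSpace (𝓡 2) q}
    (hσ : MDifferentiableAt (𝓡 2) ((𝓡 2).prod 𝓘(ℝ, Plane)) (fieldMap σ) p) (k : Fin 2) :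
    DifferentiableAt ℝ (fieldComp e σ k) (e p) :=
  differentiableAt_comp_symm he hp (mdifferentiableAt_coordForm he hp k hσ)

theorem mfderiv_coordField (he : e ∈ atlas Plane M) (hp : p ∈ e.source) {f : M → ℝ}
    (hf : MDifferentiableAt (𝓡 2) 𝓘(ℝ, ℝ) f p) (i : Fin 2) :
    mfderiv (𝓡 2) 𝓘(ℝ, ℝ) f p (coordField e i p) = pderiv i (fun x => f (e.symm x)) (e p) := by
  have hd := differentiableAt_comp_symm he hp hf
  have hc : f =ᶠ[nhds p] (fun x => f (e.symm x)) ∘ e := by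
    filter_upwards [e.open_source.mem_nhds hp] with q hq
    simp [hq]
  have h := (isInvertible_mfderiv_of_mem_atlas he hp).self_apply_inverse
    (EuclideanSpace.single i 1 : Plane)
  rw [hc.mfderiv_eq, mfderiv_comp p (mdifferentiableAt_iff_differentiableAt.mpr hd)
    (mdifferentiableAt_atlas he hp), mfderiv_eq_fderiv]
  exact congrArg (fderiv ℝ (fun x => f (e.symm x)) (e p)) h

theorem mdifferentiableAt_coordField (he : e ∈ atlas Plane M) (hp : p ∈ e.source) (i : Fin 2) :
    MDifferentiableAt (𝓡 2) ((𝓡 2).prod 𝓘(ℝ, Plane)) (fieldMap (coordField e i)) p :=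
  ((contMDiffOn_coordField he i).contMDiffAt (e.open_source.mem_nhds hp)).mdifferentiableAt
    (by simp)

theorem fieldComp_transition (he : e ∈ atlas Plane M) (he' : e' ∈ atlas Plane M)
    (σ : Π q : M, TangentSpace (𝓡 2) q) {y : Plane} (hy : y ∈ (e.symm.trans e').source)
    (c : Fin 2) : fieldComp e' σ c (e.symm.trans e' y) =
      ∑ k, jacobian (e.symm.trans e') c k y * fieldComp e σ k y := by
  have h1 : y ∈ e.target := by simpa using hy.1
  have h2 : e.symm y ∈ e'.source := hy.2
  have := coordForm_eq_sum_jacobian he he' (e.map_target h1) h2 c (σ (e.symm y))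
  rw [e.right_inv h1] at this
  exact (fieldComp_apply_chart h2 σ c).trans this

theorem fieldComp_coordField (he : e ∈ atlas Plane M) {x : Plane} (hx : x ∈ e.target)
    (k i : Fin 2) : fieldComp e (coordField e i) k x = (1 : Matrix (Fin 2) (Fin 2) ℝ) k i :=
  coordForm_coordField he (e.map_target hx) k i

namespace AffineConnection

variable (D : AffineConnection M)

theorem christoffel_eq (k i j : Fin 2) (x : Plane) :
    D.christoffel e k i j x = coordForm e k (e.symm x)
      (D.cov (coordField e j) (e.symm x) (coordField e i (e.symm x))) := rfl

theorem christoffel_apply_chart (hp : p ∈ e.source) (k i j : Fin 2) :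
    D.christoffel e k i j (e p) =
      coordForm e k p (D.cov (coordField e j) p (coordField e i p)) := by
  rw [christoffel_eq, e.left_inv hp]

/-- The covariant derivative of a vector field in terms of the Christoffel symbols. -/
theorem coordForm_cov (he : e ∈ atlas Plane M) (hp : p ∈ e.source)
    {σ : Π q : M, TangentSpace (𝓡 2) q}
    (hσ : MDifferentiableAt (𝓡 2) ((𝓡 2).prod 𝓘(ℝ, Plane)) (fieldMap σ) p) (k i : Fin 2) :
    coordForm e k p (D.cov σ p (coordField e i p)) =
      covDerivField (D.christoffel e) (fieldComp e σ) k i (e p) := by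
  -- Near `p` the field is `∑ σ^j ∂_j`; apply the Leibniz rule.
  have hf := fun j => mdifferentiableAt_coordForm he hp j hσ
  have hX := fun j => mdifferentiableAt_coordField he hp j
  have hfX : ∀ j, MDifferentiableAt (𝓡 2) ((𝓡 2).prod 𝓘(ℝ, Plane))
      (fieldMap ((fun q => coordForm e j q (σ q)) • coordField e j)) p := fun j =>
    MDifferentiableAt.smul_section (hf j) (hX j)
  have hadd : MDifferentiableAt (𝓡 2) ((𝓡 2).prod 𝓘(ℝ, Plane))
      (fieldMap (((fun q => coordForm e 0 q (σ q)) • coordField e 0)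
        + ((fun q => coordForm e 1 q (σ q)) • coordField e 1))) p :=
    mdifferentiableAt_add_section (hfX 0) (hfX 1)
  have hcov := D.cov.isCovariantDerivativeOnUniv
  have h1 : D.cov σ p = D.cov (((fun q => coordForm e 0 q (σ q)) • coordField e 0)
        + ((fun q => coordForm e 1 q (σ q)) • coordField e 1)) p := by
    refine hcov.congr_of_eventuallyEq hσ hadd Filter.univ_mem ?_
    filter_upwards [e.open_source.mem_nhds hp] with q hq
    have := sum_coordForm_smul_coordField he hq (σ q)
    rw [Fin.sum_univ_two] at this
    exact this.symm
  rw [h1, hcov.add (hfX 0) (hfX 1), hcov.leibniz (hX 0) (hf 0), hcov.leibniz (hX 1) (hf 1)]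
  have hm : ∀ j, mvfderiv (𝓡 2) (fun q => coordForm e j q (σ q)) p (coordField e i p)
      = pderiv i (fieldComp e σ j) (e p) := fun j => mfderiv_coordField he hp (hf j) i
  simp only [_root_.add_apply, _root_.smul_apply, ContinuousLinearMap.smulRight_apply, hm, map_add,
    map_smul, covDerivField, Fin.sum_univ_two, D.christoffel_apply_chart hp,
    fieldComp_apply_chart hp, smul_eq_mul]
  rw [coordForm_coordField he hp, coordForm_coordField he hp]
  rcases fin_two_cases k with rfl | rfl <;> simp <;> ring

/-- A connection is determined by its Christoffel symbols in the charts. -/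
theorem ext_of_christoffel {D D' : AffineConnection M}
    (h : ∀ e ∈ atlas Plane M, ∀ x ∈ e.target, ∀ k i j,
      D.christoffel e k i j x = D'.christoffel e k i j x) : D = D' := by
  have hcov : D.cov = D'.cov := by
    refine CovariantDerivative.ext (funext fun σ => funext fun p => ?_)
    by_cases hσ : MDifferentiableAt (𝓡 2) ((𝓡 2).prod 𝓘(ℝ, Plane)) (fieldMap σ) p
    · have he := chart_mem_atlas Plane p
      have hp := mem_chart_source Plane p
      ext v
      rw [map_eq_sum_coordForm he hp, map_eq_sum_coordForm he hp]
      refine Finset.sum_congr rfl fun i _ => congrArg _ (eq_of_coordForm_eq he hp fun k => ?_)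
      rw [D.coordForm_cov he hp hσ, D'.coordForm_cov he hp hσ]
      simp only [covDerivField, h _ he _ ((chartAt Plane p).map_source hp)]
    · exact (D.eq_zero_of_not_mdifferentiableAt σ p hσ).trans
        (D'.eq_zero_of_not_mdifferentiableAt σ p hσ).symm
  cases D
  cases D'
  cases hcov
  rfl

theorem christoffelLaw [OrientedAtlas M] (he : e ∈ atlas Plane M) (he' : e' ∈ atlas Plane M) :
    ChristoffelLaw (D.christoffel e) (D.christoffel e') (e.symm.trans e')
      (e.symm.trans e').source := by
  intro y hy c i j
  have hφ := isCoordChange_transition he he'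
  have h1 : y ∈ e.target := by simpa using hy.1
  have hp := e.map_target h1
  have hp' : e.symm y ∈ e'.source := hy.2
  set p := e.symm y with hpdef
  have hy' : e p = y := e.right_inv h1
  have hφy : e.symm.trans e' y = e' p := rfl
  have hX := mdifferentiableAt_coordField he hp j
  have hJ : ∀ y ∈ (e.symm.trans e').source, ∀ c,
      fieldComp e' (coordField e j) c (e.symm.trans e' y) = jacobian (e.symm.trans e') c j y := by
    intro y hy c
    rw [fieldComp_transition he he' _ hy, Fin.sum_univ_two,
      fieldComp_coordField he (by simpa using hy.1), fieldComp_coordField he (by simpa using hy.1)]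
    rcases fin_two_cases j with rfl | rfl <;> simp
  have d1 := hφ.pderiv_comp hy (differentiableAt_fieldComp he' hp' hX c) i
  have d2 : pderiv i (fun y => fieldComp e' (coordField e j) c (e.symm.trans e' y)) y
      = pderiv i (jacobian (e.symm.trans e') c j) y :=
    pderiv_congr i hφ.isOpen_source hy fun z hz => hJ z hz c
  -- Both sides are the component `dx'^c (∇_{∂_i} ∂_j)`.
  have l1 : coordForm e' c p (D.cov (coordField e j) p (coordField e i p)) =
      ∑ k, jacobian (e.symm.trans e') c k y * D.christoffel e k i j y := by
    rw [coordForm_eq_sum_jacobian he he' hp hp', hy']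
    rfl
  have l2 : coordForm e' c p (D.cov (coordField e j) p (coordField e i p)) =
      ∑ a, jacobian (e.symm.trans e') a i y *
        covDerivField (D.christoffel e') (fieldComp e' (coordField e j)) c a (e' p) := by
    rw [coordField_eq_sum_jacobian he he' hp hp' i, hy', Fin.sum_univ_two, map_add, map_smul,
      map_smul, map_add, map_smul, map_smul, D.coordForm_cov he' hp' hX, D.coordForm_cov he' hp' hX,
      Fin.sum_univ_two]
    rfl
  rw [← l1, l2, ← d2, d1]
  simp only [covDerivField, ← hφy, hJ y hy, Fin.sum_univ_two]
  ring

end AffineConnection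

end Connections

section Connections

variable {M : Type*} [TopologicalSpace M] [ChartedSpace Plane M] [IsManifold (𝓡 2) ∞ M]
  {e e' : OpenPartialHomeomorph M Plane} {p : M}

theorem mlieBracket_coordField (he : e ∈ atlas Plane M) (hp : p ∈ e.source) (i j : Fin 2) :
    VectorField.mlieBracket (𝓡 2) (coordField e i) (coordField e j) p = 0 := by
  have he' : e ∈ IsManifold.maximalAtlas (𝓡 2) ∞ M := IsManifold.subset_maximalAtlas he
  have hc : ∀ i, MDifferentiableAt (𝓡 2) (𝓡 2).tangent
      (fun y : Plane => (⟨y, (EuclideanSpace.single i 1 : Plane)⟩ : TangentBundle (𝓡 2) Plane))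
      (e p) := fun i => by
    have : ContMDiffAt (𝓡 2) (𝓡 2).tangent 1
      (fun y : Plane => (⟨y, (EuclideanSpace.single i 1 : Plane)⟩ : TangentBundle (𝓡 2) Plane))
      (e p) := contMDiffAt_vectorSpace_iff_contDiffAt.mpr contDiffAt_const
    exact this.mdifferentiableAt (by simp)
  have h2 : minSmoothness ℝ 2 ≤ ∞ := by
    rw [minSmoothness_of_isRCLikeNormedField]
    exact WithTop.coe_le_coe.2 (le_top : (2 : ℕ∞) ≤ ⊤)
  have : IsManifold (𝓡 2) (minSmoothness ℝ 2) M := IsManifold.of_le h2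
  have h := VectorField.mpullback_mlieBracket (n := ∞) (hc i) (hc j)
    (contMDiffAt_of_mem_maximalAtlas he' hp) h2
  refine h.symm.trans ?_
  rw [VectorField.mpullback_apply]
  have : ∀ V W : Π y : Plane, TangentSpace (𝓡 2) y,
      (V = fun _ => (EuclideanSpace.single i 1 : Plane)) →
      (W = fun _ => (EuclideanSpace.single j 1 : Plane)) →
      VectorField.mlieBracket (𝓡 2) V W (e p) = 0 := by
    intro V W hV hW
    rw [← VectorField.mlieBracketWithin_univ, VectorField.mlieBracketWithin_eq_lieBracketWithin]
    subst hV hW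
    have h0 : ∀ v : Plane, fderivWithin ℝ (fun _ : Plane => v) Set.univ (e p) = 0 :=
      fun v => fderivWithin_const_apply v
    change fderivWithin ℝ (fun _ : Plane => (EuclideanSpace.single j 1 : Plane)) Set.univ (e p) _
      - fderivWithin ℝ (fun _ : Plane => (EuclideanSpace.single i 1 : Plane)) Set.univ (e p) _ = 0
    rw [h0, h0]
    exact sub_self (0 : Plane)
  exact (congrArg _ (this _ _ rfl rfl)).trans (map_zero _)

namespace AffineConnection

variable (D : AffineConnection M)

theorem isTorsionFree_iff : D.IsTorsionFree ↔ ∀ e ∈ atlas Plane M, ∀ x ∈ e.target, ∀ k i j,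
    D.christoffel e k i j x = D.christoffel e k j i x := by
  have key : ∀ e ∈ atlas Plane M, ∀ p ∈ e.source, ∀ i j k,
      coordForm e k p (D.cov.torsion p (coordField e i p) (coordField e j p)) =
        D.christoffel e k i j (e p) - D.christoffel e k j i (e p) := by
    intro e he p hp i j k
    rw [D.cov.torsion_apply (mdifferentiableAt_coordField he hp i)
      (mdifferentiableAt_coordField he hp j), mlieBracket_coordField he hp, sub_zero, map_sub,
      D.christoffel_apply_chart hp, D.christoffel_apply_chart hp]
  constructor
  · intro h e he x hx k i j
    have := key e he _ (e.map_target hx) i j k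
    rw [show D.cov.torsion = 0 from h, e.right_inv hx] at this
    simp only [Pi.zero_apply, _root_.zero_apply, map_zero] at this
    linarith
  · intro h
    refine funext fun p => ?_
    have he := chart_mem_atlas Plane p
    have hp := mem_chart_source Plane p
    have h0 : ∀ i j, D.cov.torsion p (coordField (chartAt Plane p) i p)
        (coordField (chartAt Plane p) j p) = 0 := fun i j =>
      eq_of_coordForm_eq he hp fun k => by
        rw [key _ he p hp, h _ he _ ((chartAt Plane p).map_source hp), sub_self, map_zero]
    ext v w
    rw [map_eq_sum_coordForm he hp (D.cov.torsion p)]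
    simp only [Fin.sum_univ_two, _root_.add_apply, _root_.smul_apply]
    rw [map_eq_sum_coordForm he hp (D.cov.torsion p _),
      map_eq_sum_coordForm he hp (D.cov.torsion p (coordField (chartAt Plane p) 1 p))]
    simp [h0]

theorem contDiffOn_christoffel [T2Space M] (he : e ∈ atlas Plane M) (k i j : Fin 2) :
    ContDiffOn ℝ ∞ (D.christoffel e k i j) e.target := by
  refine contDiffOn_comp_symm he
    (f := fun q => coordForm e k q (D.cov (coordField e j) q (coordField e i q))) ?_
  intro p hp
  -- Smoothness of a connection refers to global sections, so the coordinate field is cut off by a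
  -- bump function around `p`.
  obtain ⟨χ, -, hχ⟩ := (SmoothBumpFunction.nhds_basis_tsupport (I := 𝓡 2) p).mem_iff.mp
    (e.open_source.mem_nhds hp)
  have hσ : ContMDiff (𝓡 2) ((𝓡 2).prod 𝓘(ℝ, Plane)) ∞
      (fieldMap ((χ : M → ℝ) • coordField e j)) :=
    ContMDiffOn.smul_section_of_tsupport χ.contMDiff.contMDiffOn e.open_source hχ
      (contMDiffOn_coordField he j)
  have hcov := (D.smooth.contMDiff.contMDiff (σ := (χ : M → ℝ) • coordField e j)
    (by rw [show (∞ : WithTop ℕ∞) + 1 = ∞ from rfl]; exact hσ.contMDiffOn)).contMDiffAt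
    (x := p) Filter.univ_mem
  have h1 := contMDiffAt_coordForm he hp k (hcov.clm_bundle_apply
    ((contMDiffOn_coordField he i).contMDiffAt (e.open_source.mem_nhds hp)))
  refine (h1.congr_of_eventuallyEq ?_).contMDiffWithinAt
  have hone : ∀ᶠ q in nhds p, ∀ᶠ q' in nhds q, χ q' = 1 :=
    eventually_eventually_nhds.mpr χ.eventuallyEq_one
  filter_upwards [hone, e.open_source.mem_nhds hp] with q hq hqe
  have : D.cov (coordField e j) q = D.cov ((χ : M → ℝ) • coordField e j) q := by
    refine D.cov.isCovariantDerivativeOnUniv.congr_of_eventuallyEq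
      (mdifferentiableAt_coordField he hqe j) (hσ.contMDiffAt.mdifferentiableAt (by simp))
      Filter.univ_mem ?_
    filter_upwards [hq] with q' hq'
    simp [hq']
  rw [this]

end AffineConnection

/-- Compatible families of Christoffel symbols define a connection. -/
theorem exists_affineConnection [OrientedAtlas M]
    {Γ : OpenPartialHomeomorph M Plane → Fin 2 → Fin 2 → Fin 2 → Plane → ℝ}
    (hΓ : ∀ e ∈ atlas Plane M, ∀ k i j, ContDiffOn ℝ ∞ (Γ e k i j) e.target)
    (law : ∀ e ∈ atlas Plane M, ∀ e' ∈ atlas Plane M,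
      ChristoffelLaw (Γ e) (Γ e') (e.symm.trans e') (e.symm.trans e').source) :
    ∃ D : AffineConnection M, ∀ e ∈ atlas Plane M, ∀ x ∈ e.target, ∀ k i j,
      D.christoffel e k i j x = Γ e k i j x := by
  classical
  have hc : ∀ p : M, chartAt Plane p ∈ atlas Plane M := chart_mem_atlas Plane
  have hs : ∀ p : M, p ∈ (chartAt Plane p).source := mem_chart_source Plane
  set A : OpenPartialHomeomorph M Plane → (Π q : M, TangentSpace (𝓡 2) q) →
      Π p : M, TangentSpace (𝓡 2) p →L[ℝ] TangentSpace (𝓡 2) p := fun e σ p =>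
    frameLift e p fun i => ∑ k, covDerivField (Γ e) (fieldComp e σ) k i (e p) • coordField e k p
    with hA
  set P : (Π q : M, TangentSpace (𝓡 2) q) → M → Prop := fun σ p =>
    MDifferentiableAt (𝓡 2) ((𝓡 2).prod 𝓘(ℝ, Plane)) (fieldMap σ) p with hP
  have hcomp : ∀ e ∈ atlas Plane M, ∀ p ∈ e.source, ∀ σ k i,
      coordForm e k p (A e σ p (coordField e i p)) =
        covDerivField (Γ e) (fieldComp e σ) k i (e p) := by
    intro e he p hp σ k i
    have h : A e σ p (coordField e i p) =
        ∑ k, covDerivField (Γ e) (fieldComp e σ) k i (e p) • coordField e k p := by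
      simp only [hA, frameLift_apply, coordForm_coordField he hp]
      rcases fin_two_cases i with rfl | rfl <;> simp
    rw [h, Fin.sum_univ_two, map_add, map_smul, map_smul, coordForm_coordField he hp,
      coordForm_coordField he hp]
    rcases fin_two_cases k with rfl | rfl <;> simp
  have hext : ∀ e ∈ atlas Plane M, ∀ p ∈ e.source,
      ∀ T T' : TangentSpace (𝓡 2) p →L[ℝ] TangentSpace (𝓡 2) p,
      (∀ k i, coordForm e k p (T (coordField e i p)) = coordForm e k p (T' (coordField e i p))) →
      T = T' := by
    intro e he p hp T T' h
    ext v
    rw [map_eq_sum_coordForm he hp T, map_eq_sum_coordForm he hp T']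
    exact Finset.sum_congr rfl fun i _ =>
      congrArg _ (eq_of_coordForm_eq he hp fun k => h k i)
  -- The expression does not depend on the chart.
  have hindep : ∀ e ∈ atlas Plane M, ∀ e' ∈ atlas Plane M, ∀ p ∈ e.source, p ∈ e'.source →
      ∀ σ, P σ p → A e σ p = A e' σ p := by
    intro e he e' he' p hp hp' σ hσ
    have hφ := isCoordChange_transition he he'
    have hy : e p ∈ (e.symm.trans e').source := by simp [hp, hp']
    have hφy : e.symm.trans e' (e p) = e' p := by simp [hp]
    have hn := (law e he e' he').covDerivField hφ hy
      (s := fieldComp e σ) (s' := fieldComp e' σ)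
      (fun k => differentiableAt_fieldComp he hp hσ k)
      (fun k => by rw [hφy]; exact differentiableAt_fieldComp he' hp' hσ k)
      (fun y hy c => fieldComp_transition he he' σ hy c)
    refine hext e he p hp _ _ fun k i => ?_
    refine eq_of_jacobian_mul (F := fun c j => jacobian (e.symm.trans e') c j (e p))
      (hφ.det_pos _ hy).ne'
      (u := fun k => coordForm e k p (A e σ p (coordField e i p)))
      (v := fun k => coordForm e k p (A e' σ p (coordField e i p))) (fun c => ?_) k
    have e1 : ∑ k, jacobian (e.symm.trans e') c k (e p) *
        coordForm e k p (A e σ p (coordField e i p)) =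
        ∑ k, jacobian (e.symm.trans e') c k (e p) *
          covDerivField (Γ e) (fieldComp e σ) k i (e p) :=
      Finset.sum_congr rfl fun k _ => by rw [hcomp e he p hp]
    refine e1.trans (Eq.trans ?_ (coordForm_eq_sum_jacobian he he' hp hp' c _))
    rw [hn, coordField_eq_sum_jacobian he he' hp hp' i, Fin.sum_univ_two, Fin.sum_univ_two,
      map_add, map_smul, map_smul, map_add, map_smul, map_smul, hcomp e' he' p hp',
      hcomp e' he' p hp', hφy, smul_eq_mul, smul_eq_mul]
    ring
  -- At points where a section is not differentiable the value `0` is prescribed.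
  set cov : (Π q : M, TangentSpace (𝓡 2) q) →
      Π p : M, TangentSpace (𝓡 2) p →L[ℝ] TangentSpace (𝓡 2) p := fun σ p =>
    if P σ p then A (chartAt Plane p) σ p else 0 with hcov
  have hcovA : ∀ e ∈ atlas Plane M, ∀ p ∈ e.source, ∀ σ, P σ p → cov σ p = A e σ p := by
    intro e he p hp σ hσ
    simp only [hcov, if_pos hσ]
    exact hindep _ (hc p) e he p (hs p) hp σ hσ
  have hcovcomp : ∀ e ∈ atlas Plane M, ∀ p ∈ e.source, ∀ σ, P σ p → ∀ k i,
      coordForm e k p (cov σ p (coordField e i p)) =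
        covDerivField (Γ e) (fieldComp e σ) k i (e p) := by
    intro e he p hp σ hσ k i
    rw [hcovA e he p hp σ hσ, hcomp e he p hp]
  have hcd : IsCovariantDerivativeOn Plane cov Set.univ := by
    constructor
    · intro σ σ' p hσ hσ' _
      have he := hc p
      have hp := hs p
      have hσσ' : P (σ + σ') p := mdifferentiableAt_add_section hσ hσ'
      refine hext _ he p hp _ _ fun k i => ?_
      rw [_root_.add_apply, map_add, hcovcomp _ he p hp _ hσ, hcovcomp _ he p hp _ hσ',
        hcovcomp _ he p hp _ hσσ']
      have h1 : ∀ k, fieldComp (chartAt Plane p) (σ + σ') k =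
          fun y => fieldComp (chartAt Plane p) σ k y + fieldComp (chartAt Plane p) σ' k y :=
        fun k => funext fun y => map_add _ _ _
      simp only [covDerivField, h1, Fin.sum_univ_two]
      rw [pderiv_add i (differentiableAt_fieldComp he hp hσ k)
        (differentiableAt_fieldComp he hp hσ' k)]
      ring
    · intro σ f p hσ hf _
      have he := hc p
      have hp := hs p
      have hfσ : P (f • σ) p := MDifferentiableAt.smul_section hf hσ
      refine hext _ he p hp _ _ fun k i => ?_
      have hm : mvfderiv (𝓡 2) f p (coordField (chartAt Plane p) i p) =
          pderiv i (fun x => f ((chartAt Plane p).symm x)) (chartAt Plane p p) :=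
        mfderiv_coordField he hp hf i
      rw [_root_.add_apply, map_add, _root_.smul_apply, map_smul,
        ContinuousLinearMap.smulRight_apply, map_smul, hm, hcovcomp _ he p hp _ hσ,
        hcovcomp _ he p hp _ hfσ]
      have h1 : ∀ k, fieldComp (chartAt Plane p) (f • σ) k =
          fun y => f ((chartAt Plane p).symm y) * fieldComp (chartAt Plane p) σ k y :=
        fun k => funext fun y => (coordForm (chartAt Plane p) k _).map_smul _ _
      simp only [covDerivField, h1, Fin.sum_univ_two]
      rw [pderiv_mul i (differentiableAt_comp_symm he hp hf)
        (differentiableAt_fieldComp he hp hσ k)]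
      simp only [(chartAt Plane p).left_inv hp, fieldComp_apply_chart hp, smul_eq_mul]
      ring
  refine ⟨⟨⟨cov, hcd⟩, ⟨⟨fun {σ} hσ => ?_⟩⟩, fun σ p h => if_neg h⟩, fun e he x hx k i j => ?_⟩
  · intro p _
    have he := hc p
    have hp := hs p
    replace hσ : ContMDiffOn (𝓡 2) ((𝓡 2).prod 𝓘(ℝ, Plane)) ∞ (fieldMap σ) Set.univ := hσ
    have hPσ : ∀ q, P σ q := fun q =>
      (hσ.contMDiffAt Filter.univ_mem).mdifferentiableAt (by simp)
    have hcs : ∀ k, ContDiffOn ℝ ∞ (fieldComp (chartAt Plane p) σ k) (chartAt Plane p).target :=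
      fun k => contDiffOn_comp_symm he (contMDiffOn_coordForm he k subset_rfl
        (hσ.mono (Set.subset_univ _)))
    have h := contMDiffOn_hom_of_coordField (V := (TangentSpace (𝓡 2) : M → Type _)) he
      (T := cov σ) fun i => by
        refine (ContMDiffOn.sum_section (s := Finset.univ)
          (t := fun k q => covDerivField (Γ (chartAt Plane p)) (fieldComp (chartAt Plane p) σ) k i
            (chartAt Plane p q) • coordField (chartAt Plane p) k q) fun k _ =>
          ContMDiffOn.smul_section (contMDiffOn_comp_chart he ?_)
            (contMDiffOn_coordField he k)).congr fun q hq => ?_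
        · refine (contDiffOn_pderiv (hcs k) (chartAt Plane p).open_target i).add ?_
          exact ContDiffOn.sum fun j _ => (hΓ _ he k i j).mul (hcs j)
        · congr 1
          refine eq_of_coordForm_eq he hq fun k => ?_
          rw [hcovcomp _ he q hq σ (hPσ q), Fin.sum_univ_two, map_add, map_smul, map_smul,
            coordForm_coordField he hq, coordForm_coordField he hq]
          rcases fin_two_cases k with rfl | rfl <;> simp
    exact (h.contMDiffAt ((chartAt Plane p).open_source.mem_nhds hp)).contMDiffWithinAt
  · have hp := e.map_target hx
    refine (hcovcomp e he _ hp _ (mdifferentiableAt_coordField he hp j) k i).trans ?_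
    have h0 : pderiv i (fieldComp e (coordField e j) k) x =
        pderiv i (fun _ => (1 : Matrix (Fin 2) (Fin 2) ℝ) k j) x :=
      pderiv_congr i e.open_target hx fun y hy => fieldComp_coordField he hy k j
    rw [e.right_inv hx, covDerivField, h0, pderiv_const, Fin.sum_univ_two,
      fieldComp_coordField he hx, fieldComp_coordField he hx]
    rcases fin_two_cases j with rfl | rfl <;> simp

end Connections

/-! ### Structure equations and Ricci curvature in a chart -/

theorem CausalType.sign_mul_sign (τ : CausalType) : τ.sign * τ.sign = 1 := by
  cases τ <;> norm_num [CausalType.sign]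

theorem CausalType.sign_ne_zero (τ : CausalType) : τ.sign ≠ 0 := by
  cases τ <;> norm_num [CausalType.sign]

section Chart

variable {G : Plane → Matrix (Fin 2) (Fin 2) ℝ} {U : Set Plane} {x : Plane}
  {β : Fin 2 → Plane → ℝ} {C : Fin 2 → Fin 2 → Fin 2 → Plane → ℂ}
  {Γ : Fin 2 → Fin 2 → Fin 2 → Plane → ℝ}

theorem isHarmonicCubic_divergence (h : IsMetricOn G U) (hU : IsOpen U) (hx : x ∈ U)
    (hC : ∀ i j k, ContDiffOn ℝ ∞ (C i j k) U)
    (hH : ∀ y ∈ U, IsComplexCubic (G y) fun i j k => C i j k y) (b : Fin 2 → ℝ) (m : Fin 2) :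
    IsHarmonicCubic (G x) fun i j k =>
      covDerivCubic (leviCivita G) (fun a b c y => (C a b c y).re) m i j k x
        - 2 * (b m * (C i j k x).re) := by
  have h1 := (isComplexCubic_covDeriv h hU hx hC hH m).isHarmonicCubic_re (h.posDef x hx)
  have h2 := (hH x hx).isHarmonicCubic_re (h.posDef x hx)
  simp only [covDerivComplexCubic_re _ fun i j k =>
    (hC i j k).differentiableAt_of_mem hU hx] at h1
  refine ⟨fun i j k => ?_, fun i j k => ?_, fun k => ?_⟩
  · linear_combination h1.swap₁₂ i j k - 2 * b m * h2.swap₁₂ i j k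
  · linear_combination h1.swap₂₃ i j k - 2 * b m * h2.swap₂₃ i j k
  · have t1 := h1.trace k
    have t2 := h2.trace k
    simp only [Fin.sum_univ_two] at t1 t2 ⊢
    linear_combination t1 - 2 * b m * t2

/-- The structure equations for `(G, β, C)` say that the Ricci tensor of the twisted connection is
a constant multiple of `G`: they are its trace, its trace-free symmetric and its antisymmetric
part. -/
theorem ricci_eq_smul_iff (h : IsMetricOn G U) (hU : IsOpen U) (hx : x ∈ U)
    (hβ : ∀ j, ContDiffOn ℝ ∞ (β j) U) (hC : ∀ i j k, ContDiffOn ℝ ∞ (C i j k) U)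
    (hH : ∀ y ∈ U, IsComplexCubic (G y) fun i j k => C i j k y)
    (hΓ : ∀ y ∈ U, ∀ k i j, Γ k i j y = leviCivita G k i j y
      + twistTensor (G y) (fun l => β l y) (fun a b c => (C a b c y).re) k i j) (s : ℝ) :
    ricci Γ x = s • G x ↔
      gaussCurvature G x = s + 2 * cubicNormSq G C x + codifferential G β x ∧
      (∀ a i j k, delbar G C a i j k x =
        ((β a x : ℂ) - Complex.I * (hodgeStar G β a x : ℂ)) * C i j k x) ∧
      ∀ i j, pderiv i (β j) x = pderiv j (β i) x := by
  have hg := h.posDef x hx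
  have hRic := ricci_twisted (R := fun a b c y => (C a b c y).re) h hU hx hβ
    (fun i j k => Complex.reCLM.contDiff.comp_contDiffOn (hC i j k))
    (fun y hy => (hH y hy).isHarmonicCubic_re (h.posDef y hy)) hΓ
  have hN : (harmonicNormSq (G x) fun a b c => (C a b c x).re) = cubicNormSq G C x :=
    (hH x hx).harmonicNormSq_re hg
  rw [hN] at hRic
  rw [delbar_eq_iff h hU hx hC hH]
  have hW' := isHarmonicCubic_divergence h hU hx hC hH (fun m => β m x)
  set W : Fin 2 → Fin 2 → Fin 2 → Fin 2 → ℝ := fun m i j k =>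
    covDerivCubic (leviCivita G) (fun a b c y => (C a b c y).re) m i j k x
      - 2 * (β m x * (C i j k x).re) with hWdef
  have hW : ∀ m, IsHarmonicCubic (G x) (W m) := hW'
  have hRic' : ∀ i j, ricci Γ x i j = G x i j * (gaussCurvature G x - codifferential G β x
      - 2 * cubicNormSq G C x) + (pderiv i (β j) x - pderiv j (β i) x)
      + ∑ k, ∑ l, (G x)⁻¹ k l * W k i j l := hRic
  constructor
  · intro e
    have E : ∀ i j, s * G x i j = G x i j * (gaussCurvature G x - codifferential G β x
        - 2 * cubicNormSq G C x) + (pderiv i (β j) x - pderiv j (β i) x)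
        + ∑ k, ∑ l, (G x)⁻¹ k l * W k i j l := by
      intro i j
      rw [← hRic' i j, e]
      rfl
    have hinv : (G x)⁻¹ 1 0 = (G x)⁻¹ 0 1 := hg.inv.apply_comm 1 0
    have hGc := h.comm hx 1 0
    have i0 := h.sum_inv_mul hx 0 0
    have i1 := h.sum_inv_mul hx 1 1
    have t00 := (hW 0).trace 0
    have t01 := (hW 0).trace 1
    have t10 := (hW 1).trace 0
    have t11 := (hW 1).trace 1
    have w00 := (hW 0).swap₁₂ 1 0 0
    have w01 := (hW 0).swap₁₂ 1 0 1
    have w10 := (hW 1).swap₁₂ 1 0 0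
    have w11 := (hW 1).swap₁₂ 1 0 1
    simp only [Fin.sum_univ_two, hinv, Matrix.one_apply_eq, hGc] at i0 i1 t00 t01 t10 t11 E
    have E00 := E 0 0
    have E01 := E 0 1
    have E10 := E 1 0
    have E11 := E 1 1
    simp only [hGc, w00, w01, w10, w11] at E10 t00 t01 t10 t11
    have hcl : pderiv 0 (β 1) x = pderiv 1 (β 0) x := by
      linear_combination (1 / 2 : ℝ) * (E10 - E01)
    have hs : gaussCurvature G x - codifferential G β x - 2 * cubicNormSq G C x = s := by
      linear_combination (-1 / 2 : ℝ) * ((G x)⁻¹ 0 0 * E00 + (G x)⁻¹ 0 1 * (E01 + E10)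
          + (G x)⁻¹ 1 1 * E11)
        + (1 / 2 : ℝ) * (s - (gaussCurvature G x - codifferential G β x - 2 * cubicNormSq G C x))
          * (i0 + i1)
        - (1 / 2 : ℝ) * ((G x)⁻¹ 0 0 * t00 + (G x)⁻¹ 0 1 * (t01 + t10) + (G x)⁻¹ 1 1 * t11)
    refine ⟨by linarith, fun i j => ?_, fun i j => ?_⟩
    · have Eij := E i j
      rw [hs] at Eij
      simp only [Fin.sum_univ_two, hinv]
      rcases fin_two_cases i with rfl | rfl <;> rcases fin_two_cases j with rfl | rfl <;>
        linarith
    · rcases fin_two_cases i with rfl | rfl <;> rcases fin_two_cases j with rfl | rfl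
      exacts [rfl, hcl, hcl.symm, rfl]
  · rintro ⟨hK, hdiv, hcl⟩
    ext i j
    rw [hRic' i j, hdiv i j, hcl i j, hK, Matrix.smul_apply, smul_eq_mul]
    ring

theorem induced_oneForm (h : IsMetricOn G U) (hU : IsOpen U) (hx : x ∈ U)
    (hH : IsComplexCubic (G x) fun i j k => C i j k x)
    (hΓ : ∀ k i j, Γ k i j x = leviCivita G k i j x
      + twistTensor (G x) (fun l => β l x) (fun a b c => (C a b c x).re) k i j) (k : Fin 2) :
    3 / 8 * trace3 (G x) (sym3 fun a b c => covDerivMetric Γ G a b c x) k = β k x := by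
  have hr := hH.isHarmonicCubic_re (h.posDef x hx)
  simp only [covDerivMetric_twisted (R := fun a b c y => (C a b c y).re) h hU hx hr hΓ]
  rw [trace3_sym3 (b := fun k => β k x) (h.posDef x hx) hr]
  ring

theorem induced_cubic (h : IsMetricOn G U) (hU : IsOpen U) (hx : x ∈ U)
    (hH : IsComplexCubic (G x) fun i j k => C i j k x)
    (hΓ : ∀ k i j, Γ k i j x = leviCivita G k i j x
      + twistTensor (G x) (fun l => β l x) (fun a b c => (C a b c x).re) k i j) (i j k : Fin 2) :
    -(1 / 2) * traceFree3 (G x) (sym3 fun a b c => covDerivMetric Γ G a b c x) i j k =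
      (C i j k x).re := by
  have hr := hH.isHarmonicCubic_re (h.posDef x hx)
  simp only [covDerivMetric_twisted (R := fun a b c y => (C a b c y).re) h hU hx hr hΓ]
  rw [traceFree3_sym3 (b := fun k => β k x) (h.posDef x hx) hr]
  ring

theorem twisted_minimal (h : IsMetricOn G U) (hU : IsOpen U) (hx : x ∈ U)
    (hs : ∀ k i j, ContDiffOn ℝ ∞ (Γ k i j) U)
    (hH : ∀ y ∈ U, IsComplexCubic (G y) fun i j k => C i j k y)
    (hΓ : ∀ y ∈ U, ∀ k i j, Γ k i j y = leviCivita G k i j y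
      + twistTensor (G y) (fun l => β l y) (fun a b c => (C a b c y).re) k i j)
    {s : ℝ} (hs0 : s ≠ 0) (hG : ∀ y ∈ U, ricciSymm Γ y = s • G y) (μ : Fin 2 ⊕ Fin 2) :
    meanCurvature (cotangentMetric Γ) _root_.zeroSection μ x = 0 := by
  have hg := h.posDef x hx
  have hr := (hH x hx).isHarmonicCubic_re hg
  refine (meanCurvature_zeroSection_eq_zero_iff h hU hx hs (fun k i j => ?_) hs0 hG).mpr
    (fun k => ?_) μ
  · rw [hΓ x hx, hΓ x hx, h.leviCivita_comm hU hx k i j, twistTensor_comm hg hr k i j]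
  · simp only [hΓ x hx, add_sub_cancel_left]
    exact sum_inv_mul_twistTensor hg hr k

/-- A minimal connection is twisted. -/
theorem twisted_of_minimal (h : IsMetricOn G U) (hU : IsOpen U) (hx : x ∈ U)
    (hs : ∀ k i j, ContDiffOn ℝ ∞ (Γ k i j) U) (hsymm : ∀ k i j, Γ k i j x = Γ k j i x)
    {s : ℝ} (hs0 : s ≠ 0) (hG : ∀ y ∈ U, ricciSymm Γ y = s • G y)
    (hm : ∀ μ, meanCurvature (cotangentMetric Γ) _root_.zeroSection μ x = 0)
    {A : Fin 2 → Fin 2 → Fin 2 → ℝ} {b : Fin 2 → ℝ} {r : Fin 2 → Fin 2 → Fin 2 → ℝ}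
    (hA : ∀ k i j, A k i j = Γ k i j x - leviCivita G k i j x)
    (hb : ∀ j, b j = -(1 / 2) * ∑ k, A k k j)
    (hr : ∀ i j l, r i j l = ∑ k, G x l k * A k i j - G x i j * b l + b i * G x l j
      + G x l i * b j) :
    IsHarmonicCubic (G x) r ∧ ∀ k i j, A k i j = twistTensor (G x) b r k i j := by
  refine exists_twistTensor (h.posDef x hx) (fun k i j => ?_) (fun k => ?_) hb hr
  · rw [hA, hA, hsymm, h.leviCivita_comm hU hx k i j]
  · simp only [hA]
    exact (meanCurvature_zeroSection_eq_zero_iff h hU hx hs hsymm hs0 hG).mp hm k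

theorem ricciSymm_of_isSymm (hsymm : (ricci Γ x).IsSymm) : ricciSymm Γ x = ricci Γ x := by
  rw [ricciSymm, hsymm.eq, ← two_smul ℝ, smul_smul]
  norm_num

end Chart

/-! ### Minimal Lagrangian connections and triples -/

section Chart

variable {G G' : Plane → Matrix (Fin 2) (Fin 2) ℝ} {U : Set Plane} {x x' : Plane}

theorem contDiffOn_ricci {Γ : Fin 2 → Fin 2 → Fin 2 → Plane → ℝ} (hU : IsOpen U)
    (hΓ : ∀ k i j, ContDiffOn ℝ ∞ (Γ k i j) U) (i j : Fin 2) :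
    ContDiffOn ℝ ∞ (fun y => ricci Γ y i j) U := by
  have h (l a b c : Fin 2) : ContDiffOn ℝ ∞ (curvature Γ l a b c) U := by
    have e : curvature Γ l a b c = fun y => pderiv a (Γ l b c) y - pderiv b (Γ l a c) y
        + ((Γ 0 b c y * Γ l a 0 y - Γ 0 a c y * Γ l b 0 y)
          + (Γ 1 b c y * Γ l a 1 y - Γ 1 a c y * Γ l b 1 y)) := by
      funext y
      rw [curvature, Fin.sum_univ_two]
    rw [e]
    exact ((contDiffOn_pderiv (hΓ _ _ _) hU _).sub (contDiffOn_pderiv (hΓ _ _ _) hU _)).add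
      ((((hΓ _ _ _).mul (hΓ _ _ _)).sub ((hΓ _ _ _).mul (hΓ _ _ _))).add
        (((hΓ _ _ _).mul (hΓ _ _ _)).sub ((hΓ _ _ _).mul (hΓ _ _ _))))
  have e : (fun y => ricci Γ y i j) = fun y => curvature Γ 0 0 i j y + curvature Γ 1 1 i j y := by
    funext y
    rw [ricci, Matrix.of_apply, Fin.sum_univ_two]
  rw [e]
  exact (h _ _ _ _).add (h _ _ _ _)

theorem complexStructure_congr (h : G x = G' x) (m a : Fin 2) :
    complexStructure G m a x = complexStructure G' m a x := by
  simp only [complexStructure, h]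

theorem IsMetricOn.leviCivita_congr (h : IsMetricOn G U) (hU : IsOpen U) (hx : x ∈ U)
    (hGG' : ∀ y ∈ U, G' y = G y) (k i j : Fin 2) : leviCivita G' k i j x = leviCivita G k i j x :=
  leviCivita_congr_smul hU hx one_ne_zero (fun i j => h.differentiableAt hU hx i j)
    (fun y hy => by rw [hGG' y hy, one_smul]) k i j

theorem covDerivMetric_congr {Γ : Fin 2 → Fin 2 → Fin 2 → Plane → ℝ} (hU : IsOpen U) (hx : x ∈ U)
    (hGG' : ∀ y ∈ U, G' y = G y) (k i j : Fin 2) :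
    covDerivMetric Γ G' k i j x = covDerivMetric Γ G k i j x := by
  rw [covDerivMetric, covDerivMetric, pderiv_congr k hU hx fun y hy => by rw [hGG' y hy],
    hGG' x hx]

/-- A cubic differential is determined by its real part. -/
theorem IsComplexCubic.im_eq (hg : (G x).PosDef) {c : Fin 2 → Fin 2 → Fin 2 → ℂ}
    (hc : IsComplexCubic (G x) c) (i j k : Fin 2) :
    (c i j k).im = -∑ m, complexStructure G m i x * (c m j k).re := by
  have h := congrArg Complex.re (hc.complexStructure_slot₁ hg i j k)
  simp only [Fin.sum_univ_two, Complex.add_re, Complex.mul_re, Complex.ofReal_re,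
    Complex.ofReal_im, Complex.I_re, Complex.I_im] at h ⊢
  linarith

theorem complexCubic_natural {F : Fin 2 → Fin 2 → ℝ}
    (hF : 0 < F 0 0 * F 1 1 - F 0 1 * F 1 0) (hg' : (G' x').PosDef)
    (h : BilinLaw F (G x) (G' x')) {r r' : Fin 2 → Fin 2 → Fin 2 → ℝ} (hr : TrilinLaw F r r')
    (i j k : Fin 2) :
    complexCubic (fun m a => complexStructure G m a x) r i j k =
      ∑ a, ∑ b, ∑ c, complexCubic (fun m a => complexStructure G' m a x') r' a b c
        * ((F a i * F b j * F c k : ℝ) : ℂ) := by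
  have n := fun c => complexStructure_natural hF hg' h c i
  have key : ∑ m, complexStructure G m i x * r m j k =
      ∑ a, ∑ b, ∑ c, (∑ m, complexStructure G' m a x' * r' m b c) * (F a i * F b j * F c k) := by
    have n0 := n 0
    have n1 := n 1
    rw [Fin.sum_univ_two, hr 0 j k, hr 1 j k]
    simp only [Fin.sum_univ_two] at n0 n1 ⊢
    linear_combination
      (r' 0 0 0 * F 0 j * F 0 k + r' 0 0 1 * F 0 j * F 1 k
        + r' 0 1 0 * F 1 j * F 0 k + r' 0 1 1 * F 1 j * F 1 k) * n0
      + (r' 1 0 0 * F 0 j * F 0 k + r' 1 0 1 * F 0 j * F 1 k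
        + r' 1 1 0 * F 1 j * F 0 k + r' 1 1 1 * F 1 j * F 1 k) * n1
  have key' := congrArg (fun t : ℝ => (t : ℂ)) key
  have hr' := congrArg (fun t : ℝ => (t : ℂ)) (hr i j k)
  simp only [Fin.sum_univ_two] at key' hr'
  push_cast at key' hr'
  simp only [complexCubic, Fin.sum_univ_two]
  push_cast
  linear_combination hr' - Complex.I * key'

end Chart

section Trilinear

variable {E : Type*} [AddCommGroup E] [Module ℝ E] [TopologicalSpace E]
  (c : E →L[ℝ] E →L[ℝ] E →L[ℝ] ℂ) (f : Fin 2 → ℝ) (d : Fin 2 → E) (v w : E)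

set_option synthInstance.maxHeartbeats 200000 in
theorem trilinear_slot₁ : c (∑ m, f m • d m) v w = ∑ m, (f m : ℂ) * c (d m) v w := by
  simp only [Fin.sum_univ_two, map_add, map_smul, _root_.add_apply, _root_.smul_apply,
    Complex.real_smul]

theorem trilinear_slot₂ : c v (∑ m, f m • d m) w = ∑ m, (f m : ℂ) * c v (d m) w := by
  simp only [Fin.sum_univ_two, map_add, map_smul, _root_.add_apply, _root_.smul_apply,
    Complex.real_smul]

theorem trilinear_slot₃ : c v w (∑ m, f m • d m) = ∑ m, (f m : ℂ) * c v w (d m) := by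
  simp only [Fin.sum_univ_two, map_add, map_smul, Complex.real_smul]

end Trilinear

namespace SurfaceTriple

variable {M : Type*} [TopologicalSpace M] [ChartedSpace Plane M] [IsManifold (𝓡 2) ∞ M]
  {e e' : OpenPartialHomeomorph M Plane} {p : M} (T : SurfaceTriple M)

theorem isMetricOn_gComp (he : e ∈ atlas Plane M) : IsMetricOn (T.gComp e) e.target :=
  isMetricOn_metricComp T.g he

theorem contDiffOn_βComp (he : e ∈ atlas Plane M) (i : Fin 2) :
    ContDiffOn ℝ ∞ (T.βComp e i) e.target :=
  contDiffOn_oneForm T.β he i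

theorem contDiffOn_CComp (he : e ∈ atlas Plane M) (i j k : Fin 2) :
    ContDiffOn ℝ ∞ (T.CComp e i j k) e.target :=
  T.smooth_C e he i j k

theorem isComplexCubic_CComp (he : e ∈ atlas Plane M) {x : Plane} (hx : x ∈ e.target) :
    IsComplexCubic (T.gComp e x) fun i j k => T.CComp e i j k x := by
  have hg := (T.isMetricOn_gComp he).posDef x hx
  have h := T.complexTrilinear e he x hx
  constructor
  · intro j k
    refine (complexLinear_iff hg fun m => T.CComp e m j k x).mp fun u => ?_
    exact (trilinear_slot₁ _ _ _ _ _).symm.trans (h u j k).1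
  · intro i k
    refine (complexLinear_iff hg fun m => T.CComp e i m k x).mp fun u => ?_
    exact (trilinear_slot₂ _ _ _ _ _).symm.trans (h i u k).2.1
  · intro i j
    refine (complexLinear_iff hg fun m => T.CComp e i j m x).mp fun u => ?_
    exact (trilinear_slot₃ _ _ _ _ _).symm.trans (h i j u).2.2

theorem gComp_apply_chart (hp : p ∈ e.source) (i j : Fin 2) :
    T.gComp e (e p) i j = T.g.inner p (coordField e i p) (coordField e j p) := by
  rw [gComp, metricComp, Matrix.of_apply, e.left_inv hp]

theorem βComp_apply_chart (hp : p ∈ e.source) (i : Fin 2) :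
    T.βComp e i (e p) = T.β p (coordField e i p) := by
  rw [βComp, e.left_inv hp]

theorem CComp_apply_chart (hp : p ∈ e.source) (i j k : Fin 2) :
    T.CComp e i j k (e p) = T.C p (coordField e i p) (coordField e j p) (coordField e k p) := by
  rw [CComp, e.left_inv hp]

theorem bilinLaw_gComp (he : e ∈ atlas Plane M) (he' : e' ∈ atlas Plane M) (hp : p ∈ e.source)
    (hp' : p ∈ e'.source) :
    BilinLaw (fun c j => jacobian (e.symm.trans e') c j (e p)) (T.gComp e (e p))
      (T.gComp e' (e' p)) := by
  intro i j
  simp only [T.gComp_apply_chart hp, T.gComp_apply_chart hp',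
    coordField_eq_sum_jacobian he he' hp hp', Fin.sum_univ_two, map_add, map_smul,
    _root_.add_apply, _root_.smul_apply, smul_eq_mul]
  ring

theorem linLaw_βComp (he : e ∈ atlas Plane M) (he' : e' ∈ atlas Plane M) (hp : p ∈ e.source)
    (hp' : p ∈ e'.source) :
    LinLaw (fun c j => jacobian (e.symm.trans e') c j (e p)) (fun i => T.βComp e i (e p))
      fun i => T.βComp e' i (e' p) := by
  intro i
  simp only [T.βComp_apply_chart hp, T.βComp_apply_chart hp',
    coordField_eq_sum_jacobian he he' hp hp', Fin.sum_univ_two, map_add, map_smul, smul_eq_mul]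
  ring

theorem trilinLaw_CComp_re (he : e ∈ atlas Plane M) (he' : e' ∈ atlas Plane M)
    (hp : p ∈ e.source) (hp' : p ∈ e'.source) :
    TrilinLaw (fun c j => jacobian (e.symm.trans e') c j (e p))
      (fun i j k => (T.CComp e i j k (e p)).re) fun i j k => (T.CComp e' i j k (e' p)).re := by
  intro i j k
  simp only [T.CComp_apply_chart hp, T.CComp_apply_chart hp',
    coordField_eq_sum_jacobian he he' hp hp', trilinear_slot₁, trilinear_slot₂, trilinear_slot₃]
  simp only [Fin.sum_univ_two, Complex.add_re, Complex.mul_re, Complex.mul_im, Complex.add_im,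
    Complex.ofReal_re, Complex.ofReal_im]
  ring

/-- A triple is determined by its metric, its `1`-form and the real part of its cubic
differential. -/
theorem ext_of_comp {T T' : SurfaceTriple M}
    (hg : ∀ e ∈ atlas Plane M, ∀ x ∈ e.target, T.gComp e x = T'.gComp e x)
    (hβ : ∀ e ∈ atlas Plane M, ∀ x ∈ e.target, ∀ i, T.βComp e i x = T'.βComp e i x)
    (hC : ∀ e ∈ atlas Plane M, ∀ x ∈ e.target, ∀ i j k,
      (T.CComp e i j k x).re = (T'.CComp e i j k x).re) : T = T' := by
  have hc : ∀ p : M, chartAt Plane p ∈ atlas Plane M := chart_mem_atlas Plane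
  have hs : ∀ p : M, p ∈ (chartAt Plane p).source := mem_chart_source Plane
  have ht : ∀ p : M, chartAt Plane p p ∈ (chartAt Plane p).target := fun p =>
    (chartAt Plane p).map_source (hs p)
  have hC' : ∀ e ∈ atlas Plane M, ∀ x ∈ e.target, ∀ i j k,
      T.CComp e i j k x = T'.CComp e i j k x := by
    intro e he x hx i j k
    refine Complex.ext (hC e he x hx i j k) ?_
    rw [(T.isComplexCubic_CComp he hx).im_eq ((T.isMetricOn_gComp he).posDef x hx),
      (T'.isComplexCubic_CComp he hx).im_eq ((T'.isMetricOn_gComp he).posDef x hx)]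
    simp only [complexStructure_congr (hg e he x hx), hC e he x hx]
  have e1 : T.g.inner = T'.g.inner := by
    funext p
    ext v w
    rw [map_eq_sum_coordForm (hc p) (hs p) (T.g.inner p) v,
      map_eq_sum_coordForm (hc p) (hs p) (T'.g.inner p) v, _root_.sum_apply, _root_.sum_apply]
    refine Finset.sum_congr rfl fun i _ => ?_
    rw [_root_.smul_apply, _root_.smul_apply, map_eq_sum_coordForm (hc p) (hs p) _ w,
      map_eq_sum_coordForm (hc p) (hs p) (T'.g.inner p _) w]
    simp only [← T.gComp_apply_chart (hs p), ← T'.gComp_apply_chart (hs p), hg _ (hc p) _ (ht p)]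
  have e2 : T.β = T'.β := by
    refine ContMDiffSection.ext fun p => ?_
    ext v
    rw [map_eq_sum_coordForm (hc p) (hs p) (T.β p) v,
      map_eq_sum_coordForm (hc p) (hs p) (T'.β p) v]
    simp only [← T.βComp_apply_chart (hs p), ← T'.βComp_apply_chart (hs p), hβ _ (hc p) _ (ht p)]
  have e3 : T.C = T'.C := by
    funext p
    ext u v w
    rw [← sum_coordForm_smul_coordField (hc p) (hs p) u,
      ← sum_coordForm_smul_coordField (hc p) (hs p) v,
      ← sum_coordForm_smul_coordField (hc p) (hs p) w]
    simp only [trilinear_slot₁, trilinear_slot₂, trilinear_slot₃]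
    simp only [← T.CComp_apply_chart (hs p), ← T'.CComp_apply_chart (hs p), hC' _ (hc p) _ (ht p)]
  have e1' : T.g = T'.g := by
    cases h : T.g
    cases h' : T'.g
    rw [h, h'] at e1
    cases e1
    rfl
  cases T
  cases T'
  cases e1'
  cases e2
  cases e3
  rfl

theorem isTwistedConnection_iff {T : SurfaceTriple M} {D : AffineConnection M} :
    T.IsTwistedConnection D ↔ ∀ e ∈ atlas Plane M, ∀ x ∈ e.target, ∀ k i j,
      D.christoffel e k i j x = leviCivita (T.gComp e) k i j x
        + twistTensor (T.gComp e x) (fun l => T.βComp e l x)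
          (fun a b c => (T.CComp e a b c x).re) k i j := by
  have : ∀ e (x : Plane) (k i j : Fin 2), leviCivita (T.gComp e) k i j x
      + twistTensor (T.gComp e x) (fun l => T.βComp e l x)
          (fun a b c => (T.CComp e a b c x).re) k i j =
      leviCivita (T.gComp e) k i j x
        + T.gComp e x i j * ∑ l, (T.gComp e x)⁻¹ k l * T.βComp e l x
        - T.βComp e i x * (1 : Matrix (Fin 2) (Fin 2) ℝ) k j
        - (1 : Matrix (Fin 2) (Fin 2) ℝ) k i * T.βComp e j x
        + ∑ l, (T.gComp e x)⁻¹ k l * (T.CComp e i j l x).re := by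
    intro e x k i j
    rw [twistTensor]
    ring
  simp only [this]
  rfl

end SurfaceTriple

/-! ### The correspondence -/

theorem IsMetricOn.mono {G : Plane → Matrix (Fin 2) (Fin 2) ℝ} {U V : Set Plane}
    (h : IsMetricOn G U) (hV : V ⊆ U) : IsMetricOn G V :=
  ⟨fun i j => (h.smooth i j).mono hV, fun y hy => h.posDef y (hV hy)⟩

/-- Adding a tensor to a connection gives a connection. -/
theorem ChristoffelLaw.add {Γ Γ' A A' : Fin 2 → Fin 2 → Fin 2 → Plane → ℝ} {φ : Plane → Plane}
    {V : Set Plane} (h : ChristoffelLaw Γ Γ' φ V)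
    (hA : ∀ y ∈ V, DiffLaw (fun c j => jacobian φ c j y) (fun k i j => A k i j y)
      fun k i j => A' k i j (φ y)) :
    ChristoffelLaw (fun k i j y => Γ k i j y + A k i j y)
      (fun k i j y => Γ' k i j y + A' k i j y) φ V := by
  intro y hy c i j
  have h1 := h y hy c i j
  have h2 := hA y hy c i j
  simp only [Fin.sum_univ_two] at h1 h2 ⊢
  linear_combination h1 + h2

/-- The difference of two connections is a tensor. -/
theorem ChristoffelLaw.diffLaw_sub {Γ Γ' L L' : Fin 2 → Fin 2 → Fin 2 → Plane → ℝ}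
    {φ : Plane → Plane} {V : Set Plane} (h : ChristoffelLaw Γ Γ' φ V)
    (hL : ChristoffelLaw L L' φ V) {y : Plane} (hy : y ∈ V) :
    DiffLaw (fun c j => jacobian φ c j y) (fun k i j => Γ k i j y - L k i j y)
      fun k i j => Γ' k i j (φ y) - L' k i j (φ y) := by
  intro c i j
  have h1 := h y hy c i j
  have h2 := hL y hy c i j
  simp only [Fin.sum_univ_two] at h1 h2 ⊢
  linear_combination h1 - h2

theorem source_transition_subset {M : Type*} [TopologicalSpace M]
    (e e' : OpenPartialHomeomorph M Plane) : (e.symm.trans e').source ⊆ e.target :=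
  fun _ hy => by simpa using hy.1

section Global

variable {M : Type*} [TopologicalSpace M] [ChartedSpace Plane M] [IsManifold (𝓡 2) ∞ M]
  {τ : CausalType} {e e' : OpenPartialHomeomorph M Plane}

/-- Every triple has a twisted connection. -/
theorem SurfaceTriple.exists_isTwistedConnection [OrientedAtlas M] (T : SurfaceTriple M) :
    ∃ D : AffineConnection M, T.IsTwistedConnection D := by
  simp only [isTwistedConnection_iff]
  refine exists_affineConnection (Γ := fun e k i j x => leviCivita (T.gComp e) k i j x
    + twistTensor (T.gComp e x) (fun l => T.βComp e l x)
      (fun a b c => (T.CComp e a b c x).re) k i j) (fun e he k i j => ?_) fun e he e' he' => ?_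
  · exact ((T.isMetricOn_gComp he).smooth_leviCivita e.open_target k i j).add
      (smooth_twistTensor (R := fun a b c y => (T.CComp e a b c y).re) (T.isMetricOn_gComp he)
        (T.contDiffOn_βComp he)
        (fun i j k => Complex.reCLM.contDiff.comp_contDiffOn (T.contDiffOn_CComp he i j k)) k i j)
  · have hφ := isCoordChange_transition he he'
    have hs : ∀ y ∈ (e.symm.trans e').source, e.symm y ∈ e.source ∧ e.symm y ∈ e'.source ∧
        e (e.symm y) = y := fun y hy =>
      ⟨e.map_target (source_transition_subset e e' hy), hy.2,
        e.right_inv (source_transition_subset e e' hy)⟩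
    have hB : ∀ y ∈ (e.symm.trans e').source,
        BilinLaw (fun c j => jacobian (e.symm.trans e') c j y) (T.gComp e y)
          (T.gComp e' (e.symm.trans e' y)) := by
      intro y hy
      have h := T.bilinLaw_gComp he he' (hs y hy).1 (hs y hy).2.1
      rw [(hs y hy).2.2] at h
      exact h
    refine (christoffelLaw_leviCivita hφ
      ((T.isMetricOn_gComp he).mono (source_transition_subset e e')) (T.isMetricOn_gComp he')
      hB).add fun y hy => ?_
    have h2 := T.linLaw_βComp he he' (hs y hy).1 (hs y hy).2.1
    have h3 := T.trilinLaw_CComp_re he he' (hs y hy).1 (hs y hy).2.1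
    rw [(hs y hy).2.2] at h2 h3
    exact diffLaw_twistTensor (hφ.det_pos y hy).ne'
      ((T.isMetricOn_gComp he).posDef y (source_transition_subset e e' hy))
      ((T.isMetricOn_gComp he').posDef _ (hφ.mapsTo y hy)) (hB y hy) h2 h3

namespace AffineConnection

/-- The bilinear form `±Ric(∇)` in the chart `e`. -/
noncomputable def ricciMetric (D : AffineConnection M) (τ : CausalType)
    (e : OpenPartialHomeomorph M Plane) (y : Plane) : Matrix (Fin 2) (Fin 2) ℝ :=
  τ.sign • ricci (D.christoffel e) y

/-- The difference of `∇` and the Levi-Civita connection of `±Ric(∇)`; the first index is the upper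
one. -/
noncomputable def diffTensor (D : AffineConnection M) (τ : CausalType)
    (e : OpenPartialHomeomorph M Plane) (k i j : Fin 2) (y : Plane) : ℝ :=
  D.christoffel e k i j y - leviCivita (D.ricciMetric τ e) k i j y

/-- The `1`-form of a minimal connection, read off from the trace of `diffTensor`. -/
noncomputable def twistForm (D : AffineConnection M) (τ : CausalType)
    (e : OpenPartialHomeomorph M Plane) (j : Fin 2) (y : Plane) : ℝ :=
  -(1 / 2) * ∑ k, D.diffTensor τ e k k j y

/-- The real part of the cubic differential of a minimal connection: what remains of `diffTensor`,
with its index lowered, once the terms containing the `1`-form are removed. -/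
noncomputable def twistCubic (D : AffineConnection M) (τ : CausalType)
    (e : OpenPartialHomeomorph M Plane) (i j l : Fin 2) (y : Plane) : ℝ :=
  ∑ k, D.ricciMetric τ e y l k * D.diffTensor τ e k i j y
    - D.ricciMetric τ e y i j * D.twistForm τ e l y
    + D.twistForm τ e i y * D.ricciMetric τ e y l j
    + D.ricciMetric τ e y l i * D.twistForm τ e j y

variable {D : AffineConnection M}

theorem IsMinimalLagrangian.christoffel_symm (hD : D.IsMinimalLagrangian τ)
    (he : e ∈ atlas Plane M) {x : Plane} (hx : x ∈ e.target) (k i j : Fin 2) :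
    D.christoffel e k i j x = D.christoffel e k j i x :=
  D.isTorsionFree_iff.mp hD.torsionFree e he x hx k i j

theorem IsMinimalLagrangian.ricciSymm_eq (hD : D.IsMinimalLagrangian τ)
    (he : e ∈ atlas Plane M) {x : Plane} (hx : x ∈ e.target) :
    ricciSymm (D.christoffel e) x = τ.sign • D.ricciMetric τ e x := by
  rw [ricciMetric, smul_smul, τ.sign_mul_sign, one_smul,
    ricciSymm_of_isSymm (hD.lagrangian e he x hx)]

variable [T2Space M]

theorem IsMinimalLagrangian.isMetricOn (hD : D.IsMinimalLagrangian τ)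
    (he : e ∈ atlas Plane M) : IsMetricOn (D.ricciMetric τ e) e.target where
  posDef y hy := by
    have h := hD.ofType e he y hy
    rw [ricciSymm_of_isSymm (hD.lagrangian e he y hy)] at h
    exact h
  smooth i j := contDiffOn_const.mul
    (contDiffOn_ricci e.open_target (D.contDiffOn_christoffel he) i j)

theorem IsMinimalLagrangian.smooth_diffTensor (hD : D.IsMinimalLagrangian τ)
    (he : e ∈ atlas Plane M) (k i j : Fin 2) :
    ContDiffOn ℝ ∞ (D.diffTensor τ e k i j) e.target :=
  (D.contDiffOn_christoffel he k i j).sub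
    ((hD.isMetricOn he).smooth_leviCivita e.open_target k i j)

theorem IsMinimalLagrangian.smooth_twistForm (hD : D.IsMinimalLagrangian τ)
    (he : e ∈ atlas Plane M) (j : Fin 2) : ContDiffOn ℝ ∞ (D.twistForm τ e j) e.target :=
  contDiffOn_const.mul (ContDiffOn.sum fun k _ => hD.smooth_diffTensor he k k j)

theorem IsMinimalLagrangian.smooth_twistCubic (hD : D.IsMinimalLagrangian τ)
    (he : e ∈ atlas Plane M) (i j l : Fin 2) :
    ContDiffOn ℝ ∞ (D.twistCubic τ e i j l) e.target :=
  (((ContDiffOn.sum fun k _ => ((hD.isMetricOn he).smooth l k).mul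
    (hD.smooth_diffTensor he k i j)).sub
    (((hD.isMetricOn he).smooth i j).mul (hD.smooth_twistForm he l))).add
    ((hD.smooth_twistForm he i).mul ((hD.isMetricOn he).smooth l j))).add
    (((hD.isMetricOn he).smooth l i).mul (hD.smooth_twistForm he j))

/-- A minimal Lagrangian connection is twisted by `twistForm` and `twistCubic`. -/
theorem IsMinimalLagrangian.twisted (hD : D.IsMinimalLagrangian τ) (he : e ∈ atlas Plane M)
    {x : Plane} (hx : x ∈ e.target) :
    IsHarmonicCubic (D.ricciMetric τ e x) (fun i j k => D.twistCubic τ e i j k x) ∧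
      ∀ k i j, D.diffTensor τ e k i j x = twistTensor (D.ricciMetric τ e x)
        (fun l => D.twistForm τ e l x) (fun a b c => D.twistCubic τ e a b c x) k i j :=
  twisted_of_minimal (A := fun k i j => D.diffTensor τ e k i j x) (hD.isMetricOn he)
    e.open_target hx (D.contDiffOn_christoffel he)
    (hD.christoffel_symm he hx) τ.sign_ne_zero (fun _ hy => hD.ricciSymm_eq he hy)
    (hD.minimal e he x hx) (fun _ _ _ => rfl) (fun _ => rfl) fun _ _ _ => rfl

section Laws

variable [OrientedAtlas M] {y : Plane} (he : e ∈ atlas Plane M) (he' : e' ∈ atlas Plane M)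
  (hy : y ∈ (e.symm.trans e').source)
include he he' hy

theorem bilinLaw_ricciMetric :
    BilinLaw (fun c j => jacobian (e.symm.trans e') c j y) (D.ricciMetric τ e y)
      (D.ricciMetric τ e' (e.symm.trans e' y)) := by
  have hφ := isCoordChange_transition he he'
  have h := (D.christoffelLaw he he').ricci hφ hy
    (fun k i j => (D.contDiffOn_christoffel he k i j).differentiableAt_of_mem e.open_target
      (source_transition_subset e e' hy))
    (fun k i j => (D.contDiffOn_christoffel he' k i j).differentiableAt_of_mem e'.open_target
      (hφ.mapsTo y hy))
  intro i j
  have hij := h i j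
  simp only [ricciMetric, Matrix.smul_apply, smul_eq_mul, Fin.sum_univ_two] at hij ⊢
  rw [hij]
  ring

variable (hD : D.IsMinimalLagrangian τ)
include hD

theorem IsMinimalLagrangian.diffLaw :
    DiffLaw (fun c j => jacobian (e.symm.trans e') c j y) (fun k i j => D.diffTensor τ e k i j y)
      fun k i j => D.diffTensor τ e' k i j (e.symm.trans e' y) :=
  (D.christoffelLaw he he').diffLaw_sub
    (christoffelLaw_leviCivita (isCoordChange_transition he he')
      ((hD.isMetricOn he).mono (source_transition_subset e e')) (hD.isMetricOn he')
      fun _ hz => bilinLaw_ricciMetric he he' hz) hy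

theorem IsMinimalLagrangian.linLaw :
    LinLaw (fun c j => jacobian (e.symm.trans e') c j y) (fun j => D.twistForm τ e j y)
      fun j => D.twistForm τ e' j (e.symm.trans e' y) := by
  intro i
  have h := (hD.diffLaw he he' hy).trace
    ((isCoordChange_transition he he').det_pos y hy).ne' i
  simp only [twistForm, Fin.sum_univ_two] at h ⊢
  rw [h]
  ring

theorem IsMinimalLagrangian.trilinLaw :
    TrilinLaw (fun c j => jacobian (e.symm.trans e') c j y)
      (fun i j k => D.twistCubic τ e i j k y)
      fun i j k => D.twistCubic τ e' i j k (e.symm.trans e' y) := by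
  intro i j l
  have hB := bilinLaw_ricciMetric (D := D) (τ := τ) he he' hy
  have hL : ∀ i, D.twistForm τ e i y = ∑ a, D.twistForm τ e' a (e.symm.trans e' y)
      * jacobian (e.symm.trans e') a i y := hD.linLaw he he' hy
  have h := (hD.diffLaw he he' hy).lower hB i j l
  simp only [twistCubic]
  simp only at h
  rw [h, hB i j, hB l j, hB l i, hL i, hL j, hL l]
  simp only [Fin.sum_univ_two]
  ring

end Laws

/-- A minimal Lagrangian connection is the twisted connection of the triple that it induces. -/
theorem IsMinimalLagrangian.exists_triple [OrientedAtlas M] (hD : D.IsMinimalLagrangian τ) :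
    ∃ T : SurfaceTriple M, T.IsInducedBy D τ ∧ T.IsTwistedConnection D := by
  obtain ⟨g, hg⟩ := exists_metric (G := D.ricciMetric τ) (fun e he => hD.isMetricOn he)
    fun e he e' he' y hy => bilinLaw_ricciMetric he he' hy
  obtain ⟨β, hβ⟩ := exists_oneForm (B := D.twistForm τ) (fun e he => hD.smooth_twistForm he)
    fun e he e' he' y hy => hD.linLaw he he' hy
  set C : OpenPartialHomeomorph M Plane → Fin 2 → Fin 2 → Fin 2 → Plane → ℂ := fun e i j k y =>
    complexCubic (fun m a => complexStructure (D.ricciMetric τ e) m a y)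
      (fun a b c => D.twistCubic τ e a b c y) i j k with hCdef
  obtain ⟨c, hc⟩ := exists_trilinear (C := C) fun e he e' he' y hy i j k =>
    complexCubic_natural ((isCoordChange_transition he he').det_pos y hy)
      ((hD.isMetricOn he').posDef _ ((isCoordChange_transition he he').mapsTo y hy))
      (bilinLaw_ricciMetric he he' hy) (hD.trilinLaw he he' hy) i j k
  have hcub : ∀ e ∈ atlas Plane M, ∀ x ∈ e.target,
      IsComplexCubic (D.ricciMetric τ e x) fun i j k => C e i j k x := fun e he x hx =>
    isComplexCubic_complexCubic ((hD.isMetricOn he).posDef x hx) (hD.twisted he hx).1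
  have hCs : ∀ e ∈ atlas Plane M, ∀ i j k, ContDiffOn ℝ ∞ (C e i j k) e.target := by
    intro e he i j k
    have hof : ∀ {f : Plane → ℝ}, ContDiffOn ℝ ∞ f e.target →
        ContDiffOn ℝ ∞ (fun y => (f y : ℂ)) e.target := fun hf =>
      Complex.ofRealCLM.contDiff.comp_contDiffOn hf
    exact (hof (hD.smooth_twistCubic he i j k)).sub (contDiffOn_const.mul
      (ContDiffOn.sum fun m _ => (hof ((hD.isMetricOn he).smooth_complexStructure m i)).mul
        (hof (hD.smooth_twistCubic he m j k))))
  refine ⟨⟨g, β, c, fun e he i j k => (hCs e he i j k).congr fun x hx => hc e he x hx i j k,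
    fun e he x hx u v w => ?_⟩, ?_⟩
  · have hp := (hD.isMetricOn he).posDef x hx
    have hH := hcub e he x hx
    intro J d
    simp only [J, d, complexStructure_congr (hg e he x hx)]
    refine ⟨(trilinear_slot₁ _ _ _ _ _).trans ?_, (trilinear_slot₂ _ _ _ _ _).trans ?_,
      (trilinear_slot₃ _ _ _ _ _).trans ?_⟩
    · simp only [hc e he x hx]
      exact hH.complexStructure_slot₁ hp u v w
    · simp only [hc e he x hx]
      exact hH.complexStructure_slot₂ hp u v w
    · simp only [hc e he x hx]
      exact hH.complexStructure_slot₃ hp u v w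
  set T : SurfaceTriple M := ⟨g, β, c, _, _⟩ with hT
  have hTg : ∀ e ∈ atlas Plane M, ∀ x ∈ e.target, T.gComp e x = D.ricciMetric τ e x := hg
  have hTβ : ∀ e ∈ atlas Plane M, ∀ x ∈ e.target, ∀ i, T.βComp e i x = D.twistForm τ e i x := hβ
  have hTC : ∀ e ∈ atlas Plane M, ∀ x ∈ e.target, ∀ i j k,
      (T.CComp e i j k x).re = D.twistCubic τ e i j k x := by
    intro e he x hx i j k
    have h : T.CComp e i j k x = C e i j k x := hc e he x hx i j k
    rw [h, hCdef, complexCubic_re]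
  have htw : T.IsTwistedConnection D := by
    refine SurfaceTriple.isTwistedConnection_iff.mpr fun e he x hx k i j => ?_
    have h := (hD.twisted he hx).2 k i j
    rw [diffTensor] at h
    rw [(hD.isMetricOn he).leviCivita_congr e.open_target hx (hTg e he)]
    simp only [hTg e he x hx, hTβ e he x hx, hTC e he x hx]
    linarith
  have htw' := SurfaceTriple.isTwistedConnection_iff.mp htw
  refine ⟨⟨hTg, fun e he x hx k => ?_, fun e he x hx i j k => ?_⟩, htw⟩
  · exact (induced_oneForm (T.isMetricOn_gComp he) e.open_target hx
      (T.isComplexCubic_CComp he hx) (htw' e he x hx) k).symm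
  · exact (induced_cubic (T.isMetricOn_gComp he) e.open_target hx
      (T.isComplexCubic_CComp he hx) (htw' e he x hx) i j k).symm

end AffineConnection

namespace SurfaceTriple

variable {T T' : SurfaceTriple M} {D : AffineConnection M}

/-- A connection induces at most one triple. -/
theorem IsInducedBy.unique (h : T.IsInducedBy D τ) (h' : T'.IsInducedBy D τ) : T = T' := by
  have hg : ∀ e ∈ atlas Plane M, ∀ x ∈ e.target, T.gComp e x = T'.gComp e x :=
    fun e he x hx => (h.metric e he x hx).trans (h'.metric e he x hx).symm
  have hcov : ∀ e ∈ atlas Plane M, ∀ x ∈ e.target, ∀ k i j,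
      covDerivMetric (D.christoffel e) (T.gComp e) k i j x =
        covDerivMetric (D.christoffel e) (T'.gComp e) k i j x := fun e he x hx k i j =>
    covDerivMetric_congr e.open_target hx (hg e he) k i j
  refine ext_of_comp hg (fun e he x hx k => ?_) fun e he x hx i j k => ?_
  · rw [h.oneForm e he x hx, h'.oneForm e he x hx, hg e he x hx]
    simp only [hcov e he x hx]
  · rw [h.cubic e he x hx, h'.cubic e he x hx, hg e he x hx]
    simp only [hcov e he x hx]

/-- A twisted connection satisfies `Ric(∇) = ±g` iff the triple satisfies the structure
equations. -/
theorem IsTwistedConnection.structureEquations_iff (h : T.IsTwistedConnection D) :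
    T.StructureEquations τ ↔ ∀ e ∈ atlas Plane M, ∀ x ∈ e.target,
      ricci (D.christoffel e) x = τ.sign • T.gComp e x := by
  have key : ∀ e (he : e ∈ atlas Plane M) x (hx : x ∈ e.target), _ := fun e he x hx =>
    ricci_eq_smul_iff (T.isMetricOn_gComp he) e.open_target hx (T.contDiffOn_βComp he)
      (T.contDiffOn_CComp he) (fun _ hy => T.isComplexCubic_CComp he hy)
      (isTwistedConnection_iff.mp h e he) τ.sign
  constructor
  · exact fun hT e he x hx => (key e he x hx).mpr
      ⟨hT.gauss e he x hx, hT.delbar_eq e he x hx, hT.closed e he x hx⟩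
  · exact fun hR => ⟨fun e he x hx => ((key e he x hx).mp (hR e he x hx)).1,
      fun e he x hx => ((key e he x hx).mp (hR e he x hx)).2.1,
      fun e he x hx => ((key e he x hx).mp (hR e he x hx)).2.2⟩

/-- A triple has at most one twisted connection. -/
theorem IsTwistedConnection.unique {D' : AffineConnection M} (h : T.IsTwistedConnection D)
    (h' : T.IsTwistedConnection D') : D = D' :=
  AffineConnection.ext_of_christoffel fun e he x hx k i j =>
    (h e he x hx k i j).trans (h' e he x hx k i j).symm

variable [T2Space M]

/-- The twisted connection of a solution of the structure equations is minimal Lagrangian and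
induces the triple. -/
theorem IsTwistedConnection.isMinimalLagrangian (h : T.IsTwistedConnection D)
    (hT : T.StructureEquations τ) : D.IsMinimalLagrangian τ ∧ T.IsInducedBy D τ := by
  have hΓ := isTwistedConnection_iff.mp h
  have hR := h.structureEquations_iff.mp hT
  have hsymm : ∀ e ∈ atlas Plane M, ∀ x ∈ e.target, (ricci (D.christoffel e) x).IsSymm := by
    intro e he x hx
    rw [hR e he x hx]
    refine Matrix.IsSymm.ext fun i j => ?_
    rw [Matrix.smul_apply, Matrix.smul_apply, (T.isMetricOn_gComp he).comm hx]
  have hRs : ∀ e ∈ atlas Plane M, ∀ x ∈ e.target,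
      ricciSymm (D.christoffel e) x = τ.sign • T.gComp e x := fun e he x hx =>
    (ricciSymm_of_isSymm (hsymm e he x hx)).trans (hR e he x hx)
  refine ⟨⟨D.isTorsionFree_iff.mpr fun e he x hx k i j => ?_, hsymm, fun e he x hx => ?_,
    fun e he x hx μ => ?_⟩, fun e he x hx => ?_, fun e he x hx k => ?_, fun e he x hx i j k => ?_⟩
  · have hg := T.isMetricOn_gComp he
    rw [hΓ e he x hx, hΓ e he x hx, hg.leviCivita_comm e.open_target hx k i j,
      twistTensor_comm (hg.posDef x hx)
        ((T.isComplexCubic_CComp he hx).isHarmonicCubic_re (hg.posDef x hx)) k i j]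
  · rw [hRs e he x hx, smul_smul, τ.sign_mul_sign, one_smul]
    exact (T.isMetricOn_gComp he).posDef x hx
  · exact twisted_minimal (T.isMetricOn_gComp he) e.open_target hx (D.contDiffOn_christoffel he)
      (fun _ hy => T.isComplexCubic_CComp he hy) (hΓ e he) τ.sign_ne_zero (hRs e he) μ
  · rw [hR e he x hx, smul_smul, τ.sign_mul_sign, one_smul]
  · exact (induced_oneForm (T.isMetricOn_gComp he) e.open_target hx
      (T.isComplexCubic_CComp he hx) (hΓ e he x hx) k).symm
  · exact (induced_cubic (T.isMetricOn_gComp he) e.open_target hx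
      (T.isComplexCubic_CComp he hx) (hΓ e he x hx) i j k).symm

/-- A minimal Lagrangian connection is the twisted connection of the triple that it induces, and
that triple satisfies the structure equations. -/
theorem IsInducedBy.isTwistedConnection [OrientedAtlas M] (h : T.IsInducedBy D τ)
    (hD : D.IsMinimalLagrangian τ) : T.IsTwistedConnection D ∧ T.StructureEquations τ := by
  obtain ⟨T₀, h₀, htw⟩ := hD.exists_triple
  obtain rfl := h.unique h₀
  refine ⟨htw, htw.structureEquations_iff.mpr fun e he x hx => ?_⟩
  rw [h.metric e he x hx, smul_smul, τ.sign_mul_sign, one_smul]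

end SurfaceTriple

end Global

theorem mainTheorem4 {M : Type*} [TopologicalSpace M] [T2Space M] [SecondCountableTopology M]
    [ChartedSpace Plane M] [IsManifold (𝓡 2) ∞ M] [OrientedAtlas M] (τ : CausalType) :
    ∃ Φ : {D : AffineConnection M // D.IsMinimalLagrangian τ} ≃
        {T : SurfaceTriple M // T.StructureEquations τ},
      (∀ D, (Φ D).1.IsInducedBy D.1 τ) ∧
      (∀ T, T.1.IsTwistedConnection (Φ.symm T).1 ∧
        ∀ e ∈ atlas Plane M, ∀ x ∈ e.target,
          ricci ((Φ.symm T).1.christoffel e) x = τ.sign • T.1.gComp e x) := by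
  choose t ht using fun D : {D : AffineConnection M // D.IsMinimalLagrangian τ} =>
    D.2.exists_triple
  choose d hd using fun T : {T : SurfaceTriple M // T.StructureEquations τ} =>
    T.1.exists_isTwistedConnection
  have hmin := fun T => (hd T).isMinimalLagrangian T.2
  refine ⟨⟨fun D => ⟨t D, ((ht D).1.isTwistedConnection D.2).2⟩, fun T => ⟨d T, (hmin T).1⟩,
    fun D => Subtype.ext ((hd _).unique (ht D).2),
    fun T => Subtype.ext ((ht _).1.unique (hmin T).2)⟩, fun D => (ht D).1,
    fun T => ⟨hd T, (hd T).structureEquations_iff.mp T.2⟩⟩
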